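/- Let $G$ be a finite connected simple bipartite graph with $n$ vertices and maximum degree $\Delta\geqslant 3$, let $\lambda_1\geqslant\cdots\geqslant\lambda_n$ be the eigenvalues of its adjacency matrix, counted with multiplicity, and let $$R(G)=\max\left\{|\lambda_{\lfloor (n+1)/2\rfloor}|,\ |\lambda_{\lceil (n+1)/2\rceil}|\right\}$$ be its HL-index. If $G$ is not isomorphic to the incidence graph of a projective plane of order $\Delta-1$, then $R(G)\leqslant\sqrt{\Delta-2}$. If $G$ is isomorphic to the incidence graph of a projective plane of order $\Delta-1$, then $R(G)=\sqrt{\Delta-1}$. Here the incidence graph of a projective plane has the points and the lines as its vertices, a point and a line being adjacent exactly when the point lies on the line, and a projective plane has order $q$ if every point lies on exactly $q+1$ lines. -/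

import Mathlib

namespace SimpleGraph

/-- The bipartite incidence graph of a point-line configuration: its vertices are the points and
the lines, and a point is adjacent to a line when it lies on it. -/
def pointLineGraph (P L : Type*) [Membership P L] : SimpleGraph (P ⊕ L) where
  Adj
    | Sum.inl p, Sum.inr l => p ∈ l
    | Sum.inr l, Sum.inl p => p ∈ l
    | _, _ => False
  symm := ⟨by
    rintro (p | l) (q | m) h
    · exact h
    · exact h
    · exact h
    · exact h⟩
  loopless := ⟨by
    rintro (p | l) h
    · exact h
    · exact h⟩

/-- `G` is (isomorphic to) the incidence graph of a finite projective plane of order `q`, that is,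
a plane in which every point lies on `q + 1` lines. -/
def IsProjectivePlaneIncidenceGraph.{u} {V : Type u} (G : SimpleGraph V) (q : ℕ) : Prop :=
  ∃ (P L : Type u) (_ : Finite P) (_ : Finite L) (_ : Membership P L)
    (_ : Configuration.ProjectivePlane P L),
    Configuration.ProjectivePlane.order P L = q ∧ Nonempty (G ≃g pointLineGraph P L)

variable {V : Type*} [Fintype V] [DecidableEq V] (G : SimpleGraph V) [DecidableRel G.Adj]

/-- The `i`-th largest adjacency eigenvalue, counted with multiplicity and indexed from `1`, so that
`G.adjEigenvalue 1 ≥ ⋯ ≥ G.adjEigenvalue n` for a graph with `n` vertices (and `0` for other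
indices, which the HL-index of a nonempty graph does not use). -/
noncomputable def adjEigenvalue (i : ℕ) : ℝ :=
  if h : 1 ≤ i ∧ i ≤ Fintype.card V then
    (G.isHermitian_adjMatrix ℝ).eigenvalues₀ ⟨i - 1, by omega⟩
  else 0

/-- The HL-index `max {|λ_⌊(n+1)/2⌋|, |λ_⌈(n+1)/2⌉|}` of a graph with `n` vertices. -/
noncomputable def hlIndex : ℝ :=
  max |G.adjEigenvalue ⌊((Fintype.card V : ℝ) + 1) / 2⌋₊|
    |G.adjEigenvalue ⌈((Fintype.card V : ℝ) + 1) / 2⌉₊|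

end SimpleGraph

/-! Suppose that the index exceeds √(Δ - 2). The spectrum of a bipartite graph is symmetric about 0,
so a middle eigenvalue of modulus above r forces every eigenvalue to have modulus above r. Hence A²
- (Δ - 2) is positive definite (`IsBipartite.lt_of_lt_hlIndex`). Its diagonal entries are the
degrees minus Δ - 2, and its other entries count common neighbours. Evaluating the form on short
integer combinations of basis vectors shows that two vertices share at most one neighbour
(`linear_of_sqForm_pos`) and that all degrees equal Δ (`degree_eq_of_sqForm_pos`). The form is then
2 plus the adjacency matrix of `squareGraph`, and the basis vectors are linearly independent vectors
of norm 2 representing that graph.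

The heart of the proof is `Linear.squareGraph_trans`: the square graph is a disjoint union of
cliques. To exclude a configuration, vectors are projected to the orthogonal complement of a claw (a
D₄ system) or of an induced path (an A₃ system). Their inner products then take very few values, and
either strict Cauchy-Schwarz or an explicit combination of norm at most 0 contradicts independence.
This yields claw-freeness (`clawFree_of_regular`) and at most two common neighbours for non-adjacent
vertices (`card_common_le_two`). The rest is incidence geometry in which each vertex of G is a point
and also a line, namely the set of its neighbours. By connectedness each colour class is a single
clique, so any two points are joined, any two lines meet, and G comes from a plane
(`isProjectivePlaneIncidenceGraph_of_linear`).

For a plane of order q, A² - q is the all-ones matrix on each of the two sides and 0 between them.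
It is positive semidefinite and singular, which gives the index √q (`hlIndex_eq_sqrt`). -/

/-! ### Spectra of real symmetric matrices -/

open Matrix in
theorem Matrix.IsHermitian.roots_charpoly_neg {n : Type*} [Fintype n] [DecidableEq n]
    {A : Matrix n n ℝ} (hA : A.IsHermitian) :
    (-A).charpoly.roots = (A.charpoly.roots).map (fun t => -t) := by
  have h : (-A).charpoly = ∏ i, (Polynomial.X - Polynomial.C (-hA.eigenvalues i)) := by
    conv_lhs => rw [hA.spectral_theorem, Unitary.conjStarAlgAut_apply, ← neg_mul,
      ← mul_neg, Matrix.charpoly_mul_comm, ← mul_assoc]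
    rw [Matrix.diagonal_neg]
    simp [charpoly_diagonal]
  rw [h, Polynomial.roots_prod, hA.roots_charpoly_eq_eigenvalues]
  · simp
  · simp only [Finset.prod_ne_zero_iff]
    exact fun i _ => Polynomial.X_sub_C_ne_zero _

open Matrix in
/-- If `A` and `-A` have the same characteristic polynomial then the spectrum of `A` is symmetric
with respect to the origin. -/
theorem Matrix.IsHermitian.card_eigenvalues₀_lt_neg {n : Type*} [Fintype n] [DecidableEq n]
    {A : Matrix n n ℝ} (hA : A.IsHermitian) (hneg : (-A).charpoly = A.charpoly) (r : ℝ) :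
    (Finset.univ.filter fun i => hA.eigenvalues₀ i < -r).card =
      (Finset.univ.filter fun i => r < hA.eigenvalues₀ i).card := by
  have h := hA.roots_charpoly_neg
  rw [hneg, hA.roots_charpoly_eq_eigenvalues₀, Multiset.map_map] at h
  have h' := congrArg (Multiset.countP (fun t => t < -r)) h
  simp only [Multiset.countP_map, Function.comp_apply, neg_lt_neg_iff] at h'
  exact h'

open Matrix in
theorem Matrix.IsHermitian.dotProduct_eigenvectorBasis_mulVec {n : Type*} [Fintype n]
    [DecidableEq n] {A : Matrix n n ℝ} (hA : A.IsHermitian) (i : n) (x : n → ℝ) :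
    ⇑(hA.eigenvectorBasis i) ⬝ᵥ (A *ᵥ x) =
      hA.eigenvalues i * (⇑(hA.eigenvectorBasis i) ⬝ᵥ x) := by
  have hT : Aᵀ = A := by simpa [Matrix.IsHermitian, conjTranspose_eq_transpose_of_trivial] using hA
  rw [dotProduct_mulVec, ← mulVec_transpose, hT, hA.mulVec_eigenvectorBasis, smul_dotProduct,
    smul_eq_mul]

open Matrix in
theorem Matrix.IsHermitian.dotProduct_self_eq_sum {n : Type*} [Fintype n]
    [DecidableEq n] {A : Matrix n n ℝ} (hA : A.IsHermitian) (x : n → ℝ) :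
    x ⬝ᵥ x = ∑ i, (⇑(hA.eigenvectorBasis i) ⬝ᵥ x) ^ 2 := by
  have h := hA.eigenvectorBasis.sum_sq_norm_inner_right (WithLp.toLp 2 x)
  have h2 : ‖(WithLp.toLp 2 x : EuclideanSpace ℝ n)‖ ^ 2 = x ⬝ᵥ x := by
    rw [← real_inner_self_eq_norm_sq, EuclideanSpace.inner_eq_star_dotProduct]
    simp
  rw [← h2, ← h]
  refine Finset.sum_congr rfl fun i _ => ?_
  rw [EuclideanSpace.inner_eq_star_dotProduct, Real.norm_eq_abs, sq_abs]
  simp [dotProduct_comm]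

-- In an orthonormal eigenbasis the squared coordinates of A x are those of x multiplied by the
-- squared eigenvalues, and some coordinate of x is nonzero.
open Matrix in
theorem Matrix.IsHermitian.lt_dotProduct_mulVec_self {n : Type*} [Fintype n]
    [DecidableEq n] {A : Matrix n n ℝ} (hA : A.IsHermitian) {r : ℝ} (hr : 0 ≤ r)
    (h : ∀ i, r < |hA.eigenvalues₀ i|) {x : n → ℝ} (hx : x ≠ 0) :
    r ^ 2 * (x ⬝ᵥ x) < (A *ᵥ x) ⬝ᵥ (A *ᵥ x) := by
  have hl : ∀ i, r ^ 2 < hA.eigenvalues i ^ 2 := fun i => by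
    rw [sq_lt_sq, abs_of_nonneg hr]
    exact h _
  rw [hA.dotProduct_self_eq_sum x, hA.dotProduct_self_eq_sum (A *ᵥ x), Finset.mul_sum]
  simp only [hA.dotProduct_eigenvectorBasis_mulVec, mul_pow]
  have hne : ∃ i, (⇑(hA.eigenvectorBasis i) ⬝ᵥ x) ≠ 0 := by
    by_contra! hc
    apply hx
    have := hA.dotProduct_self_eq_sum x
    simp only [hc] at this
    simpa using this
  obtain ⟨i, hi⟩ := hne
  refine Finset.sum_lt_sum (fun j _ => ?_) ⟨i, Finset.mem_univ _, ?_⟩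
  · exact mul_le_mul_of_nonneg_right (hl j).le (sq_nonneg _)
  · exact mul_lt_mul_of_pos_right (hl i) (by positivity)

open Matrix in
theorem Matrix.IsHermitian.le_abs_eigenvalues₀ {n : Type*} [Fintype n]
    [DecidableEq n] {A : Matrix n n ℝ} (hA : A.IsHermitian) {r : ℝ} (hr : 0 ≤ r)
    (h : ∀ x : n → ℝ, r ^ 2 * (x ⬝ᵥ x) ≤ (A *ᵥ x) ⬝ᵥ (A *ᵥ x)) (i : Fin (Fintype.card n)) :
    r ≤ |hA.eigenvalues₀ i| := by
  obtain ⟨j, hj⟩ : ∃ j, hA.eigenvalues j = hA.eigenvalues₀ i :=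
    ⟨(Fintype.equivOfCardEq (Fintype.card_fin _)) i, by simp [Matrix.IsHermitian.eigenvalues]⟩
  rw [← hj]
  have h1 := h (⇑(hA.eigenvectorBasis j))
  rw [hA.mulVec_eigenvectorBasis, smul_dotProduct, dotProduct_smul] at h1
  have h2 : ⇑(hA.eigenvectorBasis j) ⬝ᵥ ⇑(hA.eigenvectorBasis j) = 1 := by
    have := hA.eigenvectorBasis.orthonormal.1 j
    have h3 : ‖hA.eigenvectorBasis j‖ ^ 2 = 1 := by rw [this]; norm_num
    rw [← real_inner_self_eq_norm_sq, EuclideanSpace.inner_eq_star_dotProduct] at h3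
    simpa using h3
  rw [h2] at h1
  rw [← sq_le_sq₀ hr (abs_nonneg _), sq_abs]
  simpa [sq] using h1

/-! ### The middle eigenvalues of a bipartite graph -/

namespace SimpleGraph

-- Conjugation by the diagonal matrix of signs of the two colour classes turns A into -A.
open Matrix in
theorem IsBipartite.charpoly_neg_adjMatrix {V : Type*} [Fintype V] [DecidableEq V]
    {G : SimpleGraph V} [DecidableRel G.Adj] (hG : G.IsBipartite) :
    (-(G.adjMatrix ℝ)).charpoly = (G.adjMatrix ℝ).charpoly := by
  obtain ⟨c⟩ := hG
  let s : V → ℝ := fun v => if c v = 0 then 1 else -1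
  have hs : ∀ v, s v * s v = 1 := fun v => by simp only [s]; split_ifs <;> norm_num
  have h1 : -(G.adjMatrix ℝ) = diagonal s * (G.adjMatrix ℝ * diagonal s) := by
    ext u v
    simp only [Matrix.neg_apply, diagonal_mul, mul_diagonal, adjMatrix_apply]
    split_ifs with h
    · have := c.valid h
      simp only [s]
      have h0 : ∀ k : Fin 2, k = 0 ∨ k = 1 := by decide
      rcases h0 (c u) with hu | hu <;> rcases h0 (c v) with hv | hv <;> simp_all
    · simp
  rw [h1, charpoly_mul_comm, mul_assoc, diagonal_mul_diagonal]
  simp [hs]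

variable {V : Type*} [Fintype V] [DecidableEq V] {G : SimpleGraph V} [DecidableRel G.Adj]

theorem floor_add_one_half (n : ℕ) : ⌊((n : ℝ) + 1) / 2⌋₊ = (n + 1) / 2 := by
  have := Nat.floor_div_eq_div (K := ℝ) (n + 1) 2
  push_cast at this
  exact this

theorem ceil_add_one_half (n : ℕ) : ⌈((n : ℝ) + 1) / 2⌉₊ = (n + 2) / 2 := by
  rcases Nat.even_or_odd' n with ⟨k, rfl | rfl⟩
  · have h : (2 * k + 2) / 2 = k + 1 := by omega
    rw [h, Nat.ceil_eq_iff (by omega)]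
    push_cast
    constructor <;> linarith
  · have h : (2 * k + 1 + 2) / 2 = k + 1 := by omega
    rw [h, Nat.ceil_eq_iff (by omega)]
    push_cast
    constructor <;> linarith

theorem adjEigenvalue_of_lt {i : ℕ} (hi : i < Fintype.card V) :
    G.adjEigenvalue (i + 1) = (G.isHermitian_adjMatrix ℝ).eigenvalues₀ ⟨i, hi⟩ := by
  rw [adjEigenvalue, dif_pos ⟨by omega, by omega⟩]
  rfl

theorem adjEigenvalue_zero : G.adjEigenvalue 0 = 0 := by simp [adjEigenvalue]

theorem le_card_lt_eigenvalues₀ {r : ℝ} {i : ℕ} (hi : i < Fintype.card V)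
    (h : r < (G.isHermitian_adjMatrix ℝ).eigenvalues₀ ⟨i, hi⟩) :
    i + 1 ≤ (Finset.univ.filter fun j => r < (G.isHermitian_adjMatrix ℝ).eigenvalues₀ j).card := by
  have hsub : Finset.Iic (⟨i, hi⟩ : Fin (Fintype.card V)) ⊆
      Finset.univ.filter fun j => r < (G.isHermitian_adjMatrix ℝ).eigenvalues₀ j := by
    intro j hj
    rw [Finset.mem_Iic] at hj
    simpa using h.trans_le ((G.isHermitian_adjMatrix ℝ).eigenvalues₀_antitone hj)
  simpa using Finset.card_le_card hsub

theorem le_card_eigenvalues₀_lt {r : ℝ} {i : ℕ} (hi : i < Fintype.card V)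
    (h : (G.isHermitian_adjMatrix ℝ).eigenvalues₀ ⟨i, hi⟩ < r) :
    Fintype.card V - i ≤
      (Finset.univ.filter fun j => (G.isHermitian_adjMatrix ℝ).eigenvalues₀ j < r).card := by
  have hsub : Finset.Ici (⟨i, hi⟩ : Fin (Fintype.card V)) ⊆
      Finset.univ.filter fun j => (G.isHermitian_adjMatrix ℝ).eigenvalues₀ j < r := by
    intro j hj
    rw [Finset.mem_Ici] at hj
    simpa using ((G.isHermitian_adjMatrix ℝ).eigenvalues₀_antitone hj).trans_lt h
  simpa using Finset.card_le_card hsub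

/-- With the 0-based index i in the middle, an eigenvalue above r gives at least i + 1 eigenvalues
above r, and one below -r gives at least n - i below -r. By symmetry the other tail is equally
large, so the two disjoint tails contain all n eigenvalues. -/
theorem IsBipartite.lt_abs_eigenvalues₀ (hG : G.IsBipartite) {r : ℝ} (hr : 0 ≤ r) {i : ℕ}
    (hi : i < Fintype.card V) (hi1 : Fintype.card V ≤ 2 * (i + 1)) (hi2 : 2 * i ≤ Fintype.card V)
    (h : r < |(G.isHermitian_adjMatrix ℝ).eigenvalues₀ ⟨i, hi⟩|) (j : Fin (Fintype.card V)) :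
    r < |(G.isHermitian_adjMatrix ℝ).eigenvalues₀ j| := by
  set hA := G.isHermitian_adjMatrix ℝ
  set S := Finset.univ.filter fun j => r < hA.eigenvalues₀ j with hS
  set T := Finset.univ.filter fun j => hA.eigenvalues₀ j < -r with hT
  have hST : T.card = S.card := hA.card_eigenvalues₀_lt_neg hG.charpoly_neg_adjMatrix r
  have hdisj : Disjoint S T := by
    rw [Finset.disjoint_left]
    intro k hk hk'
    simp only [hS, hT, Finset.mem_filter, Finset.mem_univ, true_and] at hk hk'
    linarith
  have hcard : Fintype.card V ≤ (S ∪ T).card := by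
    rw [Finset.card_union_of_disjoint hdisj]
    rcases lt_abs.1 h with h | h
    · have := le_card_lt_eigenvalues₀ hi h
      change i + 1 ≤ S.card at this
      omega
    · have := le_card_eigenvalues₀_lt (r := -r) hi (by linarith)
      change _ ≤ T.card at this
      omega
  have huniv : S ∪ T = Finset.univ := by
    rw [← Finset.card_eq_iff_eq_univ]
    refine le_antisymm (Finset.card_le_univ _) (by simpa using hcard)
  have hj : j ∈ S ∪ T := by rw [huniv]; exact Finset.mem_univ _
  simp only [hS, hT, Finset.mem_union, Finset.mem_filter, Finset.mem_univ, true_and] at hj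
  rcases hj with hj | hj
  · exact lt_abs.2 (Or.inl hj)
  · exact lt_abs.2 (Or.inr (by linarith))

open Matrix in
theorem IsBipartite.lt_of_lt_hlIndex (hG : G.IsBipartite) {r : ℝ} (hr : 0 ≤ r)
    (h : r < G.hlIndex) {x : V → ℝ} (hx : x ≠ 0) :
    r ^ 2 * (x ⬝ᵥ x) < (G.adjMatrix ℝ *ᵥ x) ⬝ᵥ (G.adjMatrix ℝ *ᵥ x) := by
  apply (G.isHermitian_adjMatrix ℝ).lt_dotProduct_mulVec_self hr _ hx
  rw [hlIndex, floor_add_one_half, ceil_add_one_half] at h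
  have key : ∀ m, Fintype.card V ≤ 2 * m → 2 * m ≤ Fintype.card V + 2 →
      r < |G.adjEigenvalue m| → ∀ i, r < |(G.isHermitian_adjMatrix ℝ).eigenvalues₀ i| := by
    intro m h1 h2 h i
    -- The index 0, and an index beyond the number of vertices, satisfy the two bounds only when V
    -- is empty; the default value 0 then does not exceed r.
    rcases m with _ | i
    · rw [adjEigenvalue_zero, abs_zero] at h
      exact absurd h (not_lt.2 hr)
    · by_cases hi : i < Fintype.card V
      · rw [adjEigenvalue_of_lt hi] at h
        exact hG.lt_abs_eigenvalues₀ hr hi (by omega) (by omega) h _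
      · rw [adjEigenvalue, dif_neg (by omega), abs_zero] at h
        exact absurd h (not_lt.2 hr)
  rcases lt_max_iff.1 h with h | h
  · exact key _ (by omega) (by omega) h
  · exact key _ (by omega) (by omega) h

open Matrix in
theorem le_hlIndex [Nonempty V] {r : ℝ} (hr : 0 ≤ r)
    (h : ∀ x : V → ℝ, r ^ 2 * (x ⬝ᵥ x) ≤ (G.adjMatrix ℝ *ᵥ x) ⬝ᵥ (G.adjMatrix ℝ *ᵥ x)) :
    r ≤ G.hlIndex := by
  refine le_max_of_le_left ?_
  have hpos : 0 < Fintype.card V := Fintype.card_pos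
  rw [floor_add_one_half]
  obtain ⟨i, hi⟩ : ∃ i, (Fintype.card V + 1) / 2 = i + 1 := ⟨(Fintype.card V + 1) / 2 - 1, by omega⟩
  rw [hi, adjEigenvalue_of_lt (by omega)]
  exact (G.isHermitian_adjMatrix ℝ).le_abs_eigenvalues₀ hr h _

end SimpleGraph

/-! ### Configurations excluded by a positive definite form -/

section PositiveForm

variable {E : Type*} [AddCommGroup E] [Module ℝ E]

/-- A symmetric positive definite bilinear form on a real vector space. -/
structure LinearMap.BilinForm.IsPosDefForm (B : LinearMap.BilinForm ℝ E) : Prop where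
  symm : ∀ x y, B x y = B y x
  pos : ∀ x, x ≠ 0 → 0 < B x x

namespace LinearMap.BilinForm.IsPosDefForm

variable {B : LinearMap.BilinForm ℝ E} (hB : B.IsPosDefForm)

include hB

/-- The functional certifies that x is nonzero. In the applications φ is a coordinate that vanishes
on all vectors of the combination but one, so it carries the linear independence. -/
theorem pos_of_functional {φ : E →ₗ[ℝ] ℝ} {x : E} (h : φ x ≠ 0) : 0 < B x x :=
  hB.pos x fun h0 => h (by rw [h0, map_zero])

theorem inner_lt {φ : E →ₗ[ℝ] ℝ} {u w : E} {n : ℝ} (hu : B u u = n) (hw : B w w = n)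
    (h : φ u ≠ 0) (h' : φ w = 0) : B u w < n := by
  have := hB.pos_of_functional (φ := φ) (x := u - w) (by simpa [h'] using h)
  simp only [map_sub, LinearMap.sub_apply, hu, hw, hB.symm w u] at this
  linarith

theorem neg_lt_inner {φ : E →ₗ[ℝ] ℝ} {u w : E} {n : ℝ} (hu : B u u = n) (hw : B w w = n)
    (h : φ u ≠ 0) (h' : φ w = 0) : -n < B u w := by
  have := hB.pos_of_functional (φ := φ) (x := u + w) (by simpa [h'] using h)
  simp only [map_add, LinearMap.add_apply, hu, hw, hB.symm w u] at this
  linarith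

/-- The vector f + ε f' has norm 2, and its projection to the span of e and e' has norm 1 + 1 = 2.
The residual would therefore have norm 0. -/
theorem false_of_two_two {φ : E →ₗ[ℝ] ℝ} {e e' f f' : E} {ε : ℝ} (hε : ε = 1 ∨ ε = -1)
    (he : B e e = 1) (he' : B e' e' = 1) (hee : B e e' = 0)
    (hf : B f f = 1) (hf' : B f' f' = 1) (hff : B f f' = 0)
    (h : B f e = 1 / 2 ∨ B f e = -(1 / 2)) (h' : B f e' = 1 / 2 ∨ B f e' = -(1 / 2))
    (k : B f' e = ε * B f e) (k' : B f' e' = ε * B f e')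
    (hφ : φ f ≠ 0) (φf : φ f' = 0) (φe : φ e = 0) (φe' : φ e' = 0) : False := by
  have := hB.pos_of_functional (φ := φ)
    (x := f + ε • f' - (2 * B f e) • e - (2 * B f e') • e') (by simpa [φf, φe, φe'] using hφ)
  simp only [map_add, map_sub, map_smul, LinearMap.add_apply, LinearMap.sub_apply,
    LinearMap.smul_apply, smul_eq_mul, he, he', hee, hf, hf', hff, k, k', hB.symm e f,
    hB.symm e f', hB.symm e' f, hB.symm e' f', hB.symm e' e, hB.symm f' f] at this
  rcases hε with rfl | rfl <;> rcases h with h | h <;> rcases h' with h' | h' <;>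
    rw [h, h'] at this <;> norm_num at this

/-- Three orthonormal vectors cannot have inner products `± 1 / 2` with two orthonormal vectors,
if all the five are linearly independent. -/
theorem false_of_three_two {φ : E →ₗ[ℝ] ℝ} {e₁ e₂ e₃ f f' : E}
    (h₁ : B e₁ e₁ = 1) (h₂ : B e₂ e₂ = 1) (h₃ : B e₃ e₃ = 1)
    (h₁₂ : B e₁ e₂ = 0) (h₁₃ : B e₁ e₃ = 0) (h₂₃ : B e₂ e₃ = 0)
    (hf : B f f = 1) (hf' : B f' f' = 1) (hff : B f f' = 0)
    (k₁ : B f e₁ = 1 / 2 ∨ B f e₁ = -(1 / 2)) (k₂ : B f e₂ = 1 / 2 ∨ B f e₂ = -(1 / 2))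
    (k₃ : B f e₃ = 1 / 2 ∨ B f e₃ = -(1 / 2))
    (l₁ : B f' e₁ = 1 / 2 ∨ B f' e₁ = -(1 / 2)) (l₂ : B f' e₂ = 1 / 2 ∨ B f' e₂ = -(1 / 2))
    (l₃ : B f' e₃ = 1 / 2 ∨ B f' e₃ = -(1 / 2))
    (hφ : φ f ≠ 0) (φf : φ f' = 0) (φ₁ : φ e₁ = 0) (φ₂ : φ e₂ = 0) (φ₃ : φ e₃ = 0) : False := by
  have sgn : ∀ {a b : ℝ}, (a = 1 / 2 ∨ a = -(1 / 2)) → (b = 1 / 2 ∨ b = -(1 / 2)) →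
      b = 1 * a ∨ b = -1 * a := by
    rintro a b (rfl | rfl) (rfl | rfl) <;> norm_num
  -- The ratio of the inner products of f' and f with each of the three vectors is 1 or -1. Two of
  -- the three ratios coincide, and `false_of_two_two` applies to that pair.
  rcases sgn k₁ l₁ with m₁ | m₁ <;> rcases sgn k₂ l₂ with m₂ | m₂
  · exact hB.false_of_two_two (Or.inl rfl) h₁ h₂ h₁₂ hf hf' hff k₁ k₂ m₁ m₂ hφ φf φ₁ φ₂
  · rcases sgn k₃ l₃ with m₃ | m₃
    · exact hB.false_of_two_two (Or.inl rfl) h₁ h₃ h₁₃ hf hf' hff k₁ k₃ m₁ m₃ hφ φf φ₁ φ₃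
    · exact hB.false_of_two_two (Or.inr rfl) h₂ h₃ h₂₃ hf hf' hff k₂ k₃ m₂ m₃ hφ φf φ₂ φ₃
  · rcases sgn k₃ l₃ with m₃ | m₃
    · exact hB.false_of_two_two (Or.inl rfl) h₂ h₃ h₂₃ hf hf' hff k₂ k₃ m₂ m₃ hφ φf φ₂ φ₃
    · exact hB.false_of_two_two (Or.inr rfl) h₁ h₃ h₁₃ hf hf' hff k₁ k₃ m₁ m₃ hφ φf φ₁ φ₃
  · exact hB.false_of_two_two (Or.inr rfl) h₁ h₂ h₁₂ hf hf' hff k₁ k₂ m₁ m₂ hφ φf φ₁ φ₂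

/-- Two vectors of norm `5 / 4` and inner product `1 / 4` or `-3 / 4` cannot have inner products
`± 1 / 2` with four orthonormal vectors, if all the six are linearly independent. -/
theorem false_of_four_orthonormal {φ : E →ₗ[ℝ] ℝ} {u w : E} {z : Fin 4 → E}
    (hu : B u u = 5 / 4) (hw : B w w = 5 / 4) (huw : B u w = 1 / 4 ∨ B u w = -(3 / 4))
    (hz : ∀ i, B (z i) (z i) = 1) (hzz : ∀ i j, i ≠ j → B (z i) (z j) = 0)
    (uz : ∀ i, B u (z i) = 1 / 2 ∨ B u (z i) = -(1 / 2))
    (wz : ∀ i, B w (z i) = 1 / 2 ∨ B w (z i) = -(1 / 2))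
    (hφ : φ u ≠ 0) (φw : φ w = 0) (φz : ∀ i, φ (z i) = 0) : False := by
  have orth : ∀ t t' : E, B (t - ∑ i, B t (z i) • z i) (t' - ∑ i, B t' (z i) • z i) =
      B t t' - ∑ i, B t (z i) * B t' (z i) := by
    intro t t'
    simp only [Fin.sum_univ_four, map_sub, map_add, map_smul, LinearMap.sub_apply,
      LinearMap.add_apply, LinearMap.smul_apply, smul_eq_mul, hz,
      hzz 0 1 (by decide), hzz 0 2 (by decide), hzz 0 3 (by decide), hzz 1 0 (by decide),
      hzz 1 2 (by decide), hzz 1 3 (by decide), hzz 2 0 (by decide), hzz 2 1 (by decide),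
      hzz 2 3 (by decide), hzz 3 0 (by decide), hzz 3 1 (by decide), hzz 3 2 (by decide),
      hB.symm (z _) t']
    ring
  have sq : ∀ {a : ℝ}, (a = 1 / 2 ∨ a = -(1 / 2)) → a * a = 1 / 4 := by
    rintro a (rfl | rfl) <;> norm_num
  have mul : ∀ {a b : ℝ}, (a = 1 / 2 ∨ a = -(1 / 2)) → (b = 1 / 2 ∨ b = -(1 / 2)) →
      a * b = 1 / 4 ∨ a * b = -(1 / 4) := by
    rintro a b (rfl | rfl) (rfl | rfl) <;> norm_num
  have nu := orth u u
  have nw := orth w w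
  have nuw := orth u w
  simp only [Fin.sum_univ_four, hu, hw, sq (uz _), sq (wz _)] at nu nw nuw
  have φu' : φ (u - ∑ i, B u (z i) • z i) ≠ 0 := by simpa [φz] using hφ
  have φw' : φ (w - ∑ i, B w (z i) • z i) = 0 := by simp [φz, φw]
  replace nu := nu.trans (by norm_num : _ = (1 / 4 : ℝ))
  replace nw := nw.trans (by norm_num : _ = (1 / 4 : ℝ))
  simp only [Fin.sum_univ_four] at φu' φw'
  have lt := hB.inner_lt nu nw φu' φw'
  have gt := hB.neg_lt_inner nu nw φu' φw'
  rw [nuw] at lt gt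
  -- Both residuals have norm 1/4, while their inner product is an odd multiple of 1/4, so strict
  -- Cauchy-Schwarz fails.
  rcases huw with h | h <;> rcases mul (uz 0) (wz 0) with h0 | h0 <;>
    rcases mul (uz 1) (wz 1) with h1 | h1 <;> rcases mul (uz 2) (wz 2) with h2 | h2 <;>
    rcases mul (uz 3) (wz 3) with h3 | h3 <;> rw [h, h0, h1, h2, h3] at lt gt <;> linarith

/-- The residuals have norm 1/2 and their inner product is a multiple of 1/2, so strict
Cauchy-Schwarz makes it 0. The three products ± 1/4 then sum to 1/4 or -3/4, and an odd number of
them is negative. Thus u and w have opposite total signs. -/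
theorem prod_inner_of_three_orthonormal {φ : E →ₗ[ℝ] ℝ} {u w z₁ z₂ z₃ : E}
    (hu : B u u = 5 / 4) (hw : B w w = 5 / 4) (huw : B u w = 1 / 4 ∨ B u w = -(3 / 4))
    (h₁ : B z₁ z₁ = 1) (h₂ : B z₂ z₂ = 1) (h₃ : B z₃ z₃ = 1)
    (h₁₂ : B z₁ z₂ = 0) (h₁₃ : B z₁ z₃ = 0) (h₂₃ : B z₂ z₃ = 0)
    (k₁ : B u z₁ = 1 / 2 ∨ B u z₁ = -(1 / 2)) (k₂ : B u z₂ = 1 / 2 ∨ B u z₂ = -(1 / 2))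
    (k₃ : B u z₃ = 1 / 2 ∨ B u z₃ = -(1 / 2))
    (l₁ : B w z₁ = 1 / 2 ∨ B w z₁ = -(1 / 2)) (l₂ : B w z₂ = 1 / 2 ∨ B w z₂ = -(1 / 2))
    (l₃ : B w z₃ = 1 / 2 ∨ B w z₃ = -(1 / 2))
    (hφ : φ u ≠ 0) (φw : φ w = 0) (φ₁ : φ z₁ = 0) (φ₂ : φ z₂ = 0) (φ₃ : φ z₃ = 0) :
    (B u z₁ * B u z₂ * B u z₃) * (B w z₁ * B w z₂ * B w z₃) < 0 := by
  have orth : ∀ t t' : E, B (t - B t z₁ • z₁ - B t z₂ • z₂ - B t z₃ • z₃)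
      (t' - B t' z₁ • z₁ - B t' z₂ • z₂ - B t' z₃ • z₃) =
      B t t' - (B t z₁ * B t' z₁ + B t z₂ * B t' z₂ + B t z₃ * B t' z₃) := by
    intro t t'
    simp only [map_sub, map_smul, LinearMap.sub_apply, LinearMap.smul_apply, smul_eq_mul,
      h₁, h₂, h₃, h₁₂, h₁₃, h₂₃, hB.symm z₂ z₁, hB.symm z₃ z₁, hB.symm z₃ z₂, hB.symm z₁ t',
      hB.symm z₂ t', hB.symm z₃ t']
    ring
  have nu := orth u u
  have nw := orth w w
  have nuw := orth u w
  have sq : ∀ {a : ℝ}, (a = 1 / 2 ∨ a = -(1 / 2)) → a * a = 1 / 4 := by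
    rintro a (rfl | rfl) <;> norm_num
  have φu' : φ (u - B u z₁ • z₁ - B u z₂ • z₂ - B u z₃ • z₃) ≠ 0 := by simpa [φ₁, φ₂, φ₃] using hφ
  have φw' : φ (w - B w z₁ • z₁ - B w z₂ • z₂ - B w z₃ • z₃) = 0 := by simp [φ₁, φ₂, φ₃, φw]
  rw [hu, sq k₁, sq k₂, sq k₃] at nu
  rw [hw, sq l₁, sq l₂, sq l₃] at nw
  replace nu := nu.trans (by norm_num : _ = (1 / 2 : ℝ))
  replace nw := nw.trans (by norm_num : _ = (1 / 2 : ℝ))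
  have lt := hB.inner_lt nu nw φu' φw'
  have gt := hB.neg_lt_inner nu nw φu' φw'
  rw [nuw] at lt gt
  have mul : ∀ {a b : ℝ}, (a = 1 / 2 ∨ a = -(1 / 2)) → (b = 1 / 2 ∨ b = -(1 / 2)) →
      a * b = 1 / 4 ∨ a * b = -(1 / 4) := by
    rintro a b (rfl | rfl) (rfl | rfl) <;> norm_num
  have prod : (B u z₁ * B u z₂ * B u z₃) * (B w z₁ * B w z₂ * B w z₃) =
      (B u z₁ * B w z₁) * (B u z₂ * B w z₂) * (B u z₃ * B w z₃) := by ring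
  rw [prod]
  rcases huw with h | h <;> rcases mul k₁ l₁ with m₁ | m₁ <;> rcases mul k₂ l₂ with m₂ | m₂ <;>
    rcases mul k₃ l₃ with m₃ | m₃ <;> rw [h, m₁, m₂, m₃] at lt gt <;> rw [m₁, m₂, m₃] <;>
    first
      | (exfalso; linarith)
      | norm_num

/-- The residuals have norm 3/4 and their inner product is an odd multiple of 1/4, so strict
Cauchy-Schwarz leaves only ± 1/4. The sign records whether the total signs of u and w agree. -/
theorem inner_of_two_orthonormal {φ : E →ₗ[ℝ] ℝ} {u w z₁ z₂ : E}
    (hu : B u u = 5 / 4) (hw : B w w = 5 / 4) (huw : B u w = 1 / 4 ∨ B u w = -(3 / 4))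
    (h₁ : B z₁ z₁ = 1) (h₂ : B z₂ z₂ = 1) (h₁₂ : B z₁ z₂ = 0)
    (k₁ : B u z₁ = 1 / 2 ∨ B u z₁ = -(1 / 2)) (k₂ : B u z₂ = 1 / 2 ∨ B u z₂ = -(1 / 2))
    (l₁ : B w z₁ = 1 / 2 ∨ B w z₁ = -(1 / 2)) (l₂ : B w z₂ = 1 / 2 ∨ B w z₂ = -(1 / 2))
    (hφ : φ u ≠ 0) (φw : φ w = 0) (φ₁ : φ z₁ = 0) (φ₂ : φ z₂ = 0) :
    B (u - B u z₁ • z₁ - B u z₂ • z₂) (u - B u z₁ • z₁ - B u z₂ • z₂) = 3 / 4 ∧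
    B (w - B w z₁ • z₁ - B w z₂ • z₂) (w - B w z₁ • z₁ - B w z₂ • z₂) = 3 / 4 ∧
    B (u - B u z₁ • z₁ - B u z₂ • z₂) (w - B w z₁ • z₁ - B w z₂ • z₂) =
      if B u z₁ * B u z₂ = B w z₁ * B w z₂ then -(1 / 4) else 1 / 4 := by
  have orth : ∀ t t' : E, B (t - B t z₁ • z₁ - B t z₂ • z₂) (t' - B t' z₁ • z₁ - B t' z₂ • z₂) =
      B t t' - (B t z₁ * B t' z₁ + B t z₂ * B t' z₂) := by
    intro t t'
    simp only [map_sub, map_smul, LinearMap.sub_apply, LinearMap.smul_apply, smul_eq_mul,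
      h₁, h₂, h₁₂, hB.symm z₂ z₁, hB.symm z₁ t', hB.symm z₂ t']
    ring
  have nu := orth u u
  have nw := orth w w
  have nuw := orth u w
  have sq : ∀ {a : ℝ}, (a = 1 / 2 ∨ a = -(1 / 2)) → a * a = 1 / 4 := by
    rintro a (rfl | rfl) <;> norm_num
  have φu' : φ (u - B u z₁ • z₁ - B u z₂ • z₂) ≠ 0 := by simpa [φ₁, φ₂] using hφ
  have φw' : φ (w - B w z₁ • z₁ - B w z₂ • z₂) = 0 := by simp [φ₁, φ₂, φw]
  rw [hu, sq k₁, sq k₂] at nu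
  rw [hw, sq l₁, sq l₂] at nw
  replace nu := nu.trans (by norm_num : _ = (3 / 4 : ℝ))
  replace nw := nw.trans (by norm_num : _ = (3 / 4 : ℝ))
  have lt := hB.inner_lt nu nw φu' φw'
  have gt := hB.neg_lt_inner nu nw φu' φw'
  refine ⟨nu, nw, ?_⟩
  rw [nuw] at lt gt ⊢
  rcases huw with h | h <;> rcases k₁ with k₁ | k₁ <;> rcases k₂ with k₂ | k₂ <;>
    rcases l₁ with l₁ | l₁ <;> rcases l₂ with l₂ | l₂ <;>
    rw [h, k₁, k₂, l₁, l₂] at lt gt ⊢ <;>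
    first
      | (exfalso; linarith)
      | norm_num

/-- A vector of norm `5 / 4` with inner product `-3 / 4` with two elements of a regular simplex of
five vectors of norm `5 / 4` and inner products `1 / 4`, and `1 / 4` or `-3 / 4` with the others. -/
theorem false_of_simplex_spin {φ : E →ₗ[ℝ] ℝ} {f e₁ e₂ e₃ e₄ e₅ : E}
    (hf : B f f = 5 / 4) (h₁ : B e₁ e₁ = 5 / 4) (h₂ : B e₂ e₂ = 5 / 4) (h₃ : B e₃ e₃ = 5 / 4)
    (h₄ : B e₄ e₄ = 5 / 4) (h₅ : B e₅ e₅ = 5 / 4)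
    (h₁₂ : B e₁ e₂ = 1 / 4) (h₁₃ : B e₁ e₃ = 1 / 4) (h₁₄ : B e₁ e₄ = 1 / 4)
    (h₁₅ : B e₁ e₅ = 1 / 4) (h₂₃ : B e₂ e₃ = 1 / 4) (h₂₄ : B e₂ e₄ = 1 / 4)
    (h₂₅ : B e₂ e₅ = 1 / 4) (h₃₄ : B e₃ e₄ = 1 / 4) (h₃₅ : B e₃ e₅ = 1 / 4)
    (h₄₅ : B e₄ e₅ = 1 / 4)
    (k₁ : B f e₁ = -(3 / 4)) (k₂ : B f e₂ = -(3 / 4))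
    (k₃ : B f e₃ = 1 / 4 ∨ B f e₃ = -(3 / 4)) (k₄ : B f e₄ = 1 / 4 ∨ B f e₄ = -(3 / 4))
    (k₅ : B f e₅ = 1 / 4 ∨ B f e₅ = -(3 / 4))
    (hφ : φ f ≠ 0) (φ₁ : φ e₁ = 0) (φ₂ : φ e₂ = 0) (φ₃ : φ e₃ = 0) (φ₄ : φ e₄ = 0)
    (φ₅ : φ e₅ = 0) : False := by
  have main : ∀ a b c d e g : ℝ, a ≠ 0 →
      0 < 5 / 4 * (a ^ 2 + b ^ 2 + c ^ 2 + d ^ 2 + e ^ 2 + g ^ 2) +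
        1 / 2 * (b * c + b * d + b * e + b * g + c * d + c * e + c * g + d * e + d * g + e * g) +
        2 * a * (b * B f e₁ + c * B f e₂ + d * B f e₃ + e * B f e₄ + g * B f e₅) := by
    intro a b c d e g ha
    have := hB.pos_of_functional (φ := φ)
      (x := a • f + b • e₁ + c • e₂ + d • e₃ + e • e₄ + g • e₅)
      (by simpa [φ₁, φ₂, φ₃, φ₄, φ₅] using ⟨ha, hφ⟩)
    simp only [map_add, map_smul, LinearMap.add_apply, LinearMap.smul_apply, smul_eq_mul,
      hf, h₁, h₂, h₃, h₄, h₅, h₁₂, h₁₃, h₁₄, h₁₅, h₂₃, h₂₄, h₂₅, h₃₄, h₃₅, h₄₅,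
      hB.symm e₂ e₁, hB.symm e₃ e₁, hB.symm e₄ e₁, hB.symm e₅ e₁, hB.symm e₃ e₂,
      hB.symm e₄ e₂, hB.symm e₅ e₂, hB.symm e₄ e₃, hB.symm e₅ e₃, hB.symm e₅ e₄,
      hB.symm e₁ f, hB.symm e₂ f, hB.symm e₃ f, hB.symm e₄ f, hB.symm e₅ f] at this
    linarith
  rw [k₁, k₂] at main
  rcases k₃ with k₃ | k₃ <;> rcases k₄ with k₄ | k₄ <;> rcases k₅ with k₅ | k₅ <;>
    rw [k₃, k₄, k₅] at main
  -- In each sign pattern the chosen integer combination is isotropic: the form takes the value 0 on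
  -- it.
  · have := main 3 2 2 (-1) (-1) (-1) (by norm_num); norm_num at this
  · have := main 2 1 1 (-1) 0 1 (by norm_num); norm_num at this
  · have := main 2 1 1 (-1) 1 0 (by norm_num); norm_num at this
  · have := main 2 1 1 (-1) 1 0 (by norm_num); norm_num at this
  · have := main 2 1 1 1 (-1) 0 (by norm_num); norm_num at this
  · have := main 2 1 1 1 (-1) 0 (by norm_num); norm_num at this
  · have := main 2 1 1 1 0 (-1) (by norm_num); norm_num at this
  · have := main 3 1 1 1 1 1 (by norm_num); norm_num at this

/-- A unit vector whose inner products with the elements of a regular simplex of five vectors of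
norm `5 / 4` and inner products `1 / 4` are `± 1 / 2`, with both signs. -/
theorem false_of_simplex_unit {φ : E →ₗ[ℝ] ℝ} {f e₁ e₂ e₃ e₄ e₅ : E}
    (hf : B f f = 1) (h₁ : B e₁ e₁ = 5 / 4) (h₂ : B e₂ e₂ = 5 / 4) (h₃ : B e₃ e₃ = 5 / 4)
    (h₄ : B e₄ e₄ = 5 / 4) (h₅ : B e₅ e₅ = 5 / 4)
    (h₁₂ : B e₁ e₂ = 1 / 4) (h₁₃ : B e₁ e₃ = 1 / 4) (h₁₄ : B e₁ e₄ = 1 / 4)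
    (h₁₅ : B e₁ e₅ = 1 / 4) (h₂₃ : B e₂ e₃ = 1 / 4) (h₂₄ : B e₂ e₄ = 1 / 4)
    (h₂₅ : B e₂ e₅ = 1 / 4) (h₃₄ : B e₃ e₄ = 1 / 4) (h₃₅ : B e₃ e₅ = 1 / 4)
    (h₄₅ : B e₄ e₅ = 1 / 4)
    (k₁ : B f e₁ = 1 / 2) (k₂ : B f e₂ = -(1 / 2))
    (k₃ : B f e₃ = 1 / 2 ∨ B f e₃ = -(1 / 2)) (k₄ : B f e₄ = 1 / 2 ∨ B f e₄ = -(1 / 2))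
    (k₅ : B f e₅ = 1 / 2 ∨ B f e₅ = -(1 / 2))
    (hφ : φ f ≠ 0) (φ₁ : φ e₁ = 0) (φ₂ : φ e₂ = 0) (φ₃ : φ e₃ = 0) (φ₄ : φ e₄ = 0)
    (φ₅ : φ e₅ = 0) : False := by
  have main : ∀ a b c d e g : ℝ, a ≠ 0 →
      0 < a ^ 2 + 5 / 4 * (b ^ 2 + c ^ 2 + d ^ 2 + e ^ 2 + g ^ 2) +
        1 / 2 * (b * c + b * d + b * e + b * g + c * d + c * e + c * g + d * e + d * g + e * g) +
        2 * a * (b * B f e₁ + c * B f e₂ + d * B f e₃ + e * B f e₄ + g * B f e₅) := by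
    intro a b c d e g ha
    have := hB.pos_of_functional (φ := φ)
      (x := a • f + b • e₁ + c • e₂ + d • e₃ + e • e₄ + g • e₅)
      (by simpa [φ₁, φ₂, φ₃, φ₄, φ₅] using ⟨ha, hφ⟩)
    simp only [map_add, map_smul, LinearMap.add_apply, LinearMap.smul_apply, smul_eq_mul,
      hf, h₁, h₂, h₃, h₄, h₅, h₁₂, h₁₃, h₁₄, h₁₅, h₂₃, h₂₄, h₂₅, h₃₄, h₃₅, h₄₅,
      hB.symm e₂ e₁, hB.symm e₃ e₁, hB.symm e₄ e₁, hB.symm e₅ e₁, hB.symm e₃ e₂,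
      hB.symm e₄ e₂, hB.symm e₅ e₂, hB.symm e₄ e₃, hB.symm e₅ e₃, hB.symm e₅ e₄,
      hB.symm e₁ f, hB.symm e₂ f, hB.symm e₃ f, hB.symm e₄ f, hB.symm e₅ f] at this
    linarith
  rw [k₁, k₂] at main
  rcases k₃ with k₃ | k₃ <;> rcases k₄ with k₄ | k₄ <;> rcases k₅ with k₅ | k₅ <;>
    rw [k₃, k₄, k₅] at main
  -- Here too each integer combination is isotropic for its sign pattern.
  · have := main 3 (-1) 2 (-1) (-1) (-1) (by norm_num); norm_num at this
  · have := main 2 (-1) 1 (-1) 0 1 (by norm_num); norm_num at this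
  · have := main 2 (-1) 1 (-1) 1 0 (by norm_num); norm_num at this
  · have := main 2 (-1) 1 (-1) 1 0 (by norm_num); norm_num at this
  · have := main 2 (-1) 1 1 (-1) 0 (by norm_num); norm_num at this
  · have := main 2 (-1) 1 1 (-1) 0 (by norm_num); norm_num at this
  · have := main 2 (-1) 1 1 0 (-1) (by norm_num); norm_num at this
  · have := main 3 (-2) 1 1 1 1 (by norm_num); norm_num at this

end LinearMap.BilinForm.IsPosDefForm

end PositiveForm

/-! ### Root representations and induced claws -/

namespace SimpleGraph

variable {P : Type*}

/-- A representation of a graph by linearly independent vectors of norm `2` such that adjacent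
vertices have inner product `1` and non-adjacent vertices are orthogonal. The linear independence
is witnessed by the linear forms `coord`. -/
structure RootRepresentation (H : SimpleGraph P) (E : Type*) [AddCommGroup E] [Module ℝ E] where
  form : LinearMap.BilinForm ℝ E
  isPosDefForm : form.IsPosDefForm
  vec : P → E
  coord : P → E →ₗ[ℝ] ℝ
  coord_self : ∀ p, coord p (vec p) = 1
  coord_ne : ∀ {p q}, p ≠ q → coord p (vec q) = 0
  form_self : ∀ p, form (vec p) (vec p) = 2
  form_adj : ∀ {p q}, H.Adj p q → form (vec p) (vec q) = 1
  form_not_adj : ∀ {p q}, p ≠ q → ¬H.Adj p q → form (vec p) (vec q) = 0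

namespace RootRepresentation

variable {E : Type*} [AddCommGroup E] [Module ℝ E] {H : SimpleGraph P}
  (R : H.RootRepresentation E)

-- There is no induced 4-cycle: if both chords were missing, p + b - s - x would have norm 0.
include R in
theorem adj_of_square {p s b x : P} (hps : H.Adj p s) (hsb : H.Adj s b) (hbx : H.Adj b x)
    (hxp : H.Adj x p) (hpb : p ≠ b) (hsx : s ≠ x) (nsx : ¬H.Adj s x) : H.Adj p b := by
  by_contra npb
  have := R.isPosDefForm.pos_of_functional (φ := R.coord p)
    (x := R.vec p + R.vec b - R.vec s - R.vec x)
    (by simp [R.coord_self, R.coord_ne hpb, R.coord_ne hps.ne, R.coord_ne hxp.ne'])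
  simp only [map_add, map_sub, LinearMap.add_apply, LinearMap.sub_apply, R.form_self,
    R.form_adj hps, R.form_adj hps.symm, R.form_adj hsb, R.form_adj hsb.symm, R.form_adj hbx,
    R.form_adj hbx.symm, R.form_adj hxp, R.form_adj hxp.symm, R.form_not_adj hpb npb,
    R.form_not_adj hpb.symm (fun h => npb h.symm), R.form_not_adj hsx nsx,
    R.form_not_adj hsx.symm (fun h => nsx h.symm)] at this
  norm_num at this

theorem form_eq_or {p q : P} (h : p ≠ q) :
    R.form (R.vec p) (R.vec q) = 0 ∨ R.form (R.vec p) (R.vec q) = 1 := by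
  by_cases hpq : H.Adj p q
  · exact Or.inr (R.form_adj hpq)
  · exact Or.inl (R.form_not_adj h hpq)

/-- The orthogonal projection to the complement of the span of a path `s - p - x`. -/
noncomputable def pathRes (p s x : P) (w : E) : E :=
  w - (R.form w (R.vec p) - (R.form w (R.vec s) + R.form w (R.vec x)) / 2) • R.vec p
    - ((R.form w (R.vec s) - R.form w (R.vec p)
      + (R.form w (R.vec s) + R.form w (R.vec x)) / 2) / 2) • R.vec s
    - ((R.form w (R.vec x) - R.form w (R.vec p)
      + (R.form w (R.vec s) + R.form w (R.vec x)) / 2) / 2) • R.vec x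

/-- The orthogonal projection to the complement of the span of a claw with centre `p`. -/
noncomputable def clawRes (p s x y : P) (w : E) : E :=
  w - (2 * R.form w (R.vec p) - (R.form w (R.vec s) + R.form w (R.vec x) + R.form w (R.vec y))) •
      R.vec p
    - ((R.form w (R.vec s) - 2 * R.form w (R.vec p)
      + (R.form w (R.vec s) + R.form w (R.vec x) + R.form w (R.vec y))) / 2) • R.vec s
    - ((R.form w (R.vec x) - 2 * R.form w (R.vec p)
      + (R.form w (R.vec s) + R.form w (R.vec x) + R.form w (R.vec y))) / 2) • R.vec x
    - ((R.form w (R.vec y) - 2 * R.form w (R.vec p)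
      + (R.form w (R.vec s) + R.form w (R.vec x) + R.form w (R.vec y))) / 2) • R.vec y

theorem coord_pathRes {p s x q : P} (hp : q ≠ p) (hs : q ≠ s) (hx : q ≠ x) (w : E) :
    R.coord q (R.pathRes p s x w) = R.coord q w := by
  simp [pathRes, R.coord_ne hp, R.coord_ne hs, R.coord_ne hx]

theorem coord_clawRes {p s x y q : P} (hp : q ≠ p) (hs : q ≠ s) (hx : q ≠ x) (hy : q ≠ y) (w : E) :
    R.coord q (R.clawRes p s x y w) = R.coord q w := by
  simp [clawRes, R.coord_ne hp, R.coord_ne hs, R.coord_ne hx, R.coord_ne hy]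

theorem form_pathRes {p s x : P} (hps : H.Adj p s) (hpx : H.Adj p x) (hsx : s ≠ x)
    (nsx : ¬H.Adj s x) (w w' : E) :
    R.form (R.pathRes p s x w) (R.pathRes p s x w') = R.form w w' -
      ((R.form w (R.vec p) - (R.form w (R.vec s) + R.form w (R.vec x)) / 2) * R.form w' (R.vec p)
      + ((R.form w (R.vec s) - R.form w (R.vec p)
        + (R.form w (R.vec s) + R.form w (R.vec x)) / 2) / 2) * R.form w' (R.vec s)
      + ((R.form w (R.vec x) - R.form w (R.vec p)
        + (R.form w (R.vec s) + R.form w (R.vec x)) / 2) / 2) * R.form w' (R.vec x)) := by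
  have nxs : ¬H.Adj x s := fun h => nsx h.symm
  simp only [pathRes, map_sub, map_smul, LinearMap.sub_apply, LinearMap.smul_apply, smul_eq_mul,
    R.form_self, R.form_adj hps, R.form_adj hps.symm, R.form_adj hpx, R.form_adj hpx.symm,
    R.form_not_adj hsx nsx, R.form_not_adj hsx.symm nxs, R.isPosDefForm.symm (R.vec _) w']
  ring

theorem form_clawRes {p s x y : P} (hps : H.Adj p s) (hpx : H.Adj p x) (hpy : H.Adj p y)
    (hsx : s ≠ x) (hsy : s ≠ y) (hxy : x ≠ y) (nsx : ¬H.Adj s x) (nsy : ¬H.Adj s y)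
    (nxy : ¬H.Adj x y) (w w' : E) :
    R.form (R.clawRes p s x y w) (R.clawRes p s x y w') = R.form w w' -
      ((2 * R.form w (R.vec p) - (R.form w (R.vec s) + R.form w (R.vec x) + R.form w (R.vec y))) *
        R.form w' (R.vec p)
      + ((R.form w (R.vec s) - 2 * R.form w (R.vec p)
        + (R.form w (R.vec s) + R.form w (R.vec x) + R.form w (R.vec y))) / 2) * R.form w' (R.vec s)
      + ((R.form w (R.vec x) - 2 * R.form w (R.vec p)
        + (R.form w (R.vec s) + R.form w (R.vec x) + R.form w (R.vec y))) / 2) * R.form w' (R.vec x)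
      + ((R.form w (R.vec y) - 2 * R.form w (R.vec p)
        + (R.form w (R.vec s) + R.form w (R.vec x) + R.form w (R.vec y))) / 2) *
          R.form w' (R.vec y)) := by
  have nxs : ¬H.Adj x s := fun h => nsx h.symm
  have nys : ¬H.Adj y s := fun h => nsy h.symm
  have nyx : ¬H.Adj y x := fun h => nxy h.symm
  simp only [clawRes, map_sub, map_smul, LinearMap.sub_apply, LinearMap.smul_apply, smul_eq_mul,
    R.form_self, R.form_adj hps, R.form_adj hps.symm, R.form_adj hpx, R.form_adj hpx.symm,
    R.form_adj hpy, R.form_adj hpy.symm, R.form_not_adj hsx nsx, R.form_not_adj hsx.symm nxs,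
    R.form_not_adj hsy nsy, R.form_not_adj hsy.symm nys, R.form_not_adj hxy nxy,
    R.form_not_adj hxy.symm nyx, R.isPosDefForm.symm (R.vec _) w']
  ring

/-- `q` lies outside the claw with centre `p` and leaves `s`, `x`, `y`, its inner products with the
vectors of the claw are `t₁`, `t₂`, `t₃`, `t₄`, and its projection to the orthogonal complement of
the claw has norm `1`. -/
structure IsClawUnit (p s x y q : P) (t₁ t₂ t₃ t₄ : ℝ) : Prop where
  ne₁ : q ≠ p
  ne₂ : q ≠ s
  ne₃ : q ≠ x
  ne₄ : q ≠ y
  form₁ : R.form (R.vec q) (R.vec p) = t₁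
  form₂ : R.form (R.vec q) (R.vec s) = t₂
  form₃ : R.form (R.vec q) (R.vec x) = t₃
  form₄ : R.form (R.vec q) (R.vec y) = t₄
  form_res : R.form (R.clawRes p s x y (R.vec q)) (R.clawRes p s x y (R.vec q)) = 1

section Claw

variable {R} {p s x y : P} (hps : H.Adj p s) (hpx : H.Adj p x) (hpy : H.Adj p y)
    (hsx : s ≠ x) (hsy : s ≠ y) (hxy : x ≠ y) (nsx : ¬H.Adj s x) (nsy : ¬H.Adj s y)
    (nxy : ¬H.Adj x y)

include hps hpx hpy hsx hsy hxy nsx nsy nxy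

/-- The expression in `ht` is the inner product of the two projections to the span of the claw. When
it is an integer the residuals, of norm 1, have inner product -1, 0 or 1, and strict Cauchy-Schwarz
leaves 0. -/
theorem IsClawUnit.form_eq_zero {q q' : P} {t₁ t₂ t₃ t₄ t₁' t₂' t₃' t₄' : ℝ}
    (h : R.IsClawUnit p s x y q t₁ t₂ t₃ t₄) (h' : R.IsClawUnit p s x y q' t₁' t₂' t₃' t₄')
    (hne : q ≠ q')
    (ht : ((2 * t₁ - (t₂ + t₃ + t₄)) * t₁' + ((t₂ - 2 * t₁ + (t₂ + t₃ + t₄)) / 2) * t₂' +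
      ((t₃ - 2 * t₁ + (t₂ + t₃ + t₄)) / 2) * t₃' + ((t₄ - 2 * t₁ + (t₂ + t₃ + t₄)) / 2) * t₄') = 0 ∨
      ((2 * t₁ - (t₂ + t₃ + t₄)) * t₁' + ((t₂ - 2 * t₁ + (t₂ + t₃ + t₄)) / 2) * t₂' +
      ((t₃ - 2 * t₁ + (t₂ + t₃ + t₄)) / 2) * t₃' + ((t₄ - 2 * t₁ + (t₂ + t₃ + t₄)) / 2) * t₄') = 1) :
    R.form (R.clawRes p s x y (R.vec q)) (R.clawRes p s x y (R.vec q')) = 0 := by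
  have e := R.form_clawRes hps hpx hpy hsx hsy hxy nsx nsy nxy (R.vec q) (R.vec q')
  rw [h.form₁, h.form₂, h.form₃, h.form₄, h'.form₁, h'.form₂, h'.form₃, h'.form₄] at e
  have c := R.coord_clawRes h.ne₁ h.ne₂ h.ne₃ h.ne₄ (R.vec q)
  have c' := R.coord_clawRes h.ne₁ h.ne₂ h.ne₃ h.ne₄ (R.vec q')
  rw [R.coord_self] at c
  rw [R.coord_ne hne] at c'
  have lt := R.isPosDefForm.inner_lt h.form_res h'.form_res (by rw [c]; exact one_ne_zero) c'
  have gt := R.isPosDefForm.neg_lt_inner h.form_res h'.form_res (by rw [c]; exact one_ne_zero) c'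
  rw [e] at lt gt ⊢
  rcases R.form_eq_or hne with k | k <;> rcases ht with m | m <;> rw [k, m] at lt gt ⊢ <;> linarith

theorem IsClawUnit.form_eq_half {q q' : P} {t₁ t₂ t₃ t₄ t₁' t₂' t₃' t₄' : ℝ}
    (h : R.IsClawUnit p s x y q t₁ t₂ t₃ t₄) (h' : R.IsClawUnit p s x y q' t₁' t₂' t₃' t₄')
    (hne : q ≠ q')
    (ht : ((2 * t₁ - (t₂ + t₃ + t₄)) * t₁' + ((t₂ - 2 * t₁ + (t₂ + t₃ + t₄)) / 2) * t₂' +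
      ((t₃ - 2 * t₁ + (t₂ + t₃ + t₄)) / 2) * t₃' + ((t₄ - 2 * t₁ + (t₂ + t₃ + t₄)) / 2) * t₄') =
        1 / 2 ∨
      ((2 * t₁ - (t₂ + t₃ + t₄)) * t₁' + ((t₂ - 2 * t₁ + (t₂ + t₃ + t₄)) / 2) * t₂' +
      ((t₃ - 2 * t₁ + (t₂ + t₃ + t₄)) / 2) * t₃' + ((t₄ - 2 * t₁ + (t₂ + t₃ + t₄)) / 2) * t₄') =
        -(1 / 2)) :
    R.form (R.clawRes p s x y (R.vec q)) (R.clawRes p s x y (R.vec q')) = 1 / 2 ∨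
    R.form (R.clawRes p s x y (R.vec q)) (R.clawRes p s x y (R.vec q')) = -(1 / 2) := by
  have e := R.form_clawRes hps hpx hpy hsx hsy hxy nsx nsy nxy (R.vec q) (R.vec q')
  rw [h.form₁, h.form₂, h.form₃, h.form₄, h'.form₁, h'.form₂, h'.form₃, h'.form₄] at e
  have c := R.coord_clawRes h.ne₁ h.ne₂ h.ne₃ h.ne₄ (R.vec q)
  have c' := R.coord_clawRes h.ne₁ h.ne₂ h.ne₃ h.ne₄ (R.vec q')
  rw [R.coord_self] at c
  rw [R.coord_ne hne] at c'
  have lt := R.isPosDefForm.inner_lt h.form_res h'.form_res (by rw [c]; exact one_ne_zero) c'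
  rw [e] at lt ⊢
  rcases R.form_eq_or hne with k | k <;> rcases ht with m | m <;> rw [k, m] at lt ⊢ <;>
    first
      | (exfalso; linarith)
      | norm_num

theorem isClawUnit_of_form {q : P} {t₁ t₂ t₃ t₄ : ℝ} (ne₁ : q ≠ p) (ne₂ : q ≠ s) (ne₃ : q ≠ x)
    (ne₄ : q ≠ y) (h₁ : R.form (R.vec q) (R.vec p) = t₁) (h₂ : R.form (R.vec q) (R.vec s) = t₂)
    (h₃ : R.form (R.vec q) (R.vec x) = t₃) (h₄ : R.form (R.vec q) (R.vec y) = t₄)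
    (ht : ((2 * t₁ - (t₂ + t₃ + t₄)) * t₁ + ((t₂ - 2 * t₁ + (t₂ + t₃ + t₄)) / 2) * t₂ +
      ((t₃ - 2 * t₁ + (t₂ + t₃ + t₄)) / 2) * t₃ + ((t₄ - 2 * t₁ + (t₂ + t₃ + t₄)) / 2) * t₄) = 1) :
    R.IsClawUnit p s x y q t₁ t₂ t₃ t₄ := by
  refine ⟨ne₁, ne₂, ne₃, ne₄, h₁, h₂, h₃, h₄, ?_⟩
  rw [R.form_clawRes hps hpx hpy hsx hsy hxy nsx nsy nxy, h₁, h₂, h₃, h₄, ht, R.form_self]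
  norm_num

/-- Claw units fall into three types, one for each leaf, as for the three 8-dimensional
representations of D₄. Residuals of one type are orthonormal and those of different types have inner
product ± 1/2. Three of one type and two of another contradict `false_of_three_two`. -/
theorem false_of_claw_units {e₁ e₂ e₃ f f' : P} {t₁ t₂ t₃ t₄ u₁ u₂ u₃ u₄ w₁ w₂ w₃ w₄ : ℝ}
    (h₁ : R.IsClawUnit p s x y e₁ t₁ t₂ t₃ t₄) (h₂ : R.IsClawUnit p s x y e₂ u₁ u₂ u₃ u₄)
    (h₃ : R.IsClawUnit p s x y e₃ u₁ u₂ u₃ u₄) (hf : R.IsClawUnit p s x y f w₁ w₂ w₃ w₄)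
    (hf' : R.IsClawUnit p s x y f' w₁ w₂ w₃ w₄) (h₁₂ : e₁ ≠ e₂) (h₁₃ : e₁ ≠ e₃) (h₂₃ : e₂ ≠ e₃)
    (hff : f ≠ f') (hf₁ : f ≠ e₁) (hf₁' : f' ≠ e₁) (hf₂ : f ≠ e₂) (hf₂' : f' ≠ e₂) (hf₃ : f ≠ e₃)
    (hf₃' : f' ≠ e₃)
    (m₁ : ((2 * t₁ - (t₂ + t₃ + t₄)) * u₁ + ((t₂ - 2 * t₁ + (t₂ + t₃ + t₄)) / 2) * u₂ +
      ((t₃ - 2 * t₁ + (t₂ + t₃ + t₄)) / 2) * u₃ + ((t₄ - 2 * t₁ + (t₂ + t₃ + t₄)) / 2) * u₄) = 0)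
    (m₂ : ((2 * u₁ - (u₂ + u₃ + u₄)) * u₁ + ((u₂ - 2 * u₁ + (u₂ + u₃ + u₄)) / 2) * u₂ +
      ((u₃ - 2 * u₁ + (u₂ + u₃ + u₄)) / 2) * u₃ + ((u₄ - 2 * u₁ + (u₂ + u₃ + u₄)) / 2) * u₄) = 1)
    (m₃ : ((2 * w₁ - (w₂ + w₃ + w₄)) * w₁ + ((w₂ - 2 * w₁ + (w₂ + w₃ + w₄)) / 2) * w₂ +
      ((w₃ - 2 * w₁ + (w₂ + w₃ + w₄)) / 2) * w₃ + ((w₄ - 2 * w₁ + (w₂ + w₃ + w₄)) / 2) * w₄) = 1)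
    (m₄ : ((2 * w₁ - (w₂ + w₃ + w₄)) * t₁ + ((w₂ - 2 * w₁ + (w₂ + w₃ + w₄)) / 2) * t₂ +
      ((w₃ - 2 * w₁ + (w₂ + w₃ + w₄)) / 2) * t₃ + ((w₄ - 2 * w₁ + (w₂ + w₃ + w₄)) / 2) * t₄) =
        1 / 2 ∨
      ((2 * w₁ - (w₂ + w₃ + w₄)) * t₁ + ((w₂ - 2 * w₁ + (w₂ + w₃ + w₄)) / 2) * t₂ +
      ((w₃ - 2 * w₁ + (w₂ + w₃ + w₄)) / 2) * t₃ + ((w₄ - 2 * w₁ + (w₂ + w₃ + w₄)) / 2) * t₄) =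
        -(1 / 2))
    (m₅ : ((2 * w₁ - (w₂ + w₃ + w₄)) * u₁ + ((w₂ - 2 * w₁ + (w₂ + w₃ + w₄)) / 2) * u₂ +
      ((w₃ - 2 * w₁ + (w₂ + w₃ + w₄)) / 2) * u₃ + ((w₄ - 2 * w₁ + (w₂ + w₃ + w₄)) / 2) * u₄) =
        1 / 2) : False := by
  have zero := @IsClawUnit.form_eq_zero _ _ _ _ _ R _ _ _ _ hps hpx hpy hsx hsy hxy nsx nsy nxy
  have half := @IsClawUnit.form_eq_half _ _ _ _ _ R _ _ _ _ hps hpx hpy hsx hsy hxy nsx nsy nxy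
  refine R.isPosDefForm.false_of_three_two (φ := R.coord f) h₁.form_res h₂.form_res h₃.form_res
    (zero h₁ h₂ h₁₂ (Or.inl m₁)) (zero h₁ h₃ h₁₃ (Or.inl m₁)) (zero h₂ h₃ h₂₃ (Or.inr m₂))
    hf.form_res hf'.form_res (zero hf hf' hff (Or.inr m₃)) (half hf h₁ hf₁ m₄)
    (half hf h₂ hf₂ (Or.inl m₅)) (half hf h₃ hf₃ (Or.inl m₅)) (half hf' h₁ hf₁' m₄)
    (half hf' h₂ hf₂' (Or.inl m₅)) (half hf' h₃ hf₃' (Or.inl m₅)) ?_ ?_ ?_ ?_ ?_ <;>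
    rw [R.coord_clawRes hf.ne₁ hf.ne₂ hf.ne₃ hf.ne₄]
  · rw [R.coord_self]; exact one_ne_zero
  · exact R.coord_ne hff
  · exact R.coord_ne hf₁
  · exact R.coord_ne hf₂
  · exact R.coord_ne hf₃

end Claw

include R in
theorem not_adj_of_adj_leaf {p s x b : P} (hps : H.Adj p s) (hpx : H.Adj p x) (hsx : s ≠ x)
    (nsx : ¬H.Adj s x) (hsb : H.Adj s b) (npb : ¬H.Adj p b) (hpb : p ≠ b) : ¬H.Adj b x :=
  fun hbx => npb (R.adj_of_square hps hsb hbx hpx.symm hpb hsx nsx)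

theorem ne_of_form_ne {q q' r : P} {a b : ℝ} (h : R.form (R.vec q) (R.vec r) = a)
    (h' : R.form (R.vec q') (R.vec r) = b) (hab : a ≠ b) : q ≠ q' := by
  rintro rfl
  exact hab (h.symm.trans h')

theorem isClawUnit_of_adj_leaf {p s x y : P} (hps : H.Adj p s) (hpx : H.Adj p x) (hpy : H.Adj p y)
    (hsx : s ≠ x) (hsy : s ≠ y) (hxy : x ≠ y) (nsx : ¬H.Adj s x) (nsy : ¬H.Adj s y)
    (nxy : ¬H.Adj x y) {b : P} (hsb : H.Adj s b) (npb : ¬H.Adj p b) (hpb : p ≠ b) :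
    R.IsClawUnit p s x y b 0 1 0 0 := by
  have nbx := R.not_adj_of_adj_leaf hps hpx hsx nsx hsb npb hpb
  have nby := R.not_adj_of_adj_leaf hps hpy hsy nsy hsb npb hpb
  have hbx : b ≠ x := by rintro rfl; exact nsx hsb
  have hby : b ≠ y := by rintro rfl; exact nsy hsb
  exact isClawUnit_of_form hps hpx hpy hsx hsy hxy nsx nsy nxy hpb.symm hsb.ne' hbx hby
    (R.form_not_adj hpb.symm fun h => npb h.symm) (R.form_adj hsb.symm)
    (R.form_not_adj hbx nbx) (R.form_not_adj hby nby) (by norm_num)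

theorem IsClawUnit.swap {p s x y q : P} {t₁ t₂ t₃ t₄ : ℝ}
    (h : R.IsClawUnit p s x y q t₁ t₂ t₃ t₄) : R.IsClawUnit p x s y q t₁ t₃ t₂ t₄ := by
  refine ⟨h.ne₁, h.ne₃, h.ne₂, h.ne₄, h.form₁, h.form₃, h.form₂, h.form₄, ?_⟩
  have e : R.clawRes p x s y (R.vec q) = R.clawRes p s x y (R.vec q) := by
    simp only [clawRes]
    module
  rw [e, h.form_res]

theorem IsClawUnit.rotate {p s x y q : P} {t₁ t₂ t₃ t₄ : ℝ}
    (h : R.IsClawUnit p s x y q t₁ t₂ t₃ t₄) : R.IsClawUnit p x y s q t₁ t₃ t₄ t₂ := by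
  refine ⟨h.ne₁, h.ne₃, h.ne₄, h.ne₂, h.form₁, h.form₃, h.form₄, h.form₂, ?_⟩
  have e : R.clawRes p x y s (R.vec q) = R.clawRes p s x y (R.vec q) := by
    simp only [clawRes]
    module
  rw [e, h.form_res]

include R in
/-- There is no induced claw if each leaf has two neighbours at distance two from the centre and
one of the edges of the claw lies in a triangle. -/
theorem false_of_claw {p s x y : P} (hps : H.Adj p s) (hpx : H.Adj p x) (hpy : H.Adj p y)
    (hsx : s ≠ x) (hsy : s ≠ y) (hxy : x ≠ y) (nsx : ¬H.Adj s x) (nsy : ¬H.Adj s y)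
    (nxy : ¬H.Adj x y)
    (two : ∀ l, l = s ∨ l = x ∨ l = y → ∃ b b', b ≠ b' ∧ (H.Adj l b ∧ ¬H.Adj p b ∧ p ≠ b) ∧
      (H.Adj l b' ∧ ¬H.Adj p b' ∧ p ≠ b'))
    (triangle : ∃ c, H.Adj p c ∧ H.Adj s c) : False := by
  obtain ⟨b₁, b₂, h₁₂, ⟨a₁, n₁, ne₁⟩, a₂, n₂, ne₂⟩ := two s (by simp)
  obtain ⟨b₃, b₄, h₃₄, ⟨a₃, n₃, ne₃⟩, a₄, n₄, ne₄⟩ := two x (by simp)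
  obtain ⟨b₅, b₆, h₅₆, ⟨a₅, n₅, ne₅⟩, a₆, n₆, ne₆⟩ := two y (by simp)
  obtain ⟨c, hpc, hsc⟩ := triangle
  have nxs : ¬H.Adj x s := fun h => nsx h.symm
  have nys : ¬H.Adj y s := fun h => nsy h.symm
  have nyx : ¬H.Adj y x := fun h => nxy h.symm
  have u₁ := R.isClawUnit_of_adj_leaf hps hpx hpy hsx hsy hxy nsx nsy nxy a₁ n₁ ne₁
  have u₂ := R.isClawUnit_of_adj_leaf hps hpx hpy hsx hsy hxy nsx nsy nxy a₂ n₂ ne₂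
  have u₃ := (R.isClawUnit_of_adj_leaf hpx hps hpy hsx.symm hxy hsy nxs nxy nsy a₃ n₃ ne₃).swap
  have u₄ := (R.isClawUnit_of_adj_leaf hpx hps hpy hsx.symm hxy hsy nxs nxy nsy a₄ n₄ ne₄).swap
  have u₅ := (R.isClawUnit_of_adj_leaf hpy hps hpx hsy.symm hxy.symm hsx nys nyx nsx a₅ n₅
    ne₅).rotate
  have u₆ := (R.isClawUnit_of_adj_leaf hpy hps hpx hsy.symm hxy.symm hsx nys nyx nsx a₆ n₆
    ne₆).rotate
  have hcx : c ≠ x := by rintro rfl; exact nsx hsc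
  have hcy : c ≠ y := by rintro rfl; exact nsy hsc
  have ne : ∀ {b : P} {t₂ t₃ t₄ : ℝ}, R.IsClawUnit p s x y b 0 t₂ t₃ t₄ → c ≠ b := fun h =>
    R.ne_of_form_ne (R.form_adj hpc.symm) h.form₁ one_ne_zero
  -- If c is adjacent to all three leaves, then c + p - s - x - y has norm 0. If it misses exactly
  -- one leaf, it has the type of that leaf. If s is its only leaf, it has the type of s. Together
  -- with the two outer neighbours of that leaf it gives three units of one type, against two of
  -- another.
  by_cases hx : H.Adj c x <;> by_cases hy : H.Adj c y
  · have := R.isPosDefForm.pos_of_functional (φ := R.coord c)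
      (x := R.vec c + R.vec p - R.vec s - R.vec x - R.vec y)
      (by simp [R.coord_self, R.coord_ne hpc.ne', R.coord_ne hsc.ne', R.coord_ne hcx,
        R.coord_ne hcy])
    simp only [map_add, map_sub, LinearMap.add_apply, LinearMap.sub_apply, R.form_self,
      R.form_adj hps, R.form_adj hps.symm, R.form_adj hpx, R.form_adj hpx.symm, R.form_adj hpy,
      R.form_adj hpy.symm, R.form_adj hpc, R.form_adj hpc.symm, R.form_adj hsc,
      R.form_adj hsc.symm, R.form_adj hx, R.form_adj hx.symm, R.form_adj hy, R.form_adj hy.symm,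
      R.form_not_adj hsx nsx, R.form_not_adj hsx.symm nxs, R.form_not_adj hsy nsy,
      R.form_not_adj hsy.symm nys, R.form_not_adj hxy nxy, R.form_not_adj hxy.symm nyx] at this
    norm_num at this
  · have uc : R.IsClawUnit p s x y c 1 1 1 0 :=
      isClawUnit_of_form hps hpx hpy hsx hsy hxy nsx nsy nxy hpc.ne' hsc.ne' hcx hcy
        (R.form_adj hpc.symm) (R.form_adj hsc.symm) (R.form_adj hx) (R.form_not_adj hcy hy)
        (by norm_num)
    exact false_of_claw_units hps hpx hpy hsx hsy hxy nsx nsy nxy uc u₅ u₆ u₁ u₂ (ne u₅) (ne u₆)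
      h₅₆ h₁₂ (ne u₁).symm (ne u₂).symm (R.ne_of_form_ne u₁.form₂ u₅.form₂ one_ne_zero)
      (R.ne_of_form_ne u₂.form₂ u₅.form₂ one_ne_zero)
      (R.ne_of_form_ne u₁.form₂ u₆.form₂ one_ne_zero)
      (R.ne_of_form_ne u₂.form₂ u₆.form₂ one_ne_zero) (by norm_num) (by norm_num) (by norm_num)
      (by norm_num) (by norm_num)
  · have uc : R.IsClawUnit p s x y c 1 1 0 1 :=
      isClawUnit_of_form hps hpx hpy hsx hsy hxy nsx nsy nxy hpc.ne' hsc.ne' hcx hcy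
        (R.form_adj hpc.symm) (R.form_adj hsc.symm) (R.form_not_adj hcx hx) (R.form_adj hy)
        (by norm_num)
    exact false_of_claw_units hps hpx hpy hsx hsy hxy nsx nsy nxy uc u₃ u₄ u₁ u₂ (ne u₃) (ne u₄)
      h₃₄ h₁₂ (ne u₁).symm (ne u₂).symm (R.ne_of_form_ne u₁.form₂ u₃.form₂ one_ne_zero)
      (R.ne_of_form_ne u₂.form₂ u₃.form₂ one_ne_zero)
      (R.ne_of_form_ne u₁.form₂ u₄.form₂ one_ne_zero)
      (R.ne_of_form_ne u₂.form₂ u₄.form₂ one_ne_zero) (by norm_num) (by norm_num) (by norm_num)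
      (by norm_num) (by norm_num)
  · have uc : R.IsClawUnit p s x y c 1 1 0 0 :=
      isClawUnit_of_form hps hpx hpy hsx hsy hxy nsx nsy nxy hpc.ne' hsc.ne' hcx hcy
        (R.form_adj hpc.symm) (R.form_adj hsc.symm) (R.form_not_adj hcx hx)
        (R.form_not_adj hcy hy) (by norm_num)
    exact false_of_claw_units hps hpx hpy hsx hsy hxy nsx nsy nxy uc u₁ u₂ u₃ u₄ (ne u₁) (ne u₂)
      h₁₂ h₃₄ (ne u₃).symm (ne u₄).symm (R.ne_of_form_ne u₁.form₂ u₃.form₂ one_ne_zero).symm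
      (R.ne_of_form_ne u₁.form₂ u₄.form₂ one_ne_zero).symm
      (R.ne_of_form_ne u₂.form₂ u₃.form₂ one_ne_zero).symm
      (R.ne_of_form_ne u₂.form₂ u₄.form₂ one_ne_zero).symm (by norm_num) (by norm_num)
      (by norm_num) (by norm_num) (by norm_num)

end RootRepresentation
end SimpleGraph

/-! ### Projection away from an induced path -/

namespace SimpleGraph

variable {P : Type*}

/-- No vertex has three pairwise non-adjacent neighbours. -/
def ClawFree (H : SimpleGraph P) : Prop :=
  ∀ {p a b c : P}, H.Adj p a → H.Adj p b → H.Adj p c → a ≠ b → a ≠ c → b ≠ c →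
    H.Adj a b ∨ H.Adj a c ∨ H.Adj b c

/-- Relative to an induced path `s - p - x`: the vertex `q` is adjacent to `p` and `s` only, or
to `x` only. -/
def IsSpin (H : SimpleGraph P) (p s x q : P) : Prop :=
  (H.Adj p q ∧ H.Adj s q ∧ ¬H.Adj x q) ∨ (¬H.Adj p q ∧ ¬H.Adj s q ∧ H.Adj x q)

namespace RootRepresentation

variable {E : Type*} [AddCommGroup E] [Module ℝ E] {H : SimpleGraph P}
  (R : H.RootRepresentation E)

theorem pathRes_swap (p s x : P) (w : E) : R.pathRes p x s w = R.pathRes p s x w := by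
  simp only [pathRes]
  module

section Path

variable (hclaw : H.ClawFree) {p s x : P} (hps : H.Adj p s) (hpx : H.Adj p x) (hsx : s ≠ x)
  (nsx : ¬H.Adj s x)

include hps hpx nsx in
omit R in
theorem _root_.SimpleGraph.IsSpin.ne {q : P} (h : H.IsSpin p s x q) : q ≠ p ∧ q ≠ s ∧ q ≠ x := by
  rcases h with ⟨h₁, h₂, h₃⟩ | ⟨h₁, h₂, h₃⟩
  · exact ⟨h₁.ne', h₂.ne', by rintro rfl; exact nsx h₂⟩
  · exact ⟨by rintro rfl; exact h₂ hps.symm, by rintro rfl; exact nsx h₃.symm, h₃.ne'⟩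

include hps hpx nsx in
theorem form_of_isSpin {q : P} (h : H.IsSpin p s x q) :
    (R.form (R.vec q) (R.vec p) = 1 ∧ R.form (R.vec q) (R.vec s) = 1 ∧
      R.form (R.vec q) (R.vec x) = 0) ∨
    (R.form (R.vec q) (R.vec p) = 0 ∧ R.form (R.vec q) (R.vec s) = 0 ∧
      R.form (R.vec q) (R.vec x) = 1) := by
  obtain ⟨n₁, n₂, n₃⟩ := h.ne hps hpx nsx
  rcases h with ⟨h₁, h₂, h₃⟩ | ⟨h₁, h₂, h₃⟩
  · exact Or.inl ⟨R.form_adj h₁.symm, R.form_adj h₂.symm, R.form_not_adj n₃ fun h => h₃ h.symm⟩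
  · exact Or.inr ⟨R.form_not_adj n₁ fun h => h₁ h.symm, R.form_not_adj n₂ fun h => h₂ h.symm,
      R.form_adj h₃.symm⟩

include hps hpx hsx nsx

/-- Either adjacency pattern projects to a vector of norm 3/4 in the span of the path, which leaves
2 - 3/4. -/
theorem form_spin_self {q : P} (h : H.IsSpin p s x q) :
    R.form (R.pathRes p s x (R.vec q)) (R.pathRes p s x (R.vec q)) = 5 / 4 := by
  rw [R.form_pathRes hps hpx hsx nsx, R.form_self]
  rcases R.form_of_isSpin hps hpx nsx h with ⟨h₁, h₂, h₃⟩ | ⟨h₁, h₂, h₃⟩ <;>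
    rw [h₁, h₂, h₃] <;> norm_num

-- Two spins with the same pattern are adjacent, as otherwise there would be a claw, and their
-- projections to the path have inner product 3/4. Two with different patterns are not adjacent, as
-- otherwise there would be an induced 4-cycle, and that inner product is -1/4. The difference is
-- 1/4 in both cases.
include hclaw in
theorem form_spin_spin {q q' : P} (h : H.IsSpin p s x q) (h' : H.IsSpin p s x q') (hne : q ≠ q') :
    R.form (R.pathRes p s x (R.vec q)) (R.pathRes p s x (R.vec q')) = 1 / 4 := by
  have n := h.ne hps hpx nsx
  have n' := h'.ne hps hpx nsx
  rw [R.form_pathRes hps hpx hsx nsx]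
  rcases h with ⟨a₁, a₂, a₃⟩ | ⟨a₁, a₂, a₃⟩ <;> rcases h' with ⟨b₁, b₂, b₃⟩ | ⟨b₁, b₂, b₃⟩
  · have : H.Adj q q' := by
      rcases hclaw hpx a₁ b₁ n.2.2.symm n'.2.2.symm hne with h | h | h
      exacts [absurd h a₃, absurd h b₃, h]
    rw [R.form_adj this, R.form_adj a₁.symm, R.form_adj a₂.symm,
      R.form_not_adj n.2.2 fun h => a₃ h.symm, R.form_adj b₁.symm, R.form_adj b₂.symm,
      R.form_not_adj n'.2.2 fun h => b₃ h.symm]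
    norm_num
  · have : ¬H.Adj q q' := fun hqq => b₁
      (R.adj_of_square a₁ hqq b₃.symm hpx.symm n'.1.symm n.2.2 fun h => a₃ h.symm)
    rw [R.form_not_adj hne this, R.form_adj a₁.symm, R.form_adj a₂.symm,
      R.form_not_adj n.2.2 fun h => a₃ h.symm, R.form_not_adj n'.1 fun h => b₁ h.symm,
      R.form_not_adj n'.2.1 fun h => b₂ h.symm, R.form_adj b₃.symm]
    norm_num
  · have : ¬H.Adj q q' := fun hqq => a₁
      (R.adj_of_square b₁ hqq.symm a₃.symm hpx.symm n.1.symm n'.2.2 fun h => b₃ h.symm)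
    rw [R.form_not_adj hne this, R.form_adj b₁.symm, R.form_adj b₂.symm,
      R.form_not_adj n'.2.2 fun h => b₃ h.symm, R.form_not_adj n.1 fun h => a₁ h.symm,
      R.form_not_adj n.2.1 fun h => a₂ h.symm, R.form_adj a₃.symm]
    norm_num
  · have : H.Adj q q' := by
      rcases hclaw hpx.symm a₃ b₃ n.1.symm n'.1.symm hne with h | h | h
      exacts [absurd h a₁, absurd h b₁, h]
    rw [R.form_adj this, R.form_adj b₃.symm, R.form_not_adj n.1 fun h => a₁ h.symm,
      R.form_not_adj n.2.1 fun h => a₂ h.symm, R.form_adj a₃.symm,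
      R.form_not_adj n'.1 fun h => b₁ h.symm, R.form_not_adj n'.2.1 fun h => b₂ h.symm]
    norm_num

theorem form_spin_swap {q q' : P} (h : H.IsSpin p s x q) (h' : H.IsSpin p x s q') :
    R.form (R.pathRes p s x (R.vec q)) (R.pathRes p s x (R.vec q')) =
      R.form (R.vec q) (R.vec q') - 1 / 4 := by
  have h2 := R.form_of_isSpin hps hpx nsx h
  have h2' := R.form_of_isSpin hpx hps (fun h => nsx h.symm) h'
  rw [R.form_pathRes hps hpx hsx nsx]
  rcases h2 with ⟨a₁, a₂, a₃⟩ | ⟨a₁, a₂, a₃⟩ <;> rcases h2' with ⟨b₁, b₂, b₃⟩ | ⟨b₁, b₂, b₃⟩ <;>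
    rw [a₁, a₂, a₃, b₁, b₂, b₃] <;> norm_num

theorem form_unit_self {z : P} (h₁ : H.Adj p z) (h₂ : H.Adj s z) (h₃ : H.Adj x z) :
    R.form (R.pathRes p s x (R.vec z)) (R.pathRes p s x (R.vec z)) = 1 := by
  rw [R.form_pathRes hps hpx hsx nsx, R.form_self, R.form_adj h₁.symm, R.form_adj h₂.symm,
    R.form_adj h₃.symm]
  norm_num

/-- The inner product is -1 or 0, and strict Cauchy-Schwarz excludes -1. -/
theorem form_unit_unit {z z' : P} (hne : z ≠ z') (h₁ : H.Adj p z) (h₂ : H.Adj s z)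
    (h₃ : H.Adj x z) (h₁' : H.Adj p z') (h₂' : H.Adj s z') (h₃' : H.Adj x z') :
    R.form (R.pathRes p s x (R.vec z)) (R.pathRes p s x (R.vec z')) = 0 := by
  have c := R.coord_pathRes h₁.ne' h₂.ne' h₃.ne' (R.vec z)
  have c' := R.coord_pathRes h₁.ne' h₂.ne' h₃.ne' (R.vec z')
  rw [R.coord_self] at c
  rw [R.coord_ne hne] at c'
  have gt := R.isPosDefForm.neg_lt_inner (R.form_unit_self hps hpx hsx nsx h₁ h₂ h₃)
    (R.form_unit_self hps hpx hsx nsx h₁' h₂' h₃') (by rw [c]; exact one_ne_zero) c'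
  rw [R.form_pathRes hps hpx hsx nsx, R.form_adj h₁.symm, R.form_adj h₂.symm,
    R.form_adj h₃.symm, R.form_adj h₁'.symm, R.form_adj h₂'.symm, R.form_adj h₃'.symm] at gt ⊢
  rcases R.form_eq_or hne with k | k <;> rw [k] at gt ⊢ <;>
    first
      | (exfalso; linarith)
      | norm_num

theorem form_unit_spin {z q : P} (h₁ : H.Adj p z) (h₂ : H.Adj s z)
    (h₃ : H.Adj x z) (h : H.IsSpin p s x q ∨ H.IsSpin p x s q) :
    R.form (R.pathRes p s x (R.vec z)) (R.pathRes p s x (R.vec q)) =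
      R.form (R.vec z) (R.vec q) - 1 / 2 := by
  rw [R.form_pathRes hps hpx hsx nsx, R.form_adj h₁.symm, R.form_adj h₂.symm, R.form_adj h₃.symm]
  rcases h with h | h
  · rcases R.form_of_isSpin hps hpx nsx h with ⟨a₁, a₂, a₃⟩ | ⟨a₁, a₂, a₃⟩ <;>
      rw [a₁, a₂, a₃] <;> norm_num
  · rcases R.form_of_isSpin hpx hps (fun h => nsx h.symm) h with ⟨a₁, a₂, a₃⟩ | ⟨a₁, a₂, a₃⟩ <;>
      rw [a₁, a₂, a₃] <;> norm_num

open Classical in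
omit hps hpx hsx nsx in
/-- The projection of the vector of `q`, with the sign for which any two of these vectors have
inner product `1 / 4` or `-3 / 4`. -/
noncomputable def signedRes (R : H.RootRepresentation E) (p s x q : P) : E :=
  if H.IsSpin p s x q then R.pathRes p s x (R.vec q) else -R.pathRes p s x (R.vec q)

omit hps hpx hsx nsx in
theorem signedRes_pos {q : P} (h : H.IsSpin p s x q) :
    R.signedRes p s x q = R.pathRes p s x (R.vec q) := if_pos h

omit hps hpx hsx nsx in
theorem signedRes_neg {q : P} (h : H.IsSpin p x s q) :
    R.signedRes p s x q = -R.pathRes p s x (R.vec q) := by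
  refine if_neg fun h' => ?_
  rcases h with ⟨a₁, a₂, a₃⟩ | ⟨a₁, a₂, a₃⟩ <;> rcases h' with ⟨b₁, b₂, b₃⟩ | ⟨b₁, b₂, b₃⟩ <;>
    contradiction

theorem form_signedRes_self {q : P} (h : H.IsSpin p s x q ∨ H.IsSpin p x s q) :
    R.form (R.signedRes p s x q) (R.signedRes p s x q) = 5 / 4 := by
  rcases h with h | h
  · rw [R.signedRes_pos h, R.form_spin_self hps hpx hsx nsx h]
  · rw [R.signedRes_neg h]
    simp only [map_neg, LinearMap.neg_apply, neg_neg]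
    rw [← R.pathRes_swap, R.form_spin_self hpx hps hsx.symm (fun h => nsx h.symm) h]

-- On one side the value is 1/4 by `form_spin_spin`. Across the two sides the sign change turns
-- `form_spin_swap` into 1/4 minus the adjacency.
include hclaw in
theorem form_signedRes_signedRes {q q' : P} (h : H.IsSpin p s x q ∨ H.IsSpin p x s q)
    (h' : H.IsSpin p s x q' ∨ H.IsSpin p x s q') (hne : q ≠ q') :
    R.form (R.signedRes p s x q) (R.signedRes p s x q') = 1 / 4 ∨
    R.form (R.signedRes p s x q) (R.signedRes p s x q') = -(3 / 4) := by
  rcases h with h | h <;> rcases h' with h' | h'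
  · rw [R.signedRes_pos h, R.signedRes_pos h', R.form_spin_spin hclaw hps hpx hsx nsx h h' hne]
    exact Or.inl rfl
  · rw [R.signedRes_pos h, R.signedRes_neg h', map_neg, R.form_spin_swap hps hpx hsx nsx h h']
    rcases R.form_eq_or hne with k | k <;> rw [k] <;> norm_num
  · rw [R.signedRes_neg h, R.signedRes_pos h', R.isPosDefForm.symm, map_neg,
      R.form_spin_swap hps hpx hsx nsx h' h]
    rcases R.form_eq_or hne.symm with k | k <;> rw [k] <;> norm_num
  · rw [R.signedRes_neg h, R.signedRes_neg h']
    simp only [map_neg, LinearMap.neg_apply, neg_neg]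
    rw [← R.pathRes_swap, ← R.pathRes_swap p s x (R.vec q'),
      R.form_spin_spin hclaw hpx hps hsx.symm (fun h => nsx h.symm) h h' hne]
    exact Or.inl rfl

theorem form_signedRes_unit {z q : P} (h₁ : H.Adj p z) (h₂ : H.Adj s z)
    (h₃ : H.Adj x z) (h : H.IsSpin p s x q ∨ H.IsSpin p x s q) :
    R.form (R.signedRes p s x q) (R.pathRes p s x (R.vec z)) = 1 / 2 ∨
    R.form (R.signedRes p s x q) (R.pathRes p s x (R.vec z)) = -(1 / 2) := by
  have hne : z ≠ q := by
    rintro rfl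
    rcases h with (h | h) | (h | h)
    exacts [h.2.2 h₃, h.1 h₁, h.2.2 h₂, h.1 h₁]
  have := R.form_unit_spin hps hpx hsx nsx h₁ h₂ h₃ h
  rw [R.isPosDefForm.symm]
  rcases h with h | h
  · rw [R.signedRes_pos h, this]
    rcases R.form_eq_or hne with k | k <;> rw [k] <;> norm_num
  · rw [R.signedRes_neg h, map_neg, this]
    rcases R.form_eq_or hne with k | k <;> rw [k] <;> norm_num

omit hsx in
theorem coord_signedRes_self {q : P} (h : H.IsSpin p s x q ∨ H.IsSpin p x s q) :
    R.coord q (R.signedRes p s x q) ≠ 0 := by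
  rcases h with h | h
  · obtain ⟨h₁, h₂, h₃⟩ := h.ne hps hpx nsx
    rw [R.signedRes_pos h, R.coord_pathRes h₁ h₂ h₃, R.coord_self]
    exact one_ne_zero
  · obtain ⟨h₁, h₂, h₃⟩ := h.ne hpx hps fun h => nsx h.symm
    rw [R.signedRes_neg h, map_neg, R.coord_pathRes h₁ h₃ h₂, R.coord_self]
    norm_num

omit hsx in
theorem coord_pathRes_ne {q q' : P} (h : H.IsSpin p s x q ∨ H.IsSpin p x s q) (hne : q ≠ q') :
    R.coord q (R.pathRes p s x (R.vec q')) = 0 := by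
  rcases h with h | h
  · obtain ⟨h₁, h₂, h₃⟩ := h.ne hps hpx nsx
    rw [R.coord_pathRes h₁ h₂ h₃, R.coord_ne hne]
  · obtain ⟨h₁, h₂, h₃⟩ := h.ne hpx hps fun h => nsx h.symm
    rw [R.coord_pathRes h₁ h₃ h₂, R.coord_ne hne]

omit hsx in
theorem coord_signedRes_ne {q q' : P} (h : H.IsSpin p s x q ∨ H.IsSpin p x s q)
    (hne : q ≠ q') : R.coord q (R.signedRes p s x q') = 0 := by
  have := R.coord_pathRes_ne hps hpx nsx h hne
  unfold signedRes
  split_ifs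
  · exact this
  · rw [map_neg, this, neg_zero]

omit hps hpx hsx nsx in
omit R in
theorem _root_.SimpleGraph.IsSpin.ne_of_adj {q z : P} (h : H.IsSpin p s x q ∨ H.IsSpin p x s q)
    (h₁ : H.Adj p z) (h₂ : H.Adj s z) (h₃ : H.Adj x z) : q ≠ z := by
  rintro rfl
  rcases h with (h | h) | (h | h)
  exacts [h.2.2 h₃, h.1 h₁, h.2.2 h₂, h.1 h₁]

include R hclaw

theorem false_of_four_common {z : Fin 4 → P} (hz : Function.Injective z)
    (hpz : ∀ i, H.Adj p (z i)) (hsz : ∀ i, H.Adj s (z i)) (hxz : ∀ i, H.Adj x (z i)) {q q' : P}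
    (h : H.IsSpin p s x q ∨ H.IsSpin p x s q) (h' : H.IsSpin p s x q' ∨ H.IsSpin p x s q')
    (hne : q ≠ q') : False := by
  refine R.isPosDefForm.false_of_four_orthonormal (φ := R.coord q)
    (z := fun i => R.pathRes p s x (R.vec (z i)))
    (R.form_signedRes_self hps hpx hsx nsx h) (R.form_signedRes_self hps hpx hsx nsx h')
    (R.form_signedRes_signedRes hclaw hps hpx hsx nsx h h' hne)
    (fun i => R.form_unit_self hps hpx hsx nsx (hpz i) (hsz i) (hxz i))
    (fun i j hij => R.form_unit_unit hps hpx hsx nsx (fun e => hij (hz e)) (hpz i) (hsz i) (hxz i)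
      (hpz j) (hsz j) (hxz j))
    (fun i => R.form_signedRes_unit hps hpx hsx nsx (hpz i) (hsz i) (hxz i) h)
    (fun i => R.form_signedRes_unit hps hpx hsx nsx (hpz i) (hsz i) (hxz i) h')
    (R.coord_signedRes_self hps hpx nsx h) (R.coord_signedRes_ne hps hpx nsx h hne)
    (fun i => R.coord_pathRes_ne hps hpx nsx h (IsSpin.ne_of_adj h (hpz i) (hsz i) (hxz i)))

theorem false_of_three_common {z₁ z₂ z₃ : P} (h₁₂ : z₁ ≠ z₂) (h₁₃ : z₁ ≠ z₃) (h₂₃ : z₂ ≠ z₃)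
    (p₁ : H.Adj p z₁) (s₁ : H.Adj s z₁) (x₁ : H.Adj x z₁)
    (p₂ : H.Adj p z₂) (s₂ : H.Adj s z₂) (x₂ : H.Adj x z₂)
    (p₃ : H.Adj p z₃) (s₃ : H.Adj s z₃) (x₃ : H.Adj x z₃) {q q' q'' : P}
    (h : H.IsSpin p s x q ∨ H.IsSpin p x s q) (h' : H.IsSpin p s x q' ∨ H.IsSpin p x s q')
    (h'' : H.IsSpin p s x q'' ∨ H.IsSpin p x s q'')
    (n₁ : q ≠ q') (n₂ : q ≠ q'') (n₃ : q' ≠ q'') : False := by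
  have key := fun {q q' : P} (h : H.IsSpin p s x q ∨ H.IsSpin p x s q)
      (h' : H.IsSpin p s x q' ∨ H.IsSpin p x s q') (hne : q ≠ q') =>
    R.isPosDefForm.prod_inner_of_three_orthonormal (φ := R.coord q)
      (R.form_signedRes_self hps hpx hsx nsx h) (R.form_signedRes_self hps hpx hsx nsx h')
      (R.form_signedRes_signedRes hclaw hps hpx hsx nsx h h' hne)
      (R.form_unit_self hps hpx hsx nsx p₁ s₁ x₁) (R.form_unit_self hps hpx hsx nsx p₂ s₂ x₂)
      (R.form_unit_self hps hpx hsx nsx p₃ s₃ x₃)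
      (R.form_unit_unit hps hpx hsx nsx h₁₂ p₁ s₁ x₁ p₂ s₂ x₂)
      (R.form_unit_unit hps hpx hsx nsx h₁₃ p₁ s₁ x₁ p₃ s₃ x₃)
      (R.form_unit_unit hps hpx hsx nsx h₂₃ p₂ s₂ x₂ p₃ s₃ x₃)
      (R.form_signedRes_unit hps hpx hsx nsx p₁ s₁ x₁ h)
      (R.form_signedRes_unit hps hpx hsx nsx p₂ s₂ x₂ h)
      (R.form_signedRes_unit hps hpx hsx nsx p₃ s₃ x₃ h)
      (R.form_signedRes_unit hps hpx hsx nsx p₁ s₁ x₁ h')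
      (R.form_signedRes_unit hps hpx hsx nsx p₂ s₂ x₂ h')
      (R.form_signedRes_unit hps hpx hsx nsx p₃ s₃ x₃ h')
      (R.coord_signedRes_self hps hpx nsx h) (R.coord_signedRes_ne hps hpx nsx h hne)
      (R.coord_pathRes_ne hps hpx nsx h (IsSpin.ne_of_adj h p₁ s₁ x₁))
      (R.coord_pathRes_ne hps hpx nsx h (IsSpin.ne_of_adj h p₂ s₂ x₂))
      (R.coord_pathRes_ne hps hpx nsx h (IsSpin.ne_of_adj h p₃ s₃ x₃))
  have k₁ := key h h' n₁
  have k₂ := key h h'' n₂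
  have k₃ := key h' h'' n₃
  generalize R.form (R.signedRes p s x q) (R.pathRes p s x (R.vec z₁)) *
    R.form (R.signedRes p s x q) (R.pathRes p s x (R.vec z₂)) *
    R.form (R.signedRes p s x q) (R.pathRes p s x (R.vec z₃)) = a at k₁ k₂ k₃
  generalize R.form (R.signedRes p s x q') (R.pathRes p s x (R.vec z₁)) *
    R.form (R.signedRes p s x q') (R.pathRes p s x (R.vec z₂)) *
    R.form (R.signedRes p s x q') (R.pathRes p s x (R.vec z₃)) = b at k₁ k₂ k₃
  generalize R.form (R.signedRes p s x q'') (R.pathRes p s x (R.vec z₁)) *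
    R.form (R.signedRes p s x q'') (R.pathRes p s x (R.vec z₂)) *
    R.form (R.signedRes p s x q'') (R.pathRes p s x (R.vec z₃)) = c at k₁ k₂ k₃
  -- Three real numbers cannot have pairwise negative products.
  have := mul_pos_of_neg_of_neg k₁ k₂
  have h3 : a * b * (a * c) = a ^ 2 * (b * c) := by ring
  rw [h3] at this
  nlinarith [sq_nonneg a]

/-- After projecting away from z₁ and z₂ as well, the vectors have norm 3/4 and split into two
classes by the sign `κ`, with inner product -1/4 inside a class and 1/4 between classes. Five such
vectors cannot be independent. -/
theorem false_of_two_common {z₁ z₂ : P} (h₁₂ : z₁ ≠ z₂)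
    (p₁ : H.Adj p z₁) (s₁ : H.Adj s z₁) (x₁ : H.Adj x z₁)
    (p₂ : H.Adj p z₂) (s₂ : H.Adj s z₂) (x₂ : H.Adj x z₂) {S : Finset P}
    (hS : ∀ q ∈ S, H.IsSpin p s x q ∨ H.IsSpin p x s q) (hcard : 5 ≤ S.card) : False := by
  classical
  set u₁ := R.pathRes p s x (R.vec z₁) with hu₁
  set u₂ := R.pathRes p s x (R.vec z₂) with hu₂
  let g : P → E := fun q => R.signedRes p s x q - R.form (R.signedRes p s x q) u₁ • u₁ -
    R.form (R.signedRes p s x q) u₂ • u₂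
  let κ : P → ℝ := fun q => R.form (R.signedRes p s x q) u₁ * R.form (R.signedRes p s x q) u₂
  have key := fun {q q' : P} (h : H.IsSpin p s x q ∨ H.IsSpin p x s q)
      (h' : H.IsSpin p s x q' ∨ H.IsSpin p x s q') (hne : q ≠ q') =>
    R.isPosDefForm.inner_of_two_orthonormal (φ := R.coord q)
      (R.form_signedRes_self hps hpx hsx nsx h) (R.form_signedRes_self hps hpx hsx nsx h')
      (R.form_signedRes_signedRes hclaw hps hpx hsx nsx h h' hne)
      (R.form_unit_self hps hpx hsx nsx p₁ s₁ x₁) (R.form_unit_self hps hpx hsx nsx p₂ s₂ x₂)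
      (R.form_unit_unit hps hpx hsx nsx h₁₂ p₁ s₁ x₁ p₂ s₂ x₂)
      (R.form_signedRes_unit hps hpx hsx nsx p₁ s₁ x₁ h)
      (R.form_signedRes_unit hps hpx hsx nsx p₂ s₂ x₂ h)
      (R.form_signedRes_unit hps hpx hsx nsx p₁ s₁ x₁ h')
      (R.form_signedRes_unit hps hpx hsx nsx p₂ s₂ x₂ h')
      (R.coord_signedRes_self hps hpx nsx h) (R.coord_signedRes_ne hps hpx nsx h hne)
      (R.coord_pathRes_ne hps hpx nsx h (IsSpin.ne_of_adj h p₁ s₁ x₁))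
      (R.coord_pathRes_ne hps hpx nsx h (IsSpin.ne_of_adj h p₂ s₂ x₂))
  have hκ : ∀ q ∈ S, κ q = 1 / 4 ∨ κ q = -(1 / 4) := by
    intro q hq
    have a := R.form_signedRes_unit hps hpx hsx nsx p₁ s₁ x₁ (hS q hq)
    have b := R.form_signedRes_unit hps hpx hsx nsx p₂ s₂ x₂ (hS q hq)
    simp only [κ]
    rcases a with a | a <;> rcases b with b | b <;> rw [a, b] <;> norm_num
  have same : ∀ {q q'}, q ∈ S → q' ∈ S → q ≠ q' → κ q = κ q' →
      R.form (g q) (g q') = -(1 / 4) := by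
    intro q q' hq hq' hne e
    have := (key (hS q hq) (hS q' hq') hne).2.2
    rwa [if_pos e] at this
  have diff : ∀ {q q'}, q ∈ S → q' ∈ S → κ q ≠ κ q' → R.form (g q) (g q') = 1 / 4 := by
    intro q q' hq hq' e
    have := (key (hS q hq) (hS q' hq') fun h => e (by rw [h])).2.2
    rwa [if_neg e] at this
  have cne : ∀ {q q'}, q ∈ S → q ≠ q' → R.coord q (g q') = 0 := by
    intro q q' hq hne
    simp only [g, map_sub, map_smul, R.coord_signedRes_ne hps hpx nsx (hS q hq) hne, hu₁, hu₂,
      R.coord_pathRes_ne hps hpx nsx (hS q hq) (IsSpin.ne_of_adj (hS q hq) p₁ s₁ x₁),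
      R.coord_pathRes_ne hps hpx nsx (hS q hq) (IsSpin.ne_of_adj (hS q hq) p₂ s₂ x₂)]
    simp
  have cself : ∀ {q}, q ∈ S → R.coord q (g q) ≠ 0 := by
    intro q hq
    simp only [g, map_sub, map_smul, hu₁, hu₂,
      R.coord_pathRes_ne hps hpx nsx (hS q hq) (IsSpin.ne_of_adj (hS q hq) p₁ s₁ x₁),
      R.coord_pathRes_ne hps hpx nsx (hS q hq) (IsSpin.ne_of_adj (hS q hq) p₂ s₂ x₂)]
    simpa using R.coord_signedRes_self hps hpx nsx (hS q hq)
  have self : ∀ {q q'}, q ∈ S → q' ∈ S → q ≠ q' → R.form (g q) (g q) = 3 / 4 :=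
    fun {q q'} hq hq' hne => (key (hS q hq) (hS q' hq') hne).1
  -- The sum of four vectors of one class has norm 4 · 3/4 - 12 · 1/4 = 0.
  have four : ∀ t : ℝ, (S.filter fun q => κ q = t).card ≤ 3 := by
    intro t
    by_contra! hc
    obtain ⟨T, hT, hT4⟩ := Finset.exists_subset_card_eq (Nat.succ_le_of_lt hc)
    obtain ⟨a, b, c, d, hab, hac, had, hbc, hbd, hcd, rfl⟩ := Finset.card_eq_four.1 hT4
    have mem : ∀ {q}, q ∈ ({a, b, c, d} : Finset P) → q ∈ S ∧ κ q = t := fun h =>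
      Finset.mem_filter.1 (hT h)
    obtain ⟨ha, ka⟩ := mem (q := a) (by simp)
    obtain ⟨hb, kb⟩ := mem (q := b) (by simp)
    obtain ⟨hc, kc⟩ := mem (q := c) (by simp)
    obtain ⟨hd, kd⟩ := mem (q := d) (by simp)
    have := R.isPosDefForm.pos_of_functional (φ := R.coord a) (x := g a + g b + g c + g d)
      (by simpa only [map_add, cne ha hab, cne ha hac, cne ha had, add_zero] using cself ha)
    simp only [map_add, LinearMap.add_apply, self ha hb hab, self hb ha hab.symm,
      self hc ha hac.symm, self hd ha had.symm, same ha hb hab (ka.trans kb.symm),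
      same hb ha hab.symm (kb.trans ka.symm), same ha hc hac (ka.trans kc.symm),
      same hc ha hac.symm (kc.trans ka.symm), same ha hd had (ka.trans kd.symm),
      same hd ha had.symm (kd.trans ka.symm), same hb hc hbc (kb.trans kc.symm),
      same hc hb hbc.symm (kc.trans kb.symm), same hb hd hbd (kb.trans kd.symm),
      same hd hb hbd.symm (kd.trans kb.symm), same hc hd hcd (kc.trans kd.symm),
      same hd hc hcd.symm (kd.trans kc.symm)] at this
    norm_num at this
  have split : (S.filter fun q => κ q = 1 / 4).card + (S.filter fun q => κ q = -(1 / 4)).card =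
      S.card := by
    rw [← Finset.card_union_of_disjoint, ← Finset.filter_or, Finset.filter_true_of_mem hκ]
    rw [Finset.disjoint_filter]
    intro q _ h h'
    rw [h] at h'
    norm_num at h'
  have f₁ := four (1 / 4)
  have f₂ := four (-(1 / 4))
  obtain ⟨a, ha, b, hb, hab⟩ := Finset.one_lt_card.1
    (show 1 < (S.filter fun q => κ q = 1 / 4).card by omega)
  obtain ⟨c, hc, d, hd, hcd⟩ := Finset.one_lt_card.1
    (show 1 < (S.filter fun q => κ q = -(1 / 4)).card by omega)
  rw [Finset.mem_filter] at ha hb hc hd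
  obtain ⟨ha, ka⟩ := ha
  obtain ⟨hb, kb⟩ := hb
  obtain ⟨hc, kc⟩ := hc
  obtain ⟨hd, kd⟩ := hd
  have nac : κ a ≠ κ c := by rw [ka, kc]; norm_num
  have nad : κ a ≠ κ d := by rw [ka, kd]; norm_num
  have nbc : κ b ≠ κ c := by rw [kb, kc]; norm_num
  have nbd : κ b ≠ κ d := by rw [kb, kd]; norm_num
  -- With at most three of the five in a class, each class has two members; this combination has
  -- norm 3 - 1 - 2 = 0.
  have := R.isPosDefForm.pos_of_functional (φ := R.coord a) (x := g a + g b - g c - g d)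
    (by simpa only [map_add, map_sub, cne ha hab, cne ha (ne_of_apply_ne κ nac),
      cne ha (ne_of_apply_ne κ nad), add_zero, sub_zero] using cself ha)
  simp only [map_add, map_sub, LinearMap.add_apply, LinearMap.sub_apply, self ha hb hab,
    self hb ha hab.symm, self hc hd hcd, self hd hc hcd.symm, same ha hb hab (ka.trans kb.symm),
    same hb ha hab.symm (kb.trans ka.symm), same hc hd hcd (kc.trans kd.symm),
    same hd hc hcd.symm (kd.trans kc.symm), diff ha hc nac, diff hc ha nac.symm, diff ha hd nad,
    diff hd ha nad.symm, diff hb hc nbc, diff hc hb nbc.symm, diff hb hd nbd,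
    diff hd hb nbd.symm] at this
  norm_num at this

end Path
end RootRepresentation
end SimpleGraph

namespace SimpleGraph

variable {P : Type*}

namespace RootRepresentation

variable {E : Type*} [AddCommGroup E] [Module ℝ E] {H : SimpleGraph P}
  (R : H.RootRepresentation E)

/-! ### Five spins on one side of a path -/

section Path

variable (hclaw : H.ClawFree) {p s x : P} (hps : H.Adj p s) (hpx : H.Adj p x) (hsx : s ≠ x)
  (nsx : ¬H.Adj s x) {T : Finset P} (hT : ∀ q ∈ T, H.IsSpin p s x q) (hcard : 5 ≤ T.card)

include R hclaw hps hpx hsx nsx hT hcard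

/-- A vertex of the second side of a path cannot be adjacent to two vertices of the first side,
if there are five of the latter. -/
theorem eq_of_adj_spin {f e₁ e₂ : P} (hf : H.IsSpin p x s f) (h₁ : e₁ ∈ T)
    (h₂ : e₂ ∈ T) (a₁ : H.Adj f e₁) (a₂ : H.Adj f e₂) : e₁ = e₂ := by
  classical
  by_contra h₁₂
  have hc : 2 < ((T.erase e₁).erase e₂).card := by
    rw [Finset.card_erase_of_mem (Finset.mem_erase.2 ⟨fun h => h₁₂ h.symm, h₂⟩),
      Finset.card_erase_of_mem h₁]
    omega
  obtain ⟨e₃, h₃, e₄, h₄, e₅, h₅, h₃₄, h₃₅, h₄₅⟩ := Finset.two_lt_card.1 hc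
  simp only [Finset.mem_erase] at h₃ h₄ h₅
  have spin := fun {q q'} (h : q ∈ T) (h' : q' ∈ T) =>
    R.form_spin_spin hclaw hps hpx hsx nsx (hT q h) (hT q' h')
  have self := fun {q} (h : q ∈ T) => R.form_spin_self hps hpx hsx nsx (hT q h)
  have sf := R.form_spin_self hpx hps hsx.symm (fun h => nsx h.symm) hf
  rw [R.pathRes_swap] at sf
  have nf : ∀ {q}, q ∈ T → f ≠ q := by
    rintro q hq rfl
    rcases hf with ⟨a₁, a₂, a₃⟩ | ⟨a₁, a₂, a₃⟩ <;>
      rcases hT _ hq with ⟨b₁, b₂, b₃⟩ | ⟨b₁, b₂, b₃⟩ <;> contradiction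
  have k : ∀ {q}, q ∈ T → R.form (-R.pathRes p s x (R.vec f)) (R.pathRes p s x (R.vec q)) =
      1 / 4 - R.form (R.vec q) (R.vec f) := by
    intro q hq
    rw [map_neg, LinearMap.neg_apply, R.isPosDefForm.symm,
      R.form_spin_swap hps hpx hsx nsx (hT q hq) hf]
    ring
  have k' : ∀ {q}, q ∈ T →
      R.form (-R.pathRes p s x (R.vec f)) (R.pathRes p s x (R.vec q)) = 1 / 4 ∨
      R.form (-R.pathRes p s x (R.vec f)) (R.pathRes p s x (R.vec q)) = -(3 / 4) := by
    intro q hq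
    rw [k hq]
    rcases R.form_eq_or (nf hq).symm with h | h <;> rw [h] <;> norm_num
  have cf : ∀ {q}, q ∈ T → R.coord f (R.pathRes p s x (R.vec q)) = 0 := fun hq =>
    R.coord_pathRes_ne hps hpx nsx (Or.inr hf) (nf hq)
  obtain ⟨n₁, n₂, n₃⟩ := hf.ne hpx hps fun h => nsx h.symm
  -- The five spins form the simplex. Changing the sign of the residual of f makes its inner
  -- products 1/4 minus the adjacency, hence -3/4 at e₁ and e₂.
  refine R.isPosDefForm.false_of_simplex_spin (φ := R.coord f)
    (f := -R.pathRes p s x (R.vec f)) (by simpa using sf) (self h₁) (self h₂) (self h₃.2.2)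
    (self h₄.2.2) (self h₅.2.2) (spin h₁ h₂ h₁₂) (spin h₁ h₃.2.2 h₃.2.1.symm)
    (spin h₁ h₄.2.2 h₄.2.1.symm) (spin h₁ h₅.2.2 h₅.2.1.symm) (spin h₂ h₃.2.2 h₃.1.symm)
    (spin h₂ h₄.2.2 h₄.1.symm) (spin h₂ h₅.2.2 h₅.1.symm) (spin h₃.2.2 h₄.2.2 h₃₄)
    (spin h₃.2.2 h₅.2.2 h₃₅) (spin h₄.2.2 h₅.2.2 h₄₅) ?_ ?_ (k' h₃.2.2) (k' h₄.2.2) (k' h₅.2.2)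
    ?_ (cf h₁) (cf h₂) (cf h₃.2.2) (cf h₄.2.2) (cf h₅.2.2)
  · rw [k h₁, R.form_adj a₁.symm]; norm_num
  · rw [k h₂, R.form_adj a₂.symm]; norm_num
  · rw [map_neg, R.coord_pathRes n₁ n₃ n₂, R.coord_self]
    norm_num

/-- A common neighbour of the three vertices of a path is adjacent to all or none of the vertices
of one side, if there are five of the latter. -/
theorem adj_spin_of_adj_spin {z e₁ e₂ : P} (p₁ : H.Adj p z) (s₁ : H.Adj s z) (x₁ : H.Adj x z)
    (h₁ : e₁ ∈ T) (h₂ : e₂ ∈ T) (a₁ : H.Adj z e₁) : H.Adj z e₂ := by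
  classical
  by_contra a₂
  have h₁₂ : e₁ ≠ e₂ := by rintro rfl; exact a₂ a₁
  have hc : 2 < ((T.erase e₁).erase e₂).card := by
    rw [Finset.card_erase_of_mem (Finset.mem_erase.2 ⟨fun h => h₁₂ h.symm, h₂⟩),
      Finset.card_erase_of_mem h₁]
    omega
  obtain ⟨e₃, h₃, e₄, h₄, e₅, h₅, h₃₄, h₃₅, h₄₅⟩ := Finset.two_lt_card.1 hc
  simp only [Finset.mem_erase] at h₃ h₄ h₅
  have spin := fun {q q'} (h : q ∈ T) (h' : q' ∈ T) =>
    R.form_spin_spin hclaw hps hpx hsx nsx (hT q h) (hT q' h')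
  have self := fun {q} (h : q ∈ T) => R.form_spin_self hps hpx hsx nsx (hT q h)
  have k := fun {q} (h : q ∈ T) =>
    R.form_unit_spin hps hpx hsx nsx p₁ s₁ x₁ (Or.inl (hT q h))
  have nz : ∀ {q}, q ∈ T → z ≠ q := fun h =>
    (IsSpin.ne_of_adj (Or.inl (hT _ h)) p₁ s₁ x₁).symm
  have k' : ∀ {q}, q ∈ T →
      R.form (R.pathRes p s x (R.vec z)) (R.pathRes p s x (R.vec q)) = 1 / 2 ∨
      R.form (R.pathRes p s x (R.vec z)) (R.pathRes p s x (R.vec q)) = -(1 / 2) := by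
    intro q hq
    rw [k hq]
    rcases R.form_eq_or (nz hq) with h | h <;> rw [h] <;> norm_num
  have cf : ∀ {q}, q ∈ T → R.coord z (R.pathRes p s x (R.vec q)) = 0 := fun hq => by
    rw [R.coord_pathRes p₁.ne' s₁.ne' x₁.ne', R.coord_ne (nz hq)]
  refine R.isPosDefForm.false_of_simplex_unit (φ := R.coord z)
    (R.form_unit_self hps hpx hsx nsx p₁ s₁ x₁) (self h₁) (self h₂) (self h₃.2.2)
    (self h₄.2.2) (self h₅.2.2) (spin h₁ h₂ h₁₂) (spin h₁ h₃.2.2 h₃.2.1.symm)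
    (spin h₁ h₄.2.2 h₄.2.1.symm) (spin h₁ h₅.2.2 h₅.2.1.symm) (spin h₂ h₃.2.2 h₃.1.symm)
    (spin h₂ h₄.2.2 h₄.1.symm) (spin h₂ h₅.2.2 h₅.1.symm) (spin h₃.2.2 h₄.2.2 h₃₄)
    (spin h₃.2.2 h₅.2.2 h₃₅) (spin h₄.2.2 h₅.2.2 h₄₅) ?_ ?_ (k' h₃.2.2) (k' h₄.2.2) (k' h₅.2.2)
    ?_ (cf h₁) (cf h₂) (cf h₃.2.2) (cf h₄.2.2) (cf h₅.2.2)
  · rw [k h₁, R.form_adj a₁]; norm_num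
  · rw [k h₂, R.form_not_adj (nz h₂) a₂]; norm_num
  · rw [R.coord_pathRes p₁.ne' s₁.ne' x₁.ne', R.coord_self]
    exact one_ne_zero

end Path

/-! ### Regular graphs with a root representation -/

section Regular

variable [Fintype P] [DecidableEq P] [DecidableRel H.Adj] {D : ℕ} (hD : ∀ v, H.degree v = D)

include hD

omit R in
theorem card_neighborFinset_sdiff (p s : P) :
    (H.neighborFinset s \ H.neighborFinset p).card =
      (H.neighborFinset p \ H.neighborFinset s).card :=
  Finset.card_sdiff_comm (by rw [card_neighborFinset_eq_degree, card_neighborFinset_eq_degree, hD,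
    hD])

include R

theorem clawFree_of_regular (htri : ∀ p s, H.Adj p s → ∃ c, H.Adj p c ∧ H.Adj s c) :
    H.ClawFree := by
  intro p s x y hps hpx hpy hsx hsy hxy
  by_contra! hc
  obtain ⟨nsx, nsy, nxy⟩ := hc
  have key : ∀ {l m m'}, H.Adj p l → H.Adj p m → H.Adj p m' → l ≠ m → l ≠ m' → m ≠ m' →
      ¬H.Adj l m → ¬H.Adj l m' → ∃ b b', b ≠ b' ∧ (H.Adj l b ∧ ¬H.Adj p b ∧ p ≠ b) ∧
      (H.Adj l b' ∧ ¬H.Adj p b' ∧ p ≠ b') := by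
    intro l m m' hl hm hm' h₁ h₂ h₃ n₁ n₂
    -- The three leaves are neighbours of p outside the neighbourhood of l. By regularity l has at
    -- least three neighbours outside that of p; one may be p itself, and two remain.
    have c3 : 2 < (H.neighborFinset p \ H.neighborFinset l).card := by
      rw [Finset.two_lt_card]
      exact ⟨l, by simp [hl], m, by simp [hm, n₁], m', by simp [hm', n₂], h₁, h₂, h₃⟩
    rw [← card_neighborFinset_sdiff hD] at c3
    have c2 : 1 < ((H.neighborFinset l \ H.neighborFinset p).erase p).card := by
      have := Finset.pred_card_le_card_erase (s := H.neighborFinset l \ H.neighborFinset p) (a := p)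
      omega
    obtain ⟨b, hb, b', hb', hbb⟩ := Finset.one_lt_card.1 c2
    simp only [Finset.mem_erase, Finset.mem_sdiff, mem_neighborFinset] at hb hb'
    exact ⟨b, b', hbb, ⟨hb.2.1, hb.2.2, hb.1.symm⟩, hb'.2.1, hb'.2.2, hb'.1.symm⟩
  refine R.false_of_claw hps hpx hpy hsx hsy hxy nsx nsy nxy ?_ (htri p s hps)
  rintro l (rfl | rfl | rfl)
  · exact key hps hpx hpy hsx hsy hxy nsx nsy
  · exact key hpx hps hpy hsx.symm hxy hsy (fun h => nsx h.symm) nxy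
  · exact key hpy hps hpx hsy.symm hxy.symm hsx (fun h => nsy h.symm) fun h => nxy h.symm

/-- Non-adjacent vertices have at most two common neighbours. -/
theorem card_common_le_two (hclaw : H.ClawFree) (h6 : 6 ≤ D) {s x : P} (hsx : s ≠ x)
    (nsx : ¬H.Adj s x) : (H.neighborFinset s ∩ H.neighborFinset x).card ≤ 2 := by
  by_contra! hc
  obtain ⟨p, hp⟩ := Finset.card_pos.1 (lt_trans two_pos hc)
  have hps : H.Adj p s := by simp at hp; exact hp.1.symm
  have hpx : H.Adj p x := by simp at hp; exact hp.2.symm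
  set C := H.neighborFinset s ∩ H.neighborFinset x with hC
  set S := (H.neighborFinset s \ H.neighborFinset x) ∪ (H.neighborFinset x \ H.neighborFinset s)
    with hS
  have spin : ∀ q ∈ S, H.IsSpin p s x q ∨ H.IsSpin p x s q := by
    intro q hq
    simp only [hS, Finset.mem_union, Finset.mem_sdiff, mem_neighborFinset] at hq
    by_cases hpq : H.Adj p q
    · rcases hq with ⟨h, h'⟩ | ⟨h, h'⟩
      · exact Or.inl (Or.inl ⟨hpq, h, h'⟩)
      · exact Or.inr (Or.inl ⟨hpq, h, h'⟩)
    · rcases hq with ⟨h, h'⟩ | ⟨h, h'⟩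
      · exact Or.inr (Or.inr ⟨hpq, h', h⟩)
      · exact Or.inl (Or.inr ⟨hpq, h', h⟩)
  have common : ∀ {z}, z ∈ C.erase p → H.Adj p z ∧ H.Adj s z ∧ H.Adj x z := by
    intro z hz
    simp only [hC, Finset.mem_erase, Finset.mem_inter, mem_neighborFinset] at hz
    exact ⟨R.adj_of_square hps hz.2.1 hz.2.2.symm hpx.symm hz.1.symm hsx nsx, hz.2⟩
  have card_s : (H.neighborFinset s \ H.neighborFinset x).card + C.card = D := by
    rw [hC, Finset.card_sdiff_add_card_inter, card_neighborFinset_eq_degree, hD]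
  have card_S : S.card = 2 * (H.neighborFinset s \ H.neighborFinset x).card := by
    rw [hS, Finset.card_union_of_disjoint, card_neighborFinset_sdiff hD s x, two_mul]
    rw [Finset.disjoint_left]
    intro q hq hq'
    simp only [Finset.mem_sdiff] at hq hq'
    exact hq.2 hq'.1
  have pos : 0 < (H.neighborFinset s \ H.neighborFinset x).card := by
    have c2 : 1 < (H.neighborFinset p \ H.neighborFinset s).card := by
      rw [Finset.one_lt_card]
      exact ⟨s, by simp [hps], x, by simp [hpx, nsx], hsx⟩
    rw [← card_neighborFinset_sdiff hD] at c2
    have c1 : 0 < ((H.neighborFinset s \ H.neighborFinset p).erase p).card := by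
      have := Finset.pred_card_le_card_erase (s := H.neighborFinset s \ H.neighborFinset p) (a := p)
      omega
    obtain ⟨b, hb⟩ := Finset.card_pos.1 c1
    simp only [Finset.mem_erase, Finset.mem_sdiff, mem_neighborFinset] at hb
    have := R.not_adj_of_adj_leaf hps hpx hsx nsx hb.2.1 hb.2.2 hb.1.symm
    exact Finset.card_pos.2 ⟨b, by simpa [hb.2.1] using fun h : H.Adj x b => this h.symm⟩
  have card_erase : (C.erase p).card = C.card - 1 := Finset.card_erase_of_mem hp
  -- Besides p there are 2, 3 or at least 4 common neighbours. Since D ≥ 6, the set S has at least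
  -- 6, 4 or 2 elements respectively, enough for the 5, 3 or 2 spins that the matching lemma needs.
  obtain h3 | h4 | h5 : C.card = 3 ∨ C.card = 4 ∨ 5 ≤ C.card := by omega
  · obtain ⟨z₁, z₂, hz, hz'⟩ := Finset.card_eq_two.1 (show (C.erase p).card = 2 by omega)
    obtain ⟨p₁, s₁, x₁⟩ := common (z := z₁) (by rw [hz']; simp)
    obtain ⟨p₂, s₂, x₂⟩ := common (z := z₂) (by rw [hz']; simp)
    exact R.false_of_two_common hclaw hps hpx hsx nsx hz p₁ s₁ x₁ p₂ s₂ x₂ spin (by omega)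
  · obtain ⟨z₁, z₂, z₃, h₁₂, h₁₃, h₂₃, hz'⟩ :=
      Finset.card_eq_three.1 (show (C.erase p).card = 3 by omega)
    obtain ⟨p₁, s₁, x₁⟩ := common (z := z₁) (by rw [hz']; simp)
    obtain ⟨p₂, s₂, x₂⟩ := common (z := z₂) (by rw [hz']; simp)
    obtain ⟨p₃, s₃, x₃⟩ := common (z := z₃) (by rw [hz']; simp)
    obtain ⟨q, hq, q', hq', q'', hq'', n₁, n₂, n₃⟩ :=
      Finset.two_lt_card.1 (show 2 < S.card by omega)
    exact R.false_of_three_common hclaw hps hpx hsx nsx h₁₂ h₁₃ h₂₃ p₁ s₁ x₁ p₂ s₂ x₂ p₃ s₃ x₃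
      (spin q hq) (spin q' hq') (spin q'' hq'') n₁ n₂ n₃
  · obtain ⟨T, hT, hT4⟩ := Finset.exists_subset_card_eq (show 4 ≤ (C.erase p).card by omega)
    let z := T.equivFinOfCardEq hT4
    obtain ⟨q, hq, q', hq', hne⟩ := Finset.one_lt_card.1 (show 1 < S.card by omega)
    exact R.false_of_four_common hclaw hps hpx hsx nsx (z := fun i => (z.symm i : P))
      (fun i j h => z.symm.injective (Subtype.ext h))
      (fun i => (common (hT (z.symm i).2)).1) (fun i => (common (hT (z.symm i).2)).2.1)
      (fun i => (common (hT (z.symm i).2)).2.2) (spin q hq) (spin q' hq') hne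

end Regular

end RootRepresentation
end SimpleGraph

/-! ### The square graph as a collinearity graph -/

namespace SimpleGraph

variable {V : Type*}

/-- Two vertices are adjacent in the square graph if they are distinct and have a common
neighbour. -/
def squareGraph (G : SimpleGraph V) : SimpleGraph V where
  Adj u w := u ≠ w ∧ ∃ l, G.Adj u l ∧ G.Adj w l
  symm := ⟨fun _ _ ⟨h, l, hu, hw⟩ => ⟨h.symm, l, hw, hu⟩⟩
  loopless := ⟨fun _ h => h.1 rfl⟩

/-- Two distinct vertices have at most one common neighbour. -/
def Linear (G : SimpleGraph V) : Prop :=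
  ∀ {u w l m : V}, u ≠ w → G.Adj u l → G.Adj w l → G.Adj u m → G.Adj w m → l = m

theorem squareGraph_adj {G : SimpleGraph V} {u w l : V} (hne : u ≠ w) (hu : G.Adj u l)
    (hw : G.Adj w l) : G.squareGraph.Adj u w := ⟨hne, l, hu, hw⟩

variable [Fintype V] [DecidableEq V] {G : SimpleGraph V} [DecidableRel G.Adj]

/-- If `s` is joined to all points of a line `l` with at least as many points as there are lines
through `s`, then all lines through `s` meet `l`. -/
theorem Linear.exists_meet (hone : G.Linear) {s l : V} (hsl : ¬G.Adj s l)
    (hcard : G.degree s ≤ G.degree l) (h : ∀ q, G.Adj l q → ∃ m, G.Adj s m ∧ G.Adj q m) {n : V}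
    (hn : G.Adj s n) : ∃ q, G.Adj l q ∧ G.Adj n q := by
  choose! f hf using h
  -- Two points of l with the same joining line would make that line equal to l, which does not pass
  -- through s.
  have hinj : Set.InjOn f (G.neighborFinset l : Set V) := by
    intro q hq q' hq' e
    simp only [coe_neighborFinset, mem_neighborSet] at hq hq'
    by_contra hne
    have := hone hne (hf q hq).2 (by rw [e]; exact (hf q' hq').2) hq.symm hq'.symm
    exact hsl (this ▸ (hf q hq).1)
  have himg : (G.neighborFinset l).image f = G.neighborFinset s := by
    apply Finset.eq_of_subset_of_card_le
    · intro m hm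
      obtain ⟨q, hq, rfl⟩ := Finset.mem_image.1 hm
      rw [mem_neighborFinset] at hq ⊢
      exact (hf q hq).1
    · rw [Finset.card_image_of_injOn hinj, card_neighborFinset_eq_degree,
        card_neighborFinset_eq_degree]
      exact hcard
  have : n ∈ (G.neighborFinset l).image f := by rw [himg, mem_neighborFinset]; exact hn
  obtain ⟨q, hq, rfl⟩ := Finset.mem_image.1 this
  rw [mem_neighborFinset] at hq
  exact ⟨q, hq, (hf q hq).2.symm⟩

theorem exists_adj_ne_ne {v : V} (h : 3 ≤ G.degree v) (a b : V) :
    ∃ c, G.Adj v c ∧ c ≠ a ∧ c ≠ b := by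
  have : 0 < (((G.neighborFinset v).erase a).erase b).card := by
    have h1 := Finset.pred_card_le_card_erase (s := G.neighborFinset v) (a := a)
    have h2 := Finset.pred_card_le_card_erase (s := (G.neighborFinset v).erase a) (a := b)
    rw [card_neighborFinset_eq_degree] at h1
    omega
  obtain ⟨c, hc⟩ := Finset.card_pos.1 this
  simp only [Finset.mem_erase, mem_neighborFinset] at hc
  exact ⟨c, hc.2.2, hc.2.1, hc.1⟩

theorem degree_le_three {v a b c : V} (h : ∀ q, G.Adj v q → q = a ∨ q = b ∨ q = c) :
    G.degree v ≤ 3 := by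
  rw [← card_neighborFinset_eq_degree]
  refine (Finset.card_le_card (t := {a, b, c}) fun q hq => ?_).trans Finset.card_le_three
  rw [mem_neighborFinset] at hq
  simpa using h q hq

theorem eq_of_degree_eq_three {v a b c q : V} (h : G.degree v = 3) (ha : G.Adj v a)
    (hb : G.Adj v b) (hc : G.Adj v c) (hab : a ≠ b) (hac : a ≠ c) (hbc : b ≠ c)
    (hq : G.Adj v q) : q = a ∨ q = b ∨ q = c := by
  have e : ({a, b, c} : Finset V) = G.neighborFinset v := by
    apply Finset.eq_of_subset_of_card_le
    · intro w hw
      simp only [Finset.mem_insert, Finset.mem_singleton] at hw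
      rw [mem_neighborFinset]
      rcases hw with rfl | rfl | rfl <;> assumption
    · rw [card_neighborFinset_eq_degree, h, Finset.card_eq_three.2 ⟨a, b, c, hab, hac, hbc, rfl⟩]
  have : q ∈ ({a, b, c} : Finset V) := by rw [e, mem_neighborFinset]; exact hq
  simpa using this

theorem Linear.degree_squareGraph (hone : G.Linear) [DecidableRel G.squareGraph.Adj] {k : ℕ}
    (hreg : ∀ v, G.degree v = k) (v : V) : G.squareGraph.degree v = k * (k - 1) := by
  have e : G.squareGraph.neighborFinset v =
      (G.neighborFinset v).biUnion fun l => (G.neighborFinset l).erase v := by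
    ext w
    simp only [mem_neighborFinset, Finset.mem_biUnion, Finset.mem_erase]
    constructor
    · rintro ⟨hne, l, hv, hw⟩
      exact ⟨l, hv, hne.symm, hw.symm⟩
    · rintro ⟨l, hv, hne, hw⟩
      exact ⟨hne.symm, l, hv, hw.symm⟩
  rw [← card_neighborFinset_eq_degree, e, Finset.card_biUnion]
  · rw [Finset.sum_const_nat (m := k - 1), card_neighborFinset_eq_degree, hreg]
    intro l hl
    rw [mem_neighborFinset] at hl
    rw [Finset.card_erase_of_mem (by rw [mem_neighborFinset]; exact hl.symm),
      card_neighborFinset_eq_degree, hreg]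
  · intro l hl m hm hlm
    rw [Function.onFun, Finset.disjoint_left]
    intro w hw hw'
    simp only [Finset.mem_erase, Finset.mem_coe, mem_neighborFinset] at hl hm hw hw'
    exact hlm (hone hw.1.symm hl hw.2.symm hm hw'.2.symm)

section Regular

variable {E : Type*} [AddCommGroup E] [Module ℝ E] (R : G.squareGraph.RootRepresentation E)
  {k : ℕ} (hk : 3 ≤ k) (hreg : ∀ v, G.degree v = k) (hone : G.Linear)

include R hk hreg hone

/-- A third point on the line joining p and s completes the edge to a triangle, as
`clawFree_of_regular` requires. -/
theorem Linear.squareGraph_clawFree : G.squareGraph.ClawFree := by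
  classical
  refine R.clawFree_of_regular (hone.degree_squareGraph hreg) ?_
  rintro p s ⟨hne, l, hp, hs⟩
  obtain ⟨c, hc, hcp, hcs⟩ := exists_adj_ne_ne (by rw [hreg]; exact hk : 3 ≤ G.degree l) p s
  exact ⟨c, squareGraph_adj hcp.symm hp hc.symm, squareGraph_adj hcs.symm hs hc.symm⟩

theorem Linear.false_of_three_common {s x a b c : V} (hsx : s ≠ x) (nsx : ¬G.squareGraph.Adj s x)
    (ha : G.squareGraph.Adj s a) (ha' : G.squareGraph.Adj x a) (hb : G.squareGraph.Adj s b)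
    (hb' : G.squareGraph.Adj x b) (hc : G.squareGraph.Adj s c) (hc' : G.squareGraph.Adj x c)
    (hab : a ≠ b) (hac : a ≠ c) (hbc : b ≠ c) : False := by
  classical
  have h6 : 6 ≤ k * (k - 1) := by
    obtain ⟨j, rfl⟩ := Nat.exists_eq_add_of_le hk
    have : 3 + j - 1 = 2 + j := by omega
    rw [this]
    nlinarith
  have := R.card_common_le_two (hone.degree_squareGraph hreg)
    (hone.squareGraph_clawFree R hk hreg) h6 hsx nsx
  have h3 : 2 < (G.squareGraph.neighborFinset s ∩ G.squareGraph.neighborFinset x).card := by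
    rw [Finset.two_lt_card]
    exact ⟨a, by simp [ha, ha'], b, by simp [hb, hb'], c, by simp [hc, hc'], hab, hac, hbc⟩
  omega

-- This supplies a large family of spins. A neighbour of x not joined to p cannot be joined to s,
-- since that would create an induced 4-cycle. Regularity of the square graph bounds the number of
-- these points from below, with one lost to p itself.
open Classical in
omit R hk in
theorem Linear.card_side {p s x : V}
    (R : G.squareGraph.RootRepresentation E)
    (hps : G.squareGraph.Adj p s) (hpx : G.squareGraph.Adj p x) (hsx : s ≠ x)
    (nsx : ¬G.squareGraph.Adj s x) :
    (∀ q ∈ ((G.squareGraph.neighborFinset x \ G.squareGraph.neighborFinset p).erase p),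
      G.squareGraph.IsSpin p s x q ∧ ¬G.squareGraph.Adj p q) ∧
    (G.squareGraph.neighborFinset p \ G.squareGraph.neighborFinset x).card ≤
    ((G.squareGraph.neighborFinset x \ G.squareGraph.neighborFinset p).erase p).card + 1 := by
  constructor
  · intro q hq
    simp only [Finset.mem_erase, Finset.mem_sdiff, mem_neighborFinset] at hq
    have := R.not_adj_of_adj_leaf hpx hps hsx.symm (fun h => nsx h.symm) hq.2.1 hq.2.2 hq.1.symm
    exact ⟨Or.inr ⟨hq.2.2, fun h => this h.symm, hq.2.1⟩, hq.2.2⟩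
  · have h1 := Finset.pred_card_le_card_erase
      (s := G.squareGraph.neighborFinset x \ G.squareGraph.neighborFinset p) (a := p)
    have h2 := RootRepresentation.card_neighborFinset_sdiff
      (hone.degree_squareGraph hreg) p x
    omega

-- The points of Y and X together are at least five spins. Let w be the third point of the line
-- joining x and z₂. If w were not collinear with p, then z₂, a spin of the other side, would be
-- joined to both z₁ and w, against `eq_of_adj_spin`. So w is collinear with p, necessarily on l₀.
-- All lines through p are then known, and z₁ is the only possible element of Y.
open Classical in
theorem Linear.false_of_third_line_of_two_le (hk3 : k = 3) {p s x l₀ l₁ l₂ z₁ z₂ : V}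
    (hpl₀ : G.Adj p l₀) (hpl₁ : G.Adj p l₁) (hpl₂ : G.Adj p l₂) (h₀₁ : l₀ ≠ l₁) (h₀₂ : l₀ ≠ l₂)
    (h₁₂ : l₁ ≠ l₂) (hsl : G.Adj s l₀) (hxl : G.Adj x l₁) (hsp : s ≠ p) (hxp : x ≠ p)
    (nsx : ¬G.squareGraph.Adj s x) (hz₁ : G.Adj z₁ l₂) (hz₂ : G.Adj z₂ l₂) (hz₁p : z₁ ≠ p)
    (hz₂p : z₂ ≠ p) (hz : z₁ ≠ z₂) (hz₁x : ¬G.squareGraph.Adj x z₁) (hz₂s : ¬G.squareGraph.Adj s z₂)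
    (hz₁s : G.squareGraph.Adj s z₁) (hz₂x : G.squareGraph.Adj x z₂)
    (hcard : 2 ≤ (Finset.univ.filter fun q => G.squareGraph.Adj p q ∧ G.squareGraph.Adj s q ∧
      ¬G.squareGraph.Adj x q).card) : False := by
  have hclaw : G.squareGraph.ClawFree := hone.squareGraph_clawFree R hk hreg
  have hps : G.squareGraph.Adj p s := squareGraph_adj hsp.symm hpl₀ hsl
  have hpx : G.squareGraph.Adj p x := squareGraph_adj hxp.symm hpl₁ hxl
  have hpz₁ : G.squareGraph.Adj p z₁ := squareGraph_adj hz₁p.symm hpl₂ hz₁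
  have hpz₂ : G.squareGraph.Adj p z₂ := squareGraph_adj hz₂p.symm hpl₂ hz₂
  have hsx : s ≠ x := by
    rintro rfl
    exact h₀₁ (hone hsp hsl hpl₀ hxl hpl₁)
  have hreg3 : ∀ v, G.degree v = 3 := fun v => (hreg v).trans hk3
  set Y := Finset.univ.filter fun q => G.squareGraph.Adj p q ∧ G.squareGraph.Adj s q ∧
      ¬G.squareGraph.Adj x q with hY
  obtain ⟨hX, hXc⟩ := hone.card_side hreg R hps hpx hsx nsx
  set X := (G.squareGraph.neighborFinset x \ G.squareGraph.neighborFinset p).erase p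
  have hYX : Disjoint Y X := by
    rw [Finset.disjoint_left]
    intro q hq hq'
    simp only [hY, Finset.mem_filter] at hq
    exact (hX q hq').2 hq.2.1
  have hYc : Y.card + 2 ≤ (G.squareGraph.neighborFinset p \ G.squareGraph.neighborFinset x).card := by
    have e : (insert s (insert x Y)).card = Y.card + 2 := by
      rw [Finset.card_insert_of_notMem, Finset.card_insert_of_notMem]
      · simp [hY, nsx]
      · simp [hY, hsx]
    rw [← e]
    apply Finset.card_le_card
    intro q hq
    simp only [Finset.mem_insert, hY, Finset.mem_filter, Finset.mem_univ, true_and] at hq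
    simp only [Finset.mem_sdiff, mem_neighborFinset]
    rcases hq with rfl | rfl | hq
    · exact ⟨hps, fun h => nsx h.symm⟩
    · exact ⟨hpx, G.squareGraph.loopless.irrefl _⟩
    · exact ⟨hq.1, hq.2.2⟩
  have hT : ∀ q ∈ Y ∪ X, G.squareGraph.IsSpin p s x q := by
    intro q hq
    rcases Finset.mem_union.1 hq with hq | hq
    · simp only [hY, Finset.mem_filter] at hq
      exact Or.inl hq.2
    · exact (hX q hq).1
  have hTc : 5 ≤ (Y ∪ X).card := by
    rw [Finset.card_union_of_disjoint hYX]
    omega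
  obtain ⟨-, m, hxm, hz₂m⟩ := id hz₂x
  have hxz₂ : x ≠ z₂ := hz₂x.1
  have hpm : ¬G.Adj p m := by
    intro hpm
    have e : m = l₁ := hone hxp hxm hpm hxl hpl₁
    have e' : m = l₂ := hone hz₂p hz₂m hpm hz₂ hpl₂
    exact h₁₂ (e.symm.trans e')
  obtain ⟨w, hw, hwx, hwz₂⟩ := exists_adj_ne_ne (hreg3 m).ge x z₂
  have hxw : G.squareGraph.Adj x w := squareGraph_adj hwx.symm hxm hw.symm
  have hzw : G.squareGraph.Adj z₂ w := squareGraph_adj hwz₂.symm hz₂m hw.symm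
  have hwp : w ≠ p := by rintro rfl; exact hpm hw.symm
  have hpw : G.squareGraph.Adj p w := by
    by_contra hpw
    have hwX : w ∈ X := by
      simp only [X, Finset.mem_erase, Finset.mem_sdiff, mem_neighborFinset]
      exact ⟨hwp, hxw, hpw⟩
    have hzY : z₁ ∈ Y := by simp [hY, hpz₁, hz₁s, hz₁x]
    have := R.eq_of_adj_spin hclaw hps hpx hsx nsx hT hTc (Or.inl ⟨hpz₂, hz₂x, hz₂s⟩)
      (Finset.mem_union_left _ hzY) (Finset.mem_union_right _ hwX)
      (squareGraph_adj hz.symm hz₂ hz₁) hzw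
    exact hpw (this ▸ hpz₁)
  obtain ⟨-, n, hpn, hwn⟩ := hpw
  have hwl₀ : G.Adj w l₀ := by
    rcases eq_of_degree_eq_three (hreg3 p) hpl₀ hpl₁ hpl₂ h₀₁ h₀₂ h₁₂ hpn with rfl | rfl | rfl
    · exact hwn
    · have := hone hwx hwn hxl hw.symm hxm
      exact absurd (this ▸ hpl₁) hpm
    · have := hone hwz₂ hwn hz₂ hw.symm hz₂m
      exact absurd (this ▸ hpl₂) hpm
  have hws : w ≠ s := by rintro rfl; exact nsx hxw.symm
  have hYs : Y ⊆ {z₁} := by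
    intro y hy
    simp only [hY, Finset.mem_filter, Finset.mem_univ, true_and] at hy
    obtain ⟨⟨hpy, n', hpn', hyn'⟩, hsy, hxy⟩ := hy
    rw [Finset.mem_singleton]
    rcases eq_of_degree_eq_three (hreg3 p) hpl₀ hpl₁ hpl₂ h₀₁ h₀₂ h₁₂ hpn' with rfl | rfl | rfl
    · rcases eq_of_degree_eq_three (hreg3 n') hpl₀.symm hsl.symm hwl₀.symm hsp.symm hwp.symm
        hws.symm hyn'.symm with rfl | rfl | rfl
      · exact absurd rfl hpy
      · exact absurd rfl hsy.1
      · exact absurd hxw hxy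
    · by_cases hyx : x = y
      · subst hyx
        exact absurd hsy nsx
      · exact absurd (squareGraph_adj hyx hxl hyn') hxy
    · rcases eq_of_degree_eq_three (hreg3 n') hpl₂.symm hz₁.symm hz₂.symm hz₁p.symm hz₂p.symm
        hz hyn'.symm with rfl | rfl | rfl
      · exact absurd rfl hpy
      · rfl
      · exact absurd hsy hz₂s
  have := Finset.card_le_card hYs
  rw [Finset.card_singleton] at this
  omega

open Classical in
/-- Given two non-collinear points on different lines through `p`, any third line through `p` is
full for one of them. -/
theorem Linear.false_of_third_line {p s x l₀ l₁ l₂ z₁ z₂ : V}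
    (hpl₀ : G.Adj p l₀) (hpl₁ : G.Adj p l₁) (hpl₂ : G.Adj p l₂) (h₀₁ : l₀ ≠ l₁) (h₀₂ : l₀ ≠ l₂)
    (h₁₂ : l₁ ≠ l₂) (hsl : G.Adj s l₀) (hxl : G.Adj x l₁) (hsp : s ≠ p) (hxp : x ≠ p)
    (nsx : ¬G.squareGraph.Adj s x) (hz₁ : G.Adj z₁ l₂) (hz₂ : G.Adj z₂ l₂) (hz₁p : z₁ ≠ p)
    (hz₂p : z₂ ≠ p) (hz₁x : ¬G.squareGraph.Adj x z₁) (hz₂s : ¬G.squareGraph.Adj s z₂) : False := by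
  have hclaw : G.squareGraph.ClawFree := hone.squareGraph_clawFree R hk hreg
  have hps : G.squareGraph.Adj p s := squareGraph_adj hsp.symm hpl₀ hsl
  have hpx : G.squareGraph.Adj p x := squareGraph_adj hxp.symm hpl₁ hxl
  have hsx : s ≠ x := by
    rintro rfl
    exact h₀₁ (hone hsp hsl hpl₀ hxl hpl₁)
  have nsl₂ : ∀ {q}, G.Adj q l₂ → s ≠ q := by
    rintro q hq rfl
    exact h₀₂ (hone hsp hsl hpl₀ hq hpl₂)
  have nxl₂ : ∀ {q}, G.Adj q l₂ → x ≠ q := by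
    rintro q hq rfl
    exact h₁₂ (hone hxp hxl hpl₁ hq hpl₂)
  have third : ∀ {q}, G.Adj q l₂ → q ≠ p → G.squareGraph.Adj s q ∨ G.squareGraph.Adj x q := by
    intro q hq hqp
    rcases hclaw hps hpx (squareGraph_adj hqp.symm hpl₂ hq) hsx (nsl₂ hq) (nxl₂ hq) with h | h | h
    exacts [absurd h nsx, Or.inl h, Or.inr h]
  have hz₁s : G.squareGraph.Adj s z₁ := (third hz₁ hz₁p).resolve_right hz₁x
  have hz₂x : G.squareGraph.Adj x z₂ := (third hz₂ hz₂p).resolve_left hz₂s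
  have hz : z₁ ≠ z₂ := by rintro rfl; exact hz₂s hz₁s
  -- A further point q of l₂ is joined to s or to x. In the first case s and z₂ share p, z₁, q; in
  -- the second x and z₁ share p, z₂, q. Both pairs are non-adjacent, so this is one common
  -- neighbour too many.
  have line : ∀ q, G.Adj l₂ q → q = p ∨ q = z₁ ∨ q = z₂ := by
    intro q hq
    by_contra! hc
    obtain ⟨hqp, hqz₁, hqz₂⟩ := hc
    rcases third hq.symm hqp with h | h
    · exact hone.false_of_three_common R hk hreg (nsl₂ hz₂) hz₂s hps.symm
        (squareGraph_adj hz₂p hz₂ hpl₂) hz₁s (squareGraph_adj hz.symm hz₂ hz₁) h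
        (squareGraph_adj hqz₂.symm hz₂ hq.symm) hz₁p.symm hqp.symm hqz₁.symm
    · exact hone.false_of_three_common R hk hreg (nxl₂ hz₁) hz₁x hpx.symm
        (squareGraph_adj hz₁p hz₁ hpl₂) hz₂x (squareGraph_adj hz hz₁ hz₂) h
        (squareGraph_adj hqz₁.symm hz₁ hq.symm) hz₂p.symm hqp.symm hqz₂.symm
  have hk3 : k = 3 := le_antisymm (by rw [← hreg l₂]; exact degree_le_three line) hk
  set Y := Finset.univ.filter fun q => G.squareGraph.Adj p q ∧ G.squareGraph.Adj s q ∧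
      ¬G.squareGraph.Adj x q with hY
  set Y' := Finset.univ.filter fun q => G.squareGraph.Adj p q ∧ G.squareGraph.Adj x q ∧
      ¬G.squareGraph.Adj s q with hY'
  set Z := G.squareGraph.neighborFinset s ∩ G.squareGraph.neighborFinset x with hZ
  have hZc : Z.card ≤ 2 := by
    by_contra! hc
    obtain ⟨a, ha, b, hb, c, hc, hab, hac, hbc⟩ := Finset.two_lt_card.1 hc
    simp only [hZ, Finset.mem_inter, mem_neighborFinset] at ha hb hc
    exact hone.false_of_three_common R hk hreg hsx nsx ha.1 ha.2 hb.1 hb.2 hc.1 hc.2 hab hac hbc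
  have hpZ : p ∈ Z := by simp [hZ, hps.symm, hpx.symm]
  have hZe : (Z.erase p).card ≤ 1 := by
    rw [Finset.card_erase_of_mem hpZ]
    omega
  have hcover : G.squareGraph.neighborFinset p ⊆ {s, x} ∪ (Z.erase p ∪ (Y ∪ Y')) := by
    intro q hq
    rw [mem_neighborFinset] at hq
    simp only [Finset.mem_union, Finset.mem_insert, Finset.mem_singleton, hZ, hY, hY',
      Finset.mem_erase, Finset.mem_inter, mem_neighborFinset, Finset.mem_filter, Finset.mem_univ,
      true_and]
    by_cases hqs : q = s
    · exact Or.inl (Or.inl hqs)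
    by_cases hqx : q = x
    · exact Or.inl (Or.inr hqx)
    have := hclaw hps hpx hq hsx (fun h => hqs h.symm) (fun h => hqx h.symm)
    have hqp := hq.ne'
    tauto
  -- The 6 neighbours of p are covered by s, x, at most one further common neighbour of s and x, and
  -- Y ∪ Y'. Thus Y ∪ Y' has at least 3 elements, and Y or Y' has at least 2.
  have hcard := Finset.card_le_card hcover
  rw [card_neighborFinset_eq_degree, hone.degree_squareGraph hreg, hk3] at hcard
  have c1 := Finset.card_union_le {s, x} (Z.erase p ∪ (Y ∪ Y'))
  have c2 := Finset.card_union_le (Z.erase p) (Y ∪ Y')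
  have c3 := Finset.card_union_le Y Y'
  have c4 := Finset.card_le_two (a := s) (b := x)
  obtain h2 | h2 : 2 ≤ Y.card ∨ 2 ≤ Y'.card := by omega
  · exact hone.false_of_third_line_of_two_le R hk hreg hk3 hpl₀ hpl₁ hpl₂ h₀₁ h₀₂ h₁₂ hsl hxl hsp
      hxp nsx hz₁ hz₂ hz₁p hz₂p hz hz₁x hz₂s hz₁s hz₂x h2
  · exact hone.false_of_third_line_of_two_le R hk hreg hk3 hpl₁ hpl₀ hpl₂ h₀₁.symm h₁₂ h₀₂ hxl hsl
      hxp hsp (fun h => nsx h.symm) hz₂ hz₁ hz₂p hz₁p hz.symm hz₂s hz₁x hz₂x hz₁s h2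

end Regular

end SimpleGraph

/-! ### Transitivity of the square graph -/

namespace SimpleGraph

variable {V : Type*} [Fintype V] [DecidableEq V] {G : SimpleGraph V} [DecidableRel G.Adj]

theorem exists_adj_ne_ne_ne {v : V} (h : 4 ≤ G.degree v) (a b c : V) :
    ∃ d, G.Adj v d ∧ d ≠ a ∧ d ≠ b ∧ d ≠ c := by
  have : 0 < ((((G.neighborFinset v).erase a).erase b).erase c).card := by
    have h1 := Finset.pred_card_le_card_erase (s := G.neighborFinset v) (a := a)
    have h2 := Finset.pred_card_le_card_erase (s := (G.neighborFinset v).erase a) (a := b)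
    have h3 := Finset.pred_card_le_card_erase
      (s := ((G.neighborFinset v).erase a).erase b) (a := c)
    rw [card_neighborFinset_eq_degree] at h1
    omega
  obtain ⟨d, hd⟩ := Finset.card_pos.1 this
  simp only [Finset.mem_erase, mem_neighborFinset] at hd
  exact ⟨d, hd.2.2.2, hd.2.2.1, hd.2.1, hd.1⟩

section Regular

variable {E : Type*} [AddCommGroup E] [Module ℝ E] (R : G.squareGraph.RootRepresentation E)
  {k : ℕ} (hk : 3 ≤ k) (hreg : ∀ v, G.degree v = k) (hone : G.Linear)

include R hk hreg hone

open Classical in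
/-- A point `s` that is joined to a whole line through `p` is joined to all points collinear
with `p`: the case of three lines through each point. -/
theorem Linear.false_of_meet_of_eq_three (hk3 : k = 3) {p s x l₀ l₁ l₂ n z₁ z₂ u : V}
    (hpl₀ : G.Adj p l₀) (hpl₁ : G.Adj p l₁) (hpl₂ : G.Adj p l₂) (h₀₁ : l₀ ≠ l₁) (h₀₂ : l₀ ≠ l₂)
    (h₁₂ : l₁ ≠ l₂) (hsl : G.Adj s l₀) (hxl : G.Adj x l₁) (hsp : s ≠ p) (hxp : x ≠ p)
    (nsx : ¬G.squareGraph.Adj s x) (hz₁ : G.Adj z₁ l₂) (hz₂ : G.Adj z₂ l₂) (hz₁p : z₁ ≠ p)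
    (hz₂p : z₂ ≠ p) (hz : z₁ ≠ z₂) (hsz₁ : G.squareGraph.Adj s z₁) (hsz₂ : G.squareGraph.Adj s z₂)
    (hul : G.Adj u l₁) (hup : u ≠ p) (hsu : G.squareGraph.Adj s u) (hxu : G.squareGraph.Adj x u)
    (hun : G.Adj u n) (hzn : G.Adj z₂ n) : False := by
  have hclaw : G.squareGraph.ClawFree := hone.squareGraph_clawFree R hk hreg
  have hps : G.squareGraph.Adj p s := squareGraph_adj hsp.symm hpl₀ hsl
  have hpx : G.squareGraph.Adj p x := squareGraph_adj hxp.symm hpl₁ hxl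
  have hpu : G.squareGraph.Adj p u := squareGraph_adj hup.symm hpl₁ hul
  have hpz₁ : G.squareGraph.Adj p z₁ := squareGraph_adj hz₁p.symm hpl₂ hz₁
  have hpz₂ : G.squareGraph.Adj p z₂ := squareGraph_adj hz₂p.symm hpl₂ hz₂
  have ne : ∀ {a b l m : V}, G.Adj p l → G.Adj p m → l ≠ m → G.Adj a l → G.Adj b m → a ≠ p →
      a ≠ b := by
    rintro a b l m hl hm hlm ha hb hap rfl
    exact hlm (hone hap ha hl hb hm)
  have hsx : s ≠ x := ne hpl₀ hpl₁ h₀₁ hsl hxl hsp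
  have common : ∀ {q}, q ≠ p → q ≠ u → G.squareGraph.Adj s q → ¬G.squareGraph.Adj x q :=
    fun hqp hqu hsq hxq => hone.false_of_three_common R hk hreg hsx nsx hps.symm hpx.symm hsu hxu
      hsq hxq hup.symm hqp.symm hqu.symm
  have nz₁ := common hz₁p (ne hpl₂ hpl₁ h₁₂.symm hz₁ hul hz₁p) hsz₁
  have huz₂ : z₂ ≠ u := ne hpl₂ hpl₁ h₁₂.symm hz₂ hul hz₂p
  have nz₂ := common hz₂p huz₂ hsz₂
  obtain ⟨r, hr, hrp, hrs⟩ := exists_adj_ne_ne ((hreg l₀).trans hk3).ge p s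
  have nr := common hrp (ne hpl₀ hpl₁ h₀₁ hr.symm hul hrp) (squareGraph_adj hrs.symm hsl hr.symm)
  obtain ⟨hX, hXc⟩ := hone.card_side hreg R hps hpx hsx nsx
  set X := (G.squareGraph.neighborFinset x \ G.squareGraph.neighborFinset p).erase p
  have h5 : 5 ≤ (G.squareGraph.neighborFinset p \ G.squareGraph.neighborFinset x).card := by
    have e : ({x, s, r, z₁, z₂} : Finset V).card = 5 := by
      rw [Finset.card_insert_of_notMem, Finset.card_insert_of_notMem,
        Finset.card_insert_of_notMem, Finset.card_pair hz]
      · simp [ne hpl₀ hpl₂ h₀₂ hr.symm hz₁ hrp, ne hpl₀ hpl₂ h₀₂ hr.symm hz₂ hrp]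
      · simp [ne hpl₀ hpl₂ h₀₂ hsl hz₁ hsp, ne hpl₀ hpl₂ h₀₂ hsl hz₂ hsp, hrs.symm]
      · simp [ne hpl₁ hpl₂ h₁₂ hxl hz₁ hxp, ne hpl₁ hpl₂ h₁₂ hxl hz₂ hxp, hsx.symm,
          ne hpl₁ hpl₀ h₀₁.symm hxl hr.symm hxp]
    rw [← e]
    apply Finset.card_le_card
    intro q hq
    simp only [Finset.mem_insert, Finset.mem_singleton] at hq
    simp only [Finset.mem_sdiff, mem_neighborFinset]
    rcases hq with rfl | rfl | rfl | rfl | rfl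
    · exact ⟨hpx, G.squareGraph.loopless.irrefl _⟩
    · exact ⟨hps, fun h => nsx h.symm⟩
    · exact ⟨squareGraph_adj hrp.symm hpl₀ hr.symm, nr⟩
    · exact ⟨hpz₁, nz₁⟩
    · exact ⟨hpz₂, nz₂⟩
  have hT : ∀ q ∈ insert z₂ X, G.squareGraph.IsSpin p s x q := by
    intro q hq
    rcases Finset.mem_insert.1 hq with rfl | hq
    · exact Or.inl ⟨hpz₂, hsz₂, nz₂⟩
    · exact (hX q hq).1
  have hTc : 5 ≤ (insert z₂ X).card := by
    rw [Finset.card_insert_of_notMem fun h => (hX _ h).2 hpz₂]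
    omega
  -- The point u is a common neighbour of p, s, x and is joined to z₂, hence to all of the at least
  -- five spins. That makes at least 8 neighbours, but the valency is 3 · 2 = 6.
  have hN : insert p (insert s (insert x (insert z₂ X))) ⊆ G.squareGraph.neighborFinset u := by
    intro q hq
    rw [mem_neighborFinset]
    rcases Finset.mem_insert.1 hq with rfl | hq
    · exact hpu.symm
    rcases Finset.mem_insert.1 hq with rfl | hq
    · exact hsu.symm
    rcases Finset.mem_insert.1 hq with rfl | hq
    · exact hxu.symm
    exact R.adj_spin_of_adj_spin hclaw hps hpx hsx nsx hT hTc hpu hsu hxu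
      (Finset.mem_insert_self _ _) hq (squareGraph_adj huz₂.symm hun hzn)
  have hc := Finset.card_le_card hN
  have hne := fun q hq => (hT q hq).ne hps hpx nsx
  rw [card_neighborFinset_eq_degree, hone.degree_squareGraph hreg, hk3,
    Finset.card_insert_of_notMem, Finset.card_insert_of_notMem,
    Finset.card_insert_of_notMem] at hc
  · omega
  · exact fun h => (hne _ h).2.2 rfl
  · rw [Finset.mem_insert]
    exact fun h => h.elim hsx fun h => (hne _ h).2.1 rfl
  · rw [Finset.mem_insert, Finset.mem_insert]
    rintro (h | h | h)
    exacts [hsp h.symm, hxp h.symm, (hne _ h).1 rfl]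

-- Every line through s meets l₂. Choose a point d joined to s but not to p, on a line n₁ through s.
-- Any line n through s other than l₀ and n₁ meets l₂ in a point not joined to d, as otherwise d and
-- p would share three neighbours. By `false_of_third_line` at s, all of n is joined to p, so n
-- meets l₁ in a common neighbour of s and x. For k ≥ 4 two such lines and p give three common
-- neighbours; k = 3 is `false_of_meet_of_eq_three`.
open Classical in
theorem Linear.false_of_full_line {p s x l₀ l₁ l₂ : V}
    (hpl₀ : G.Adj p l₀) (hpl₁ : G.Adj p l₁) (hpl₂ : G.Adj p l₂) (h₀₁ : l₀ ≠ l₁) (h₀₂ : l₀ ≠ l₂)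
    (h₁₂ : l₁ ≠ l₂) (hsl : G.Adj s l₀) (hxl : G.Adj x l₁) (hsp : s ≠ p) (hxp : x ≠ p)
    (nsx : ¬G.squareGraph.Adj s x)
    (full : ∀ z, G.Adj z l₂ → z ≠ p → G.squareGraph.Adj s z) : False := by
  have hps : G.squareGraph.Adj p s := squareGraph_adj hsp.symm hpl₀ hsl
  have hpx : G.squareGraph.Adj p x := squareGraph_adj hxp.symm hpl₁ hxl
  have hsx : s ≠ x := by
    rintro rfl
    exact h₀₁ (hone hsp hsl hpl₀ hxl hpl₁)
  have nsl₂ : ¬G.Adj s l₂ := fun h => h₀₂ (hone hsp hsl hpl₀ h hpl₂)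
  have nsl₁ : ¬G.Adj s l₁ := fun h => h₀₁ (hone hsp hsl hpl₀ h hpl₁)
  have meet : ∀ {n}, G.Adj s n → ∃ q, G.Adj l₂ q ∧ G.Adj n q := by
    intro n hn
    refine hone.exists_meet nsl₂ (by rw [hreg, hreg]) (fun q hq => ?_) hn
    by_cases hqp : q = p
    · exact ⟨l₀, hsl, hqp ▸ hpl₀⟩
    · exact (full q hq.symm hqp).2
  obtain ⟨d, hd⟩ : ((G.squareGraph.neighborFinset s \ G.squareGraph.neighborFinset p).erase
      p).Nonempty := by
    rw [← Finset.card_pos]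
    have h1 := (hone.card_side hreg R hpx hps hsx.symm (fun h => nsx h.symm)).2
    have h2 : 1 < (G.squareGraph.neighborFinset p \ G.squareGraph.neighborFinset s).card := by
      rw [Finset.one_lt_card]
      refine ⟨s, ?_, x, ?_, hsx⟩ <;> simp [hps, hpx, nsx]
    omega
  simp only [Finset.mem_erase, Finset.mem_sdiff, mem_neighborFinset] at hd
  obtain ⟨hdp, ⟨hsd, n₁, hsn₁, hdn₁⟩, npd⟩ := hd
  have npn₁ : ¬G.Adj p n₁ := fun h => npd (squareGraph_adj hdp.symm h hdn₁)
  have hn₁l₀ : n₁ ≠ l₀ := by rintro rfl; exact npn₁ hpl₀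
  obtain ⟨z₁, hz₁, hz₁n⟩ := meet hsn₁
  have hz₁p : z₁ ≠ p := by rintro rfl; exact npn₁ hz₁n.symm
  have hpz₁ : G.squareGraph.Adj p z₁ := squareGraph_adj hz₁p.symm hpl₂ hz₁.symm
  have hsz₁ : s ≠ z₁ := by rintro rfl; exact nsl₂ hz₁.symm
  have third : ∀ n, G.Adj s n → n ≠ l₀ → n ≠ n₁ → ∃ z₂ u, G.Adj l₂ z₂ ∧ z₂ ≠ p ∧ z₁ ≠ z₂ ∧
      G.Adj n z₂ ∧ G.Adj n u ∧ G.Adj l₁ u ∧ u ≠ p ∧ u ≠ s ∧ u ≠ x := by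
    intro n hsn hnl₀ hnn₁
    have npn : ¬G.Adj p n := fun h => hnl₀ (hone hsp hsn h hsl hpl₀)
    obtain ⟨z₂, hz₂, hz₂n⟩ := meet hsn
    have hz₂p : z₂ ≠ p := by rintro rfl; exact npn hz₂n.symm
    have hsz₂ : s ≠ z₂ := by rintro rfl; exact nsl₂ hz₂.symm
    have hz : z₁ ≠ z₂ := by
      rintro rfl
      exact hnn₁ (hone hsz₁ hsn hz₂n.symm hsn₁ hz₁n.symm)
    have ndz₂ : ¬G.squareGraph.Adj d z₂ := by
      intro h
      have hdz₁ : d ≠ z₁ := by rintro rfl; exact npd hpz₁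
      exact hone.false_of_three_common R hk hreg hdp (fun h => npd h.symm)
        (squareGraph_adj hsd.symm hdn₁ hsn₁) hps (squareGraph_adj hdz₁ hdn₁ hz₁n.symm) hpz₁
        h (squareGraph_adj hz₂p.symm hpl₂ hz₂.symm) hsz₁ hsz₂ hz
    have hfull : ∀ q, G.Adj n q → q ≠ s → G.squareGraph.Adj p q := by
      intro q hq hqs
      by_contra hpq
      exact hone.false_of_third_line R hk hreg hsl hsn₁ hsn hn₁l₀.symm hnl₀.symm hnn₁.symm hpl₀
        hdn₁ hsp.symm hsd.symm npd hz₂n.symm hq.symm hsz₂.symm hqs ndz₂ hpq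
    obtain ⟨u, hun, hul⟩ := hone.exists_meet npn (by rw [hreg, hreg]) (fun q hq => by
      by_cases hqs : q = s
      · exact ⟨l₀, hpl₀, hqs ▸ hsl⟩
      · exact (hfull q hq hqs).2) hpl₁
    refine ⟨z₂, u, hz₂, hz₂p, hz, hz₂n, hun, hul, ?_, ?_, ?_⟩
    · rintro rfl; exact npn hun.symm
    · rintro rfl; exact nsl₁ hul.symm
    · rintro rfl; exact nsx (squareGraph_adj hsx hsn hun.symm)
  obtain ⟨n, hsn, hnl₀, hnn₁⟩ := exists_adj_ne_ne (by rw [hreg]; exact hk : 3 ≤ G.degree s) l₀ n₁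
  obtain ⟨z₂, u, hz₂, hz₂p, hz, hz₂n, hun, hul, hup, hus, hux⟩ := third n hsn hnl₀ hnn₁
  have hsu : G.squareGraph.Adj s u := squareGraph_adj hus.symm hsn hun.symm
  have hxu : G.squareGraph.Adj x u := squareGraph_adj hux.symm hxl hul.symm
  obtain hk3 | hk4 : k = 3 ∨ 4 ≤ k := by omega
  · exact hone.false_of_meet_of_eq_three R hk hreg hk3 hpl₀ hpl₁ hpl₂ h₀₁ h₀₂ h₁₂ hsl hxl hsp hxp
      nsx hz₁.symm hz₂.symm hz₁p hz₂p hz (full _ hz₁.symm hz₁p) (full _ hz₂.symm hz₂p) hul.symm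
      hup hsu hxu hun.symm hz₂n.symm
  · obtain ⟨n', hsn', hnl₀', hnn₁', hnn'⟩ :=
      exists_adj_ne_ne_ne (by rw [hreg]; exact hk4 : 4 ≤ G.degree s) l₀ n₁ n
    obtain ⟨-, u', -, -, -, -, hun', hul', hup', hus', hux'⟩ := third n' hsn' hnl₀' hnn₁'
    have huu : u ≠ u' := by
      rintro rfl
      exact hnn' (hone hus hun'.symm hsn' hun.symm hsn)
    exact hone.false_of_three_common R hk hreg hsx nsx hps.symm hpx.symm hsu hxu
      (squareGraph_adj hus'.symm hsn' hun'.symm) (squareGraph_adj hux'.symm hxl hul'.symm)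
      hup.symm hup'.symm huu

/-- If s and x were not joined, a third line through p would be full for neither of them by
`false_of_full_line`, but must be full for one of them by `false_of_third_line`. -/
theorem Linear.squareGraph_trans {p s x : V} (hps : G.squareGraph.Adj p s)
    (hpx : G.squareGraph.Adj p x) (hsx : s ≠ x) : G.squareGraph.Adj s x := by
  by_contra nsx
  obtain ⟨hsp, l₀, hpl₀, hsl⟩ := hps
  obtain ⟨hxp, l₁, hpl₁, hxl⟩ := hpx
  have h₀₁ : l₀ ≠ l₁ := by rintro rfl; exact nsx (squareGraph_adj hsx hsl hxl)
  obtain ⟨l₂, hpl₂, h₂₀, h₂₁⟩ := exists_adj_ne_ne (by rw [hreg]; exact hk : 3 ≤ G.degree p) l₀ l₁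
  have hs : ∃ z, G.Adj z l₂ ∧ z ≠ p ∧ ¬G.squareGraph.Adj s z := by
    by_contra! h
    exact hone.false_of_full_line R hk hreg hpl₀ hpl₁ hpl₂ h₀₁ h₂₀.symm h₂₁.symm hsl hxl hsp.symm
      hxp.symm nsx h
  have hx : ∃ z, G.Adj z l₂ ∧ z ≠ p ∧ ¬G.squareGraph.Adj x z := by
    by_contra! h
    exact hone.false_of_full_line R hk hreg hpl₁ hpl₀ hpl₂ h₀₁.symm h₂₁.symm h₂₀.symm hxl hsl
      hxp.symm hsp.symm (fun h => nsx h.symm) h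
  obtain ⟨z₂, hz₂, hz₂p, nz₂⟩ := hs
  obtain ⟨z₁, hz₁, hz₁p, nz₁⟩ := hx
  exact hone.false_of_third_line R hk hreg hpl₀ hpl₁ hpl₂ h₀₁ h₂₀.symm h₂₁.symm hsl hxl hsp.symm
    hxp.symm nsx hz₁ hz₂ hz₁p hz₂p nz₁ nz₂

end Regular

end SimpleGraph

/-! ### Regularity of G from positive definiteness -/

namespace SimpleGraph

variable {V : Type*} [Fintype V] [DecidableEq V] {G : SimpleGraph V} [DecidableRel G.Adj]

/-- Let v have degree D - 1 and let s lie on a line l₀ chosen so that all other lines through v have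
degree D. Every line m ≠ l₀ through s meets l₁, and `hout` makes all its points collinear with v.
Its points other than s thus inject into the lines through v other than l₀, so m has degree D - 1.
As s has degree D ≥ 3, two such lines share s, against `hdef`. -/
theorem Linear.degree_eq_of_irregular_conditions (hone : G.Linear) {D : ℕ} (hD : 3 ≤ D)
    (hdeg : ∀ v, G.degree v = D ∨ G.degree v = D - 1)
    (hdef : ∀ {u v}, G.squareGraph.Adj u v → G.degree u = D - 1 → G.degree v = D)
    (hclique : ∀ {p s s'}, G.degree p = D - 1 → G.squareGraph.Adj p s → G.squareGraph.Adj p s' →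
      s ≠ s' → G.squareGraph.Adj s s')
    (hout : ∀ {p s s' q}, G.degree p = D - 1 → G.squareGraph.Adj p s → G.squareGraph.Adj p s' →
      s ≠ s' → G.squareGraph.Adj q s → G.squareGraph.Adj q s' → q ≠ p → G.squareGraph.Adj p q)
    (v : V) : G.degree v = D := by
  refine (hdeg v).resolve_right fun hp => ?_
  obtain ⟨l₀, hpl₀, hl₀⟩ : ∃ l₀, G.Adj v l₀ ∧ ∀ l, G.Adj v l → l ≠ l₀ → G.degree l = D := by
    by_cases h : ∃ l₀, G.Adj v l₀ ∧ G.degree l₀ = D - 1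
    · obtain ⟨l₀, h₀, h₁⟩ := h
      exact ⟨l₀, h₀, fun l hl hne => hdef (squareGraph_adj hne.symm h₀.symm hl.symm) h₁⟩
    · obtain ⟨l₀, h₀⟩ := (G.degree_pos_iff_exists_adj v).1 (by omega)
      exact ⟨l₀, h₀, fun l hl _ => (hdeg l).resolve_right fun h' => h ⟨l, hl, h'⟩⟩
  have exists_ne : ∀ {w : V} (a : V), 2 ≤ G.degree w → ∃ b, G.Adj w b ∧ b ≠ a := by
    intro w a h
    rw [← card_neighborFinset_eq_degree] at h
    obtain ⟨b, hb, hne⟩ := Finset.exists_mem_ne (s := G.neighborFinset w) (by omega) a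
    exact ⟨b, by simpa using hb, hne⟩
  obtain ⟨l₁, hpl₁, h₁₀⟩ := exists_ne (w := v) l₀ (by omega)
  obtain ⟨s, hsl, hsp⟩ := exists_ne (w := l₀) v (by rcases hdeg l₀ with h | h <;> omega)
  have hps : G.squareGraph.Adj v s := squareGraph_adj hsp.symm hpl₀ hsl.symm
  have hsd : G.degree s = D := hdef hps hp
  have nsl₁ : ¬G.Adj s l₁ := fun h => h₁₀ (hone hsp h hpl₁ hsl.symm hpl₀)
  have short : ∀ m, G.Adj s m → m ≠ l₀ → G.degree m = D - 1 := by
    intro m hsm hm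
    have npm : ¬G.Adj v m := fun h => hm (hone hsp hsm h hsl.symm hpl₀)
    obtain ⟨z, hz, hzm⟩ := hone.exists_meet nsl₁ (by rw [hsd, hl₀ l₁ hpl₁ h₁₀]) (fun q hq => by
      by_cases hqp : q = v
      · exact ⟨l₀, hsl.symm, hqp ▸ hpl₀⟩
      · have hsq : s ≠ q := by rintro rfl; exact nsl₁ hq.symm
        exact (hclique hp hps (squareGraph_adj (Ne.symm hqp) hpl₁ hq.symm) hsq).2) hsm
    have hzp : z ≠ v := by rintro rfl; exact npm hzm.symm
    have hsz : s ≠ z := by rintro rfl; exact nsl₁ hz.symm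
    have hpz : G.squareGraph.Adj v z := squareGraph_adj hzp.symm hpl₁ hz.symm
    have hin : ∀ q, G.Adj m q → q ≠ s → ∃ l, G.Adj v l ∧ G.Adj q l := by
      intro q hq hqs
      have hqp : q ≠ v := by rintro rfl; exact npm hq.symm
      by_cases hqz : q = z
      · exact hqz ▸ hpz.2
      · exact (hout hp hps hpz hsz (squareGraph_adj hqs hq.symm hsm)
          (squareGraph_adj hqz hq.symm hzm.symm) hqp).2
    choose! f hf using hin
    have hle : ((G.neighborFinset m).erase s).card ≤ ((G.neighborFinset v).erase l₀).card := by
      apply Finset.card_le_card_of_injOn f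
      · intro q hq
        simp only [Finset.coe_erase, coe_neighborFinset, Set.mem_sdiff, mem_neighborSet,
          Set.mem_singleton_iff] at hq ⊢
        refine ⟨(hf q hq.1 hq.2).1, fun h => hm ?_⟩
        exact hone hq.2 hq.1.symm hsm (h ▸ (hf q hq.1 hq.2).2) hsl.symm
      · intro q hq q' hq' e
        simp only [Finset.coe_erase, coe_neighborFinset, Set.mem_sdiff, mem_neighborSet,
          Set.mem_singleton_iff] at hq hq'
        by_contra hne
        have := hone hne (hf q hq.1 hq.2).2 (by rw [e]; exact (hf q' hq'.1 hq'.2).2) hq.1.symm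
          hq'.1.symm
        exact npm (this ▸ (hf q hq.1 hq.2).1)
    rw [Finset.card_erase_of_mem (by simpa using hsm.symm),
      Finset.card_erase_of_mem (by simpa using hpl₀), card_neighborFinset_eq_degree,
      card_neighborFinset_eq_degree, hp] at hle
    rcases hdeg m with h | h <;> omega
  obtain ⟨m, hsm, hm⟩ := exists_ne (w := s) l₀ (by omega)
  obtain ⟨m', hsm', hm', hmm'⟩ := exists_adj_ne_ne (by omega : 3 ≤ G.degree s) l₀ m
  have := hdef (squareGraph_adj hmm'.symm hsm.symm hsm'.symm) (short m hsm hm)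
  have := short m' hsm' hm'
  omega

open Matrix in
/-- The bilinear form of the matrix `A² - c`. -/
noncomputable def sqForm (G : SimpleGraph V) [DecidableRel G.Adj] (c : ℝ) :
    LinearMap.BilinForm ℝ (V → ℝ) :=
  Matrix.toBilin' (G.adjMatrix ℝ * G.adjMatrix ℝ - c • (1 : Matrix V V ℝ))

open Matrix in
theorem sqForm_apply (c : ℝ) (x y : V → ℝ) :
    G.sqForm c x y = (G.adjMatrix ℝ *ᵥ x) ⬝ᵥ (G.adjMatrix ℝ *ᵥ y) - c * (x ⬝ᵥ y) := by
  rw [sqForm, Matrix.toBilin'_apply', sub_mulVec, dotProduct_sub, smul_mulVec, one_mulVec,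
    dotProduct_smul, smul_eq_mul, ← mulVec_mulVec, dotProduct_mulVec, ← mulVec_transpose,
    transpose_adjMatrix]

theorem sqForm_single_self (c : ℝ) (u : V) :
    G.sqForm c (Pi.single u 1) (Pi.single u 1) = G.degree u - c := by
  rw [sqForm, Matrix.toBilin'_single]
  rw [Matrix.sub_apply, adjMatrix_mul_self_apply_self]
  simp

theorem sqForm_single_ne (c : ℝ) {u v : V} (h : u ≠ v) :
    G.sqForm c (Pi.single u 1) (Pi.single v 1) =
      ((G.neighborFinset u ∩ G.neighborFinset v).card : ℝ) := by
  rw [sqForm, Matrix.toBilin'_single]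
  have e : G.neighborFinset u ∩ G.neighborFinset v =
      (G.neighborFinset v).filter fun w => G.Adj u w := by
    ext w
    simp [and_comm]
  simp [h, e, adjMatrix_apply]

section Gap

open Matrix

variable {c : ℝ} {D : ℕ} (hc : c = (D : ℝ) - 2) (hmax : ∀ v, G.degree v ≤ D)
  (hpos : ∀ x : V → ℝ, x ≠ 0 →
    c * (x ⬝ᵥ x) < (G.adjMatrix ℝ *ᵥ x) ⬝ᵥ (G.adjMatrix ℝ *ᵥ x))

include hpos in
theorem sqForm_isPosDefForm : (G.sqForm c).IsPosDefForm where
  symm x y := by rw [sqForm_apply, sqForm_apply, dotProduct_comm, dotProduct_comm x y]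
  pos x hx := by
    rw [sqForm_apply]
    linarith [hpos x hx]

include hc hmax hpos

theorem degree_eq_or_of_sqForm_pos (v : V) : G.degree v = D ∨ G.degree v = D - 1 := by
  have h := (sqForm_isPosDefForm hpos).pos (Pi.single v 1) (by simp)
  rw [sqForm_single_self, hc] at h
  have h' : (D : ℝ) < G.degree v + 2 := by linarith
  have : D < G.degree v + 2 := by exact_mod_cast h'
  have := hmax v
  omega

omit hmax in
theorem card_common_lt_of_sqForm_pos {u v : V} (h : u ≠ v) :
    2 * (G.neighborFinset u ∩ G.neighborFinset v).card + 2 * D < G.degree u + G.degree v + 4 := by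
  have hp := (sqForm_isPosDefForm hpos).pos_of_functional (φ := LinearMap.proj u)
    (x := Pi.single u 1 - Pi.single v 1) (by simp [h])
  simp only [map_sub, LinearMap.sub_apply, sqForm_single_self, sqForm_single_ne _ h,
    sqForm_single_ne _ h.symm, hc, Finset.inter_comm (G.neighborFinset v)] at hp
  have : (2 * (G.neighborFinset u ∩ G.neighborFinset v).card + 2 * D : ℝ) <
    G.degree u + G.degree v + 4 := by linarith
  exact_mod_cast this

/-- Positivity on the difference of two basis vectors, with both degrees at most D, leaves room for
only one common neighbour. -/
theorem linear_of_sqForm_pos : G.Linear := by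
  intro u w l m h hul hwl hum hwm
  by_contra hne
  have h1 := card_common_lt_of_sqForm_pos hc hpos h
  have h2 : 1 < (G.neighborFinset u ∩ G.neighborFinset w).card := by
    rw [Finset.one_lt_card]
    exact ⟨l, by simp [hul, hwl], m, by simp [hum, hwm], hne⟩
  have := hmax u
  have := hmax w
  omega

theorem sqForm_single_adj {u v : V} (h : G.squareGraph.Adj u v) :
    G.sqForm c (Pi.single u 1) (Pi.single v 1) = 1 := by
  rw [sqForm_single_ne _ h.1]
  obtain ⟨hne, l, hu, hv⟩ := h
  have : (G.neighborFinset u ∩ G.neighborFinset v) = {l} := by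
    ext m
    simp only [Finset.mem_inter, mem_neighborFinset, Finset.mem_singleton]
    constructor
    · rintro ⟨h1, h2⟩
      exact linear_of_sqForm_pos hc hmax hpos hne h1 h2 hu hv
    · rintro rfl
      exact ⟨hu, hv⟩
  rw [this, Finset.card_singleton, Nat.cast_one]

omit hc hmax hpos in
theorem sqForm_single_not_adj {u v : V} (hne : u ≠ v) (h : ¬G.squareGraph.Adj u v) :
    G.sqForm c (Pi.single u 1) (Pi.single v 1) = 0 := by
  rw [sqForm_single_ne _ hne]
  have : (G.neighborFinset u ∩ G.neighborFinset v) = ∅ := by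
    ext m
    simp only [Finset.mem_inter, mem_neighborFinset, Finset.notMem_empty, iff_false]
    exact fun h' => h (squareGraph_adj hne h'.1 h'.2)
  rw [this, Finset.card_empty, Nat.cast_zero]

theorem degree_eq_of_sqForm_pos (hD : 3 ≤ D) (v : V) : G.degree v = D := by
  have hone : G.Linear := linear_of_sqForm_pos hc hmax hpos
  have hB := sqForm_isPosDefForm hpos
  have hdeg := degree_eq_or_of_sqForm_pos hc hmax hpos
  have adj : ∀ {u v : V}, G.squareGraph.Adj u v →
      G.sqForm c (Pi.single u 1) (Pi.single v 1) = 1 :=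
    fun h => sqForm_single_adj hc hmax hpos h
  have self : ∀ {u}, G.degree u = D → G.sqForm c (Pi.single u 1) (Pi.single u 1) = 2 := by
    intro u hu
    rw [sqForm_single_self, hu, hc]
    ring
  have self' : ∀ {u}, G.degree u = D - 1 → G.sqForm c (Pi.single u 1) (Pi.single u 1) = 1 := by
    intro u hu
    rw [sqForm_single_self, hu, hc, Nat.cast_sub (by omega)]
    push_cast
    ring
  have hdef : ∀ {u v}, G.squareGraph.Adj u v → G.degree u = D - 1 → G.degree v = D := by
    intro u v h hu
    refine (hdeg v).resolve_right fun hv => ?_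
    -- Two collinear vertices of degree D - 1 would give norm 1 + 1 - 2 = 0.
    have hp := hB.pos_of_functional (φ := LinearMap.proj u)
      (x := Pi.single u 1 - Pi.single v 1) (by simp [h.1])
    simp only [map_sub, LinearMap.sub_apply, self' hu, self' hv, adj h, adj h.symm] at hp
    norm_num at hp
  have hclique : ∀ {p s s'}, G.degree p = D - 1 → G.squareGraph.Adj p s →
      G.squareGraph.Adj p s' → s ≠ s' → G.squareGraph.Adj s s' := by
    intro p s s' hp hs hs' hne
    by_contra nss
    -- For non-adjacent s and s' the vector s + s' - 2p has norm 2 + 2 + 4 - 8 = 0.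
    have h := hB.pos_of_functional (φ := LinearMap.proj s)
      (x := Pi.single s 1 + Pi.single s' 1 - (2 : ℝ) • Pi.single p 1) (by simp [hne, hs.ne'])
    simp only [map_sub, map_add, map_smul, LinearMap.sub_apply, LinearMap.add_apply,
      LinearMap.smul_apply, smul_eq_mul, self (hdef hs hp), self (hdef hs' hp), self' hp, adj hs,
      adj hs.symm, adj hs', adj hs'.symm, sqForm_single_not_adj hne nss,
      sqForm_single_not_adj hne.symm (fun h => nss h.symm)] at h
    norm_num at h
  refine hone.degree_eq_of_irregular_conditions hD hdeg hdef hclique ?_ v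
  · intro p s s' q hp hs hs' hne hq hq' hqp
    by_contra npq
    have hss := hclique hp hs hs' hne
    have hqq : G.sqForm c (Pi.single q 1) (Pi.single q 1) ≤ 2 := by
      rcases hdeg q with h | h
      · exact (self h).le
      · rw [self' h]
        norm_num
    -- The vector q - s - s' + 2p has norm at most 0, whichever of its two possible degrees q has.
    have h := hB.pos_of_functional (φ := LinearMap.proj q)
      (x := Pi.single q 1 - Pi.single s 1 - Pi.single s' 1 + (2 : ℝ) • Pi.single p 1)
      (by simp [hqp, hq.ne, hq'.ne])
    simp only [map_sub, map_add, map_smul, LinearMap.sub_apply, LinearMap.add_apply,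
      LinearMap.smul_apply, smul_eq_mul, self (hdef hs hp), self (hdef hs' hp), self' hp, adj hs,
      adj hs.symm, adj hs', adj hs'.symm, adj hss, adj hss.symm, adj hq, adj hq.symm, adj hq',
      adj hq'.symm, sqForm_single_not_adj hqp (fun h => npq h.symm),
      sqForm_single_not_adj hqp.symm npq] at h
    linarith

/-- The basis vectors represent the square graph with respect to the form of `A² - (D - 2)`. -/
noncomputable def rootRepresentationSquareGraph (hD : 3 ≤ D) :
    G.squareGraph.RootRepresentation (V → ℝ) where
  form := G.sqForm c
  isPosDefForm := sqForm_isPosDefForm hpos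
  vec v := Pi.single v 1
  coord v := LinearMap.proj v
  coord_self v := by simp
  coord_ne h := by simp [h]
  form_self v := by
    rw [sqForm_single_self, degree_eq_of_sqForm_pos hc hmax hpos hD, hc]
    ring
  form_adj h := sqForm_single_adj hc hmax hpos h
  form_not_adj := sqForm_single_not_adj

end Gap

end SimpleGraph

/-! ### Recognising a projective plane -/

namespace SimpleGraph

variable {V : Type*}

section Transitive

variable {G : SimpleGraph V}

/-- In a connected graph in which having a common neighbour is a transitive relation, any vertex is
joined to `u` by a path of length at most three. -/
theorem Connected.eq_or_squareGraph_adj_or_exists (hconn : G.Connected)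
    (htrans : ∀ {p s x : V}, G.squareGraph.Adj p s → G.squareGraph.Adj p x → s ≠ x →
      G.squareGraph.Adj s x) (u w : V) :
    (w = u ∨ G.squareGraph.Adj u w) ∨ ∃ y, (y = u ∨ G.squareGraph.Adj u y) ∧ G.Adj y w := by
  have h := (reachable_iff_reflTransGen u w).1 (hconn.preconnected u w)
  induction h with
  | refl => exact Or.inl (Or.inl rfl)
  | @tail b w _ hbw ih =>
    rcases ih with h | ⟨y, hy, hyb⟩
    · exact Or.inr ⟨b, h, hbw⟩
    · left
      by_cases hyw : y = w
      · exact hyw ▸ hy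
      · have hyw' : G.squareGraph.Adj y w := squareGraph_adj hyw hyb hbw.symm
        rcases hy with rfl | hy
        · exact Or.inr hyw'
        · by_cases hwu : w = u
          · exact Or.inl hwu
          · exact Or.inr (htrans hy.symm hyw' (Ne.symm hwu))

/-- Vertices joined in the square graph have the same colour, so the alternative ending with one
more edge of G would give w the other colour. -/
theorem squareGraph_adj_of_color_eq (hconn : G.Connected)
    (htrans : ∀ {p s x : V}, G.squareGraph.Adj p s → G.squareGraph.Adj p x → s ≠ x →
      G.squareGraph.Adj s x) (c : G.Coloring (Fin 2)) {u w : V} (hne : u ≠ w) (h : c u = c w) :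
    G.squareGraph.Adj u w := by
  have same : ∀ {a b}, G.squareGraph.Adj a b → c a = c b := by
    rintro a b ⟨-, l, ha, hb⟩
    have := c.valid ha
    have := c.valid hb
    omega
  rcases hconn.eq_or_squareGraph_adj_or_exists htrans u w with (h' | h') | ⟨y, hy, hyw⟩
  · exact absurd h'.symm hne
  · exact h'
  · have hyu : c y = c u := by
      rcases hy with rfl | hy
      exacts [rfl, (same hy).symm]
    exact absurd (hyu.trans h) (c.valid hyw)

end Transitive

theorem isProjectivePlaneIncidenceGraph_of_linear [Fintype V] [DecidableEq V] {G : SimpleGraph V}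
    [DecidableRel G.Adj] (hone : G.Linear) {D : ℕ} (hD : 3 ≤ D) (hreg : ∀ v, G.degree v = D)
    [Nonempty V] (c : G.Coloring (Fin 2))
    (hc : ∀ {u w}, u ≠ w → c u = c w → G.squareGraph.Adj u w) :
    G.IsProjectivePlaneIncidenceGraph (D - 1) := by
  have ex : ∀ v a b, ∃ w, G.Adj v w ∧ w ≠ a ∧ w ≠ b := fun v a b =>
    exists_adj_ne_ne (by rw [hreg]; exact hD) a b
  have notAdj : ∀ {p q l m}, G.Adj p l → G.Adj p m → l ≠ m → G.Adj q l → q ≠ p → ¬G.Adj q m :=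
    fun hpl hpm hlm hql hqp hqm => hlm (hone hqp hql hpl hqm hpm)
  -- The end of a path of length three from l has the other colour, and linearity keeps it off l.
  have far : ∀ l, ∃ p, c p ≠ c l ∧ ¬G.Adj p l := by
    intro l
    obtain ⟨p, hp, -⟩ := ex l l l
    obtain ⟨m, hm, hml, -⟩ := ex p l l
    obtain ⟨q, hq, hqp, -⟩ := ex m p p
    refine ⟨q, ?_, notAdj hm hp.symm hml hq.symm hqp⟩
    have h1 := c.valid hp
    have h2 := c.valid hm
    have h3 := c.valid hq
    omega
  let P := {v // c v = 0}
  let L := {v // ¬c v = 0}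
  let inst : Membership P L := ⟨fun l p => G.Adj p.1 l.1⟩
  have line : ∀ {p q : P}, p ≠ q → ∃ l : L, p ∈ l ∧ q ∈ l := by
    intro p q hpq
    obtain ⟨-, l, hp, hq⟩ := hc (fun h => hpq (Subtype.ext h)) (p.2.trans q.2.symm)
    exact ⟨⟨l, fun h => c.valid hp (p.2.trans h.symm)⟩, hp, hq⟩
  have point : ∀ {l m : L}, l ≠ m → ∃ p : P, p ∈ l ∧ p ∈ m := by
    intro l m hlm
    obtain ⟨-, p, hp, hq⟩ := hc (fun h => hlm (Subtype.ext h))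
      (show c l.1 = c m.1 by have := l.2; have := m.2; omega)
    exact ⟨⟨p, by have := l.2; have := c.valid hp; omega⟩, hp.symm, hq.symm⟩
  have point_of : ∀ {p : P} {l : V}, G.Adj p.1 l → ¬c l = 0 :=
    fun {p l} h h' => c.valid h (p.2.trans h'.symm)
  have line_of : ∀ {l : L} {p : V}, G.Adj l.1 p → c p = 0 := by
    intro l p h
    have := l.2
    have := c.valid h
    omega
  obtain ⟨p₂⟩ : Nonempty P := by
    obtain ⟨v⟩ := ‹Nonempty V›
    by_cases h : c v = 0
    · exact ⟨⟨v, h⟩⟩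
    · obtain ⟨w, hw, -⟩ := ex v v v
      exact ⟨⟨w, line_of (l := ⟨v, h⟩) hw⟩⟩
  -- Take three lines l₂, l₃, n through p₂, with p₁ on n and p₃ on l₂, and let l₁ be another line
  -- through a third point t of l₂. This uses D ≥ 3 both for the lines through p₂ and for the points
  -- of l₂.
  have hconfig : ∃ (p₁ p₂ p₃ : P) (l₁ l₂ l₃ : L), p₁ ∉ l₂ ∧ p₁ ∉ l₃ ∧ p₂ ∉ l₁ ∧ p₂ ∈ l₂ ∧ p₂ ∈ l₃ ∧
      p₃ ∉ l₁ ∧ p₃ ∈ l₂ ∧ p₃ ∉ l₃ := by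
    obtain ⟨l₂, h₂, -⟩ := ex p₂.1 p₂ p₂
    obtain ⟨l₃, h₃, h₃₂, -⟩ := ex p₂.1 l₂ l₂
    obtain ⟨n, hn, hn₂, hn₃⟩ := ex p₂.1 l₂ l₃
    obtain ⟨p₁, hp₁, hp₁₂, -⟩ := ex n p₂ p₂
    obtain ⟨p₃, hp₃, hp₃₂, -⟩ := ex l₂ p₂ p₂
    obtain ⟨t, ht, ht₂, ht₃⟩ := ex l₂ p₂ p₃
    obtain ⟨l₁, hl₁, hl₁₂, -⟩ := ex t l₂ l₂
    have ct := line_of (l := ⟨l₂, point_of h₂⟩) ht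
    exact ⟨⟨p₁, line_of (l := ⟨n, point_of hn⟩) hp₁⟩, p₂,
      ⟨p₃, line_of (l := ⟨l₂, point_of h₂⟩) hp₃⟩, ⟨l₁, point_of (p := ⟨t, ct⟩) hl₁⟩,
      ⟨l₂, point_of h₂⟩, ⟨l₃, point_of h₃⟩, notAdj hn h₂ hn₂ hp₁.symm hp₁₂,
      notAdj hn h₃ hn₃ hp₁.symm hp₁₂, notAdj ht.symm hl₁ hl₁₂.symm h₂ ht₂.symm, h₂, h₃,
      notAdj ht.symm hl₁ hl₁₂.symm hp₃.symm ht₃.symm, hp₃.symm,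
      notAdj h₂ h₃ h₃₂.symm hp₃.symm hp₃₂⟩
  have nondeg : Configuration.Nondegenerate P L :=
    { exists_point := fun l => by
        obtain ⟨p, hp, hpl⟩ := far l.1
        exact ⟨⟨p, by have := l.2; omega⟩, hpl⟩
      exists_line := fun p => by
        obtain ⟨l, hl, hpl⟩ := far p.1
        exact ⟨⟨l, fun h => hl (h.trans p.2.symm)⟩, fun h => hpl h.symm⟩
      eq_or_eq := fun {p q l m} h1 h2 h3 h4 => by
        by_cases hpq : p = q
        · exact Or.inl hpq
        · exact Or.inr (Subtype.ext (hone (fun h => hpq (Subtype.ext h)) h1 h2 h3 h4)) }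
  let plane : Configuration.ProjectivePlane P L :=
    { nondeg with
      mkPoint := fun h => (point h).choose
      mkPoint_ax := fun h => (point h).choose_spec
      mkLine := fun h => (line h).choose
      mkLine_ax := fun h => (line h).choose_spec
      exists_config := hconfig }
  refine ⟨P, L, inferInstance, inferInstance, inst, plane, ?_, ⟨?_⟩⟩
  · have h := Configuration.ProjectivePlane.lineCount_eq L p₂
    have e : {l : L // p₂ ∈ l} ≃ G.neighborSet p₂.1 :=
      { toFun := fun l => ⟨l.1.1, l.2⟩
        invFun := fun l => ⟨⟨l.1, point_of l.2⟩, l.2⟩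
        left_inv := fun _ => rfl
        right_inv := fun _ => rfl }
    rw [Configuration.lineCount, Nat.card_congr e, Nat.card_eq_fintype_card,
      card_neighborSet_eq_degree, hreg] at h
    omega
  · have hiso : ∀ a b : P ⊕ L, G.Adj (Equiv.sumCompl (fun v => c v = 0) a)
        (Equiv.sumCompl (fun v => c v = 0) b) ↔ (pointLineGraph P L).Adj a b := by
      rintro (p | l) (q | m)
      · exact iff_of_false (fun h => c.valid h (p.2.trans q.2.symm)) id
      · exact Iff.rfl
      · exact G.adj_comm _ _
      · refine iff_of_false (fun h => c.valid h ?_) id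
        have := l.2
        have := m.2
        change c l.1 = c m.1
        omega
    exact (RelIso.mk (Equiv.sumCompl fun v => c v = 0) (hiso _ _)).symm

/-! ### The incidence graph of a plane and its index -/

section Plane

open Configuration

variable {P L : Type*} [Membership P L] [ProjectivePlane P L]

theorem exists_pointLineGraph_common {a b : P ⊕ L} (hne : a ≠ b) (h : a.isLeft = b.isLeft) :
    ∃ w, (pointLineGraph P L).Adj a w ∧ (pointLineGraph P L).Adj b w := by
  rcases a with p | l <;> rcases b with q | m <;> simp at h
  · have hpq : p ≠ q := fun h => hne (h ▸ rfl)
    exact ⟨Sum.inr (HasLines.mkLine hpq), HasLines.mkLine_ax hpq⟩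
  · have hlm : l ≠ m := fun h => hne (h ▸ rfl)
    exact ⟨Sum.inl (HasPoints.mkPoint hlm), HasPoints.mkPoint_ax hlm⟩

theorem pointLineGraph_linear : (pointLineGraph P L).Linear := by
  intro a b l m hne hal hbl ham hbm
  rcases a with p | p <;> rcases b with q | q <;> rcases l with l | l <;> rcases m with m | m <;>
    first
    | exact hal.elim
    | exact hbl.elim
    | exact ham.elim
    | exact hbm.elim
    | skip
  · exact congrArg _ ((Nondegenerate.eq_or_eq (P := P) (L := L) hal hbl ham hbm).resolve_left
      fun h => hne (h ▸ rfl))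
  · exact congrArg _ ((Nondegenerate.eq_or_eq (P := P) (L := L) hal ham hbl hbm).resolve_right
      fun h => hne (h ▸ rfl))

omit [ProjectivePlane P L] in
theorem isLeft_ne_of_pointLineGraph_adj {a b : P ⊕ L} (h : (pointLineGraph P L).Adj a b) :
    a.isLeft ≠ b.isLeft := by
  rcases a with p | p <;> rcases b with q | q
  · exact h.elim
  · simp
  · simp
  · exact h.elim

theorem card_neighborSet_pointLineGraph [Finite P] [Finite L] (a : P ⊕ L) :
    Nat.card ((pointLineGraph P L).neighborSet a) = ProjectivePlane.order P L + 1 := by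
  rcases a with p | l
  · rw [← ProjectivePlane.lineCount_eq L p, lineCount]
    refine (Nat.card_congr (Equiv.ofBijective
      (fun l : {l : L // p ∈ l} => (⟨Sum.inr l.1, l.2⟩ : (pointLineGraph P L).neighborSet (Sum.inl p)))
      ⟨fun l m h => ?_, ?_⟩)).symm
    · exact Subtype.ext (Sum.inr_injective (congrArg Subtype.val h))
    · rintro ⟨q | l, h⟩
      · exact h.elim
      · exact ⟨⟨l, h⟩, rfl⟩
  · rw [← ProjectivePlane.pointCount_eq P l, pointCount]
    refine (Nat.card_congr (Equiv.ofBijective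
      (fun p : {p : P // p ∈ l} => (⟨Sum.inl p.1, p.2⟩ : (pointLineGraph P L).neighborSet (Sum.inr l)))
      ⟨fun l m h => ?_, ?_⟩)).symm
    · exact Subtype.ext (Sum.inl_injective (congrArg Subtype.val h))
    · rintro ⟨p | q, h⟩
      · exact ⟨⟨p, h⟩, rfl⟩
      · exact h.elim

end Plane

section Index

variable [Fintype V] [DecidableEq V] {G : SimpleGraph V} [DecidableRel G.Adj]

-- With N the indicator matrix of the two sides, A² - q = N Nᵀ. This is positive semidefinite, so no
-- eigenvalue has modulus below √q. It also kills the difference of two vertices on one side, so it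
-- is not positive definite, as an index above √q would require.
open Matrix in
theorem hlIndex_eq_sqrt (hbip : G.IsBipartite) {q : ℝ} (hq : 0 ≤ q)
    (hreg : ∀ v, (G.degree v : ℝ) = q + 1) (f : V → Bool)
    (hsame : ∀ {u v}, u ≠ v → f u = f v → (G.neighborFinset u ∩ G.neighborFinset v).card = 1)
    (hdiff : ∀ {u v}, f u ≠ f v → (G.neighborFinset u ∩ G.neighborFinset v).card = 0)
    {u v : V} (huv : u ≠ v) (hf : f u = f v) : G.hlIndex = √q := by
  have : Nonempty V := ⟨u⟩
  let N : Matrix V Bool ℝ := Matrix.of fun v b => if f v = b then 1 else 0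
  have hform : ∀ x y, G.sqForm q x y = (x ᵥ* N) ⬝ᵥ (y ᵥ* N) := by
    have e : G.sqForm q = Matrix.toBilin' (N * Nᵀ) := by
      refine LinearMap.BilinForm.ext_basis (Pi.basisFun ℝ V) fun i j => ?_
      rw [Pi.basisFun_apply, Pi.basisFun_apply, Matrix.toBilin'_single, mul_apply]
      have hN : ∑ b, N i b * Nᵀ b j = if f i = f j then 1 else 0 := by
        cases hi : f i <;> cases hj : f j <;> simp [N, hi, hj]
      rw [hN]
      by_cases hij : i = j
      · subst hij
        rw [sqForm_single_self, hreg]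
        simp
      · rw [sqForm_single_ne _ hij]
        by_cases h : f i = f j
        · simp [h, hsame hij h]
        · simp [h, hdiff h]
    intro x y
    rw [e, Matrix.toBilin'_apply', ← mulVec_mulVec, dotProduct_mulVec, mulVec_transpose]
  apply le_antisymm
  · by_contra! h
    have h' := hbip.lt_of_lt_hlIndex (Real.sqrt_nonneg q) h
      (x := Pi.single u 1 - Pi.single v 1) (fun h0 => by
        have := congrFun h0 u
        simp [huv] at this)
    rw [Real.sq_sqrt hq] at h'
    have h2 := sqForm_apply (G := G) q (Pi.single u 1 - Pi.single v 1)
      (Pi.single u 1 - Pi.single v 1)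
    rw [hform] at h2
    have h3 : (Pi.single u 1 - Pi.single v 1 : V → ℝ) ᵥ* N = 0 := by
      ext b
      simp [sub_vecMul, N, hf]
    rw [h3, zero_dotProduct] at h2
    linarith
  · refine le_hlIndex (Real.sqrt_nonneg q) fun x => ?_
    rw [Real.sq_sqrt hq]
    have h2 := sqForm_apply (G := G) q x x
    rw [hform] at h2
    have : 0 ≤ (x ᵥ* N) ⬝ᵥ (x ᵥ* N) := Finset.sum_nonneg fun _ _ => mul_self_nonneg _
    linarith

theorem IsProjectivePlaneIncidenceGraph.hlIndex_eq (hbip : G.IsBipartite) {q : ℕ}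
    (h : G.IsProjectivePlaneIncidenceGraph q) : G.hlIndex = √q := by
  obtain ⟨P, L, _, _, _, _, hq, ⟨e⟩⟩ := h
  have hlin : G.Linear := fun hne h1 h2 h3 h4 => e.injective <|
    pointLineGraph_linear (e.injective.ne hne) (e.map_adj_iff.2 h1) (e.map_adj_iff.2 h2)
      (e.map_adj_iff.2 h3) (e.map_adj_iff.2 h4)
  have hreg : ∀ v, G.degree v = q + 1 := by
    intro v
    rw [← card_neighborSet_eq_degree, ← Nat.card_eq_fintype_card,
      Nat.card_congr (e.mapNeighborSet v), card_neighborSet_pointLineGraph, hq]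
  have hp : ∃ p p' : P, p ≠ p' := by
    obtain ⟨_, p, p', _, l, l', -, -, -, -, h, -, -, h'⟩ :=
      Configuration.ProjectivePlane.exists_config (P := P) (L := L)
    exact ⟨p, p', fun e => h' (e ▸ h)⟩
  obtain ⟨p, p', hpp⟩ := hp
  refine hlIndex_eq_sqrt hbip (Nat.cast_nonneg q) (fun v => by rw [hreg]; push_cast; rfl)
    (fun v => (e v).isLeft) ?_ ?_ (u := e.symm (Sum.inl p)) (v := e.symm (Sum.inl p')) ?_ ?_
  · intro u v hne hf
    obtain ⟨w, hu, hv⟩ := exists_pointLineGraph_common (e.injective.ne hne) hf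
    rw [Finset.card_eq_one]
    have hw : e (e.symm w) = w := e.apply_symm_apply w
    rw [← hw, e.map_adj_iff] at hu hv
    refine ⟨e.symm w, ?_⟩
    ext y
    simp only [Finset.mem_inter, mem_neighborFinset, Finset.mem_singleton]
    constructor
    · rintro ⟨h1, h2⟩
      exact hlin hne h1 h2 hu hv
    · rintro rfl
      exact ⟨hu, hv⟩
  · intro u v hf
    rw [Finset.card_eq_zero]
    ext y
    simp only [Finset.mem_inter, mem_neighborFinset, Finset.notMem_empty, iff_false]
    rintro ⟨h1, h2⟩
    have h1 := isLeft_ne_of_pointLineGraph_adj (e.map_adj_iff.2 h1)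
    have h2 := isLeft_ne_of_pointLineGraph_adj (e.map_adj_iff.2 h2)
    revert h1 h2 hf
    generalize (e u).isLeft = a
    generalize (e v).isLeft = b
    generalize (e y).isLeft = d
    decide +revert
  · simpa using hpp
  · simp

end Index

end SimpleGraph

/-! ### The theorem -/

open SimpleGraph in
theorem theorem2p4 {V : Type*} [Fintype V] [DecidableEq V] (G : SimpleGraph V)
    [DecidableRel G.Adj] (hconn : G.Connected) (hbip : G.IsBipartite) (hΔ : 3 ≤ G.maxDegree) :
    (¬ G.IsProjectivePlaneIncidenceGraph (G.maxDegree - 1) →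
      G.hlIndex ≤ Real.sqrt ((G.maxDegree : ℝ) - 2)) ∧
    (G.IsProjectivePlaneIncidenceGraph (G.maxDegree - 1) →
      G.hlIndex = Real.sqrt ((G.maxDegree : ℝ) - 1)) := by
  constructor
  · intro hnot
    by_contra! h
    have hc : (0 : ℝ) ≤ (G.maxDegree : ℝ) - 2 := by
      have : (3 : ℝ) ≤ G.maxDegree := by exact_mod_cast hΔ
      linarith
    have hpos := fun (x : V → ℝ) (hx : x ≠ 0) =>
      hbip.lt_of_lt_hlIndex (Real.sqrt_nonneg _) h hx
    rw [Real.sq_sqrt hc] at hpos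
    have hmax := G.degree_le_maxDegree
    have hone : G.Linear := linear_of_sqForm_pos rfl hmax hpos
    have hreg := degree_eq_of_sqForm_pos rfl hmax hpos hΔ
    have := hconn.nonempty
    obtain ⟨c⟩ := hbip
    exact hnot (isProjectivePlaneIncidenceGraph_of_linear hone hΔ hreg c fun hne hcc =>
      squareGraph_adj_of_color_eq hconn (hone.squareGraph_trans
        (rootRepresentationSquareGraph rfl hmax hpos hΔ) hΔ hreg) c hne hcc)
  · intro h
    rw [h.hlIndex_eq hbip, Nat.cast_sub (by omega), Nat.cast_one]
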